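/- For $t\in S(\mathbb{C})=\mathbb{C}\setminus\mu_3$ let $X_t\subset\mathbb{P}^2$ be the Hesse cubic $x_0^3+y_0^3+z_0^3=3t\,x_0y_0z_0$, with affine coordinates $x=x_0/z_0$, $y=y_0/z_0$. Put $\zeta=e^{2\pi i/3}$, acting on $X_t$ by $[x_0:y_0:z_0]\mapsto[\zeta x_0:\zeta^2y_0:z_0]$, and let $F_\infty\colon X_t(\mathbb{C})\to X_{\bar t}(\mathbb{C})$ be complex conjugation. Let $$\mathscr{K}=\Big\{\tfrac{x^3+y^3+1}{3xy}\;:\;|x|=|y|=1\Big\}\subset\mathbb{C},$$ a curved triangle with vertices at the cube roots of unity; its interior contains $t_0:=1/\sqrt[3]{2}$. On $X_{t_0}$, let $\lambda'$ be the path from $P=[0:-1:1]$ to $\zeta(P)=[0:-\zeta^2:1]$ whose $y$-coordinate runs along the two line segments from $-1$ to $\zeta-1$ and from $\zeta-1$ to $-\zeta^2$. Let $A=(1+\zeta+\zeta^2)(\lambda')\in H_1(X_{t_0}(\mathbb{C}),\mathbb{Q})$ and $\gamma=A-F_\infty(A)$. Let $t\in S(\mathbb{C})$ not lie in the interior of $\mathscr{K}$.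 Define $\gamma_t\in H_1(X_t(\mathbb{C}),\mathbb{Q})$ as the continuation of $\gamma$ (in the local system of the groups $H_1(X_s(\mathbb{C}),\mathbb{Q})$, $s\in S(\mathbb{C})$) along a path $c$ in $S(\mathbb{C})$ from $t_0$ to $t$ of the following kind: up to some time $c$ stays in $\mathscr{K}$, at that time it is on the open side of $\mathscr{K}$ with end points $\zeta,\zeta^2$ (the side through $-1/3$), and from then on it stays outside of the interior of $\mathscr{K}$. Such paths exist. Let $$\gamma'_t=\overline{X_t(\mathbb{C})\cap\{|x|=1,\ |y|>1\}}$$ (the closure changes nothing if $t\notin\mathscr{K}$), oriented so that $x$ runs counterclockwise on the unit circle. Then $\gamma'_t$ is a simple closed curve, hence defines a class in $H_1(X_t(\mathbb{C}),\mathbb{Q})$; it satisfies $F_\infty(\gamma'_t)=-\gamma'_{\bar t}$, so that $\gamma'_t\in H_1(X_t(\mathbb{C}),\mathbb{Q})^-$ when $t$ is real; and for every path $c$ as above $$\gamma_t=\gamma'_t\quad\text{in } H_1(X_t(\mathbb{C}),\mathbb{Q}).$$ -/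

import Mathlib

noncomputable section

namespace HesseCubic

open CategoryTheory AlgebraicTopology
open scoped unitInterval Simplicial

/-! ### First singular homology with rational coefficients -/

/-- The singular chain complex of `X` with coefficients in `ℚ`. -/
abbrev Chains (X : Type) [TopologicalSpace X] : ChainComplex (ModuleCat.{0} ℚ) ℕ :=
  ((singularChainComplexFunctor (ModuleCat.{0} ℚ)).obj (ModuleCat.of ℚ ℚ)).obj (TopCat.of X)

/-- `H₁(X, ℚ)`: singular homology in degree one with coefficients in `ℚ`. -/
abbrev H1 (X : Type) [TopologicalSpace X] : ModuleCat.{0} ℚ :=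
  ((singularHomologyFunctor (ModuleCat.{0} ℚ) 1).obj (ModuleCat.of ℚ ℚ)).obj (TopCat.of X)

/-- The map `f_* : H₁(X, ℚ) → H₁(Y, ℚ)` induced by a continuous map `f`. -/
def H1map {X Y : Type} [TopologicalSpace X] [TopologicalSpace Y] (f : C(X, Y)) :
    H1 X →ₗ[ℚ] H1 Y :=
  (((singularHomologyFunctor (ModuleCat.{0} ℚ) 1).obj (ModuleCat.of ℚ ℚ)).map
    (TopCat.ofHom f)).hom

/-- The singular `1`-simplex given by a path. -/
def pathSimplex {X : Type} [TopologicalSpace X] (g : C(I, X)) :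
    (TopCat.toSSet.obj (TopCat.of X)) _⦋1⦌ :=
  ((TopCat.of X).toSSetObjEquiv (.op ⦋1⦌)).symm
    (g.comp (stdSimplexHomeomorphUnitInterval : C(stdSimplex ℝ (Fin 2), I)))

/-- The singular `0`-simplex given by a point. -/
def pointSimplex {X : Type} [TopologicalSpace X] (p : X) :
    (TopCat.toSSet.obj (TopCat.of X)) _⦋0⦌ :=
  ((TopCat.of X).toSSetObjEquiv (.op ⦋0⦌)).symm (ContinuousMap.const _ p)

/-- A path as a singular `1`-chain. A chain is given as a linear map from `ℚ`, that is, by its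
value at `1`. -/
def pathChain {X : Type} [TopologicalSpace X] (g : C(I, X)) :
    ModuleCat.of ℚ ℚ ⟶ (Chains X).X 1 :=
  (TopCat.toSSet.obj (TopCat.of X)).ιChainComplex (pathSimplex g)

/-- A point as a singular `0`-chain. -/
def pointChain {X : Type} [TopologicalSpace X] (p : X) :
    ModuleCat.of ℚ ℚ ⟶ (Chains X).X 0 :=
  (TopCat.toSSet.obj (TopCat.of X)).ιChainComplex (pointSimplex p)

lemma pathSimplex_δ_zero {X : Type} [TopologicalSpace X] (g : C(I, X)) :
    (TopCat.toSSet.obj (TopCat.of X)).δ 0 (pathSimplex g) = pointSimplex (g 1) := by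
  apply ((TopCat.of X).toSSetObjEquiv (.op ⦋0⦌)).injective
  ext p
  obtain rfl : p = stdSimplex.vertex 0 := Subsingleton.elim (α := stdSimplex ℝ (Fin 1)) _ _
  change g (stdSimplexHomeomorphUnitInterval (stdSimplex.map (SimplexCategory.δ 0)
    (stdSimplex.vertex 0 : stdSimplex ℝ (Fin 1)))) = g 1
  rw [stdSimplex.map_vertex]
  rfl

lemma pathSimplex_δ_one {X : Type} [TopologicalSpace X] (g : C(I, X)) :
    (TopCat.toSSet.obj (TopCat.of X)).δ 1 (pathSimplex g) = pointSimplex (g 0) := by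
  apply ((TopCat.of X).toSSetObjEquiv (.op ⦋0⦌)).injective
  ext p
  obtain rfl : p = stdSimplex.vertex 0 := Subsingleton.elim (α := stdSimplex ℝ (Fin 1)) _ _
  change g (stdSimplexHomeomorphUnitInterval (stdSimplex.map (SimplexCategory.δ 1)
    (stdSimplex.vertex 0 : stdSimplex ℝ (Fin 1)))) = g 0
  rw [stdSimplex.map_vertex]
  rfl

/-- The boundary of a path is its end point minus its starting point. -/
lemma pathChain_d {X : Type} [TopologicalSpace X] (g : C(I, X)) :
    pathChain g ≫ (Chains X).d 1 0 = pointChain (g 1) - pointChain (g 0) := by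
  have h := (TopCat.toSSet.obj (TopCat.of X)).ιChainComplex_d (R := ModuleCat.of ℚ ℚ)
    (pathSimplex g)
  refine h.trans ?_
  rw [Fin.sum_univ_two]
  simp only [Fin.val_zero, Fin.val_one, pow_zero, pow_one, one_smul, neg_smul,
    pathSimplex_δ_zero, pathSimplex_δ_one, pointChain, ← sub_eq_add_neg]
  rfl

/-- The homology class of a `1`-cycle. -/
def cycleClass {X : Type} [TopologicalSpace X] (z : ModuleCat.of ℚ ℚ ⟶ (Chains X).X 1)
    (hz : z ≫ (Chains X).d 1 0 = 0) : H1 X :=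
  ((Chains X).liftCycles z 0 (by simp) hz ≫ (Chains X).homologyπ 1).hom (1 : ℚ)

/-- The homology class of a closed path. -/
def loopClass {X : Type} [TopologicalSpace X] (g : C(I, X)) (hg : g 0 = g 1) : H1 X :=
  cycleClass (pathChain g) (by rw [pathChain_d, hg, sub_self])

/-! ### The Hesse cubic curves -/

open scoped LinearAlgebra.Projectivization

/-- The complex projective plane. -/
abbrev P2 : Type := ℙ ℂ (Fin 3 → ℂ)

/-- The usual (quotient) topology of the complex projective plane. -/
instance : TopologicalSpace P2 :=
  inferInstanceAs (TopologicalSpace (Quotient (projectivizationSetoid ℂ (Fin 3 → ℂ))))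

/-- The Hesse cubic `X_t(ℂ) : x₀³ + y₀³ + z₀³ = 3 t x₀ y₀ z₀` in the projective plane, with the
topology of a subspace. -/
def hesse (t : ℂ) : Set P2 :=
  {p | p.rep 0 ^ 3 + p.rep 1 ^ 3 + p.rep 2 ^ 3 = 3 * t * p.rep 0 * p.rep 1 * p.rep 2}

lemma mk_mem_hesse {t : ℂ} (v : Fin 3 → ℂ) (hv : v ≠ 0) :
    Projectivization.mk ℂ v hv ∈ hesse t ↔
      v 0 ^ 3 + v 1 ^ 3 + v 2 ^ 3 = 3 * t * v 0 * v 1 * v 2 := by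
  obtain ⟨a, ha⟩ := Projectivization.exists_smul_eq_mk_rep ℂ v hv
  have ha0 : (a : ℂ) ^ 3 ≠ 0 := pow_ne_zero 3 a.ne_zero
  simp only [hesse, Set.mem_ofPred_eq, ← ha, Units.smul_def, Pi.smul_apply, smul_eq_mul]
  constructor
  · intro h
    apply mul_left_cancel₀ ha0
    linear_combination h
  · intro h
    linear_combination (a : ℂ) ^ 3 * h

/-- The base of the smooth part of the family, `S(ℂ) = ℂ ∖ μ₃`. -/
def smoothBase : Set ℂ := {t | t ^ 3 ≠ 1}

lemma affine_ne_zero (x y : ℂ) : (![x, y, 1] : Fin 3 → ℂ) ≠ 0 := fun h => by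
  simpa using congrFun h 2

/-- The point `[x : y : 1]` of the projective plane. -/
def affine (x y : ℂ) : P2 := Projectivization.mk ℂ ![x, y, 1] (affine_ne_zero x y)

lemma continuous_projectivization_map {τ : ℂ →+* ℂ} (f : (Fin 3 → ℂ) →ₛₗ[τ] (Fin 3 → ℂ))
    (hf : Function.Injective f) (hc : Continuous f) :
    Continuous (Projectivization.map f hf : P2 → P2) := by
  refine Continuous.quotient_map' (Continuous.subtype_mk (hc.comp continuous_subtype_val) _) _

/-- The primitive cube root of unity `ζ = e^{2πi/3}`. -/
def zeta : ℂ := Complex.exp (2 * Real.pi * Complex.I / 3)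

lemma zeta_pow_three : zeta ^ 3 = 1 := by
  rw [zeta, ← Complex.exp_nat_mul]
  convert Complex.exp_two_pi_mul_I using 2
  push_cast
  ring

lemma zeta_ne_zero : zeta ≠ 0 := Complex.exp_ne_zero _

/-- The linear map `(x₀, y₀, z₀) ↦ (ζ x₀, ζ² y₀, z₀)`. -/
def zetaLin : (Fin 3 → ℂ) →ₗ[ℂ] (Fin 3 → ℂ) where
  toFun v := ![zeta * v 0, zeta ^ 2 * v 1, v 2]
  map_add' v w := by ext i; fin_cases i <;> simp [mul_add]
  map_smul' a v := by ext i; fin_cases i <;> simp [mul_left_comm]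

lemma zetaLin_injective : Function.Injective zetaLin := by
  intro v w h
  have h0 := congrFun h 0
  have h1 := congrFun h 1
  have h2 := congrFun h 2
  simp [zetaLin, zeta_ne_zero] at h0 h1 h2
  ext i; fin_cases i <;> assumption

lemma continuous_zetaLin : Continuous zetaLin := zetaLin.continuous_of_finiteDimensional

/-- Coordinatewise complex conjugation. -/
def conjLin : (Fin 3 → ℂ) →ₛₗ[starRingEnd ℂ] (Fin 3 → ℂ) where
  toFun v i := starRingEnd ℂ (v i)
  map_add' v w := by ext i; simp
  map_smul' a v := by ext i; simp

lemma conjLin_injective : Function.Injective conjLin := by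
  intro v w h
  ext i
  exact (starRingEnd ℂ).injective (congrFun h i)

lemma continuous_conjLin : Continuous conjLin :=
  continuous_pi fun i => Complex.continuous_conj.comp (continuous_apply i)

lemma zeta_mem {t : ℂ} {p : P2} (hp : p ∈ hesse t) :
    Projectivization.map zetaLin zetaLin_injective p ∈ hesse t := by
  induction p using Projectivization.ind with
  | h v hv =>
    rw [Projectivization.map_mk, mk_mem_hesse]
    rw [mk_mem_hesse] at hp
    simp only [zetaLin, LinearMap.coe_mk, AddHom.coe_mk, Matrix.cons_val_zero,
      Matrix.cons_val_one, Matrix.cons_val]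
    linear_combination hp + (v 0 ^ 3 + (zeta ^ 3 + 1) * v 1 ^ 3
      - 3 * t * v 0 * v 1 * v 2) * zeta_pow_three

lemma conj_mem {t s : ℂ} (h : s = starRingEnd ℂ t) {p : P2} (hp : p ∈ hesse t) :
    Projectivization.map conjLin conjLin_injective p ∈ hesse s := by
  subst h
  induction p using Projectivization.ind with
  | h v hv =>
    rw [Projectivization.map_mk, mk_mem_hesse]
    rw [mk_mem_hesse] at hp
    have h3 : starRingEnd ℂ 3 = 3 := Complex.conj_ofNat 3
    simpa [conjLin, h3] using congrArg (starRingEnd ℂ) hp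

/-- The action of `ζ` on `X_t`, `[x₀ : y₀ : z₀] ↦ [ζ x₀ : ζ² y₀ : z₀]`. -/
def zetaMap (t : ℂ) : C(hesse t, hesse t) where
  toFun p := ⟨Projectivization.map zetaLin zetaLin_injective p.1, zeta_mem p.2⟩
  continuous_toFun := ((continuous_projectivization_map _ zetaLin_injective
    continuous_zetaLin).comp continuous_subtype_val).subtype_mk _

/-- Complex conjugation `F_∞ : X_t(ℂ) → X_s(ℂ)`, where `s` is the complex conjugate of `t`. -/
def conjMap {t s : ℂ} (h : s = starRingEnd ℂ t) : C(hesse t, hesse s) where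
  toFun p := ⟨Projectivization.map conjLin conjLin_injective p.1, conj_mem h p.2⟩
  continuous_toFun := ((continuous_projectivization_map _ conjLin_injective
    continuous_conjLin).comp continuous_subtype_val).subtype_mk _

/-! ### The cycle `A` and the cycle `γ = A - F_∞(A)` over the base point -/

/-- The base point `1/∛2`. -/
def basePt : ℂ := (((2 : ℝ) ^ (1 / 3 : ℝ))⁻¹ : ℝ)

lemma basePt_eq_conj : basePt = starRingEnd ℂ basePt := (Complex.conj_ofReal _).symm

/-- The point `P = [0 : -1 : 1]` of `X_t`. -/
def pointP (t : ℂ) : hesse t :=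
  ⟨affine 0 (-1), by rw [affine, mk_mem_hesse]; simp; norm_num⟩

lemma zetaMap_three (t : ℂ) (p : hesse t) : zetaMap t (zetaMap t (zetaMap t p)) = p := by
  obtain ⟨p, hp⟩ := p
  apply Subtype.ext
  change Projectivization.map zetaLin zetaLin_injective
    (Projectivization.map zetaLin zetaLin_injective
      (Projectivization.map zetaLin zetaLin_injective p)) = p
  induction p using Projectivization.ind with
  | h v hv =>
    simp only [Projectivization.map_mk]
    congr 1
    ext i
    fin_cases i
    · simp only [zetaLin, LinearMap.coe_mk, AddHom.coe_mk, Matrix.cons_val_zero, Fin.zero_eta]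
      linear_combination v 0 * zeta_pow_three
    · simp only [zetaLin, LinearMap.coe_mk, AddHom.coe_mk, Matrix.cons_val_one, Fin.mk_one,
        Matrix.cons_val_zero]
      linear_combination (v 1 * (zeta ^ 3 + 1)) * zeta_pow_three
    · simp [zetaLin]

/-- The polygonal path in the `y`-plane which runs along two line segments, from `-1` to `ζ - 1`
and from there to `-ζ²`. -/
def polygonY (s : ℝ) : ℂ :=
  if s ≤ 1 / 2 then (1 - 2 * s) * (-1) + 2 * s * (zeta - 1)
  else (2 - 2 * s) * (zeta - 1) + (2 * s - 1) * (-zeta ^ 2)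

/-- `l` is the path from `P` to `ζ(P) = [0 : -ζ² : 1]` on the curve over the base point whose
`y`-coordinate runs along the two segments of `polygonY`. -/
def IsLambdaPath (l : Path (pointP basePt) (zetaMap basePt (pointP basePt))) : Prop :=
  ∀ s : I, ∃ x : ℂ, (l s : P2) = affine x (polygonY s)

/-- The singular `1`-chain `(1 + ζ + ζ²)(l)`. -/
def chainA (l : Path (pointP basePt) (zetaMap basePt (pointP basePt))) :
    ModuleCat.of ℚ ℚ ⟶ (Chains (hesse basePt)).X 1 :=
  pathChain l.toContinuousMap + pathChain ((zetaMap basePt).comp l.toContinuousMap) +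
    pathChain ((zetaMap basePt).comp ((zetaMap basePt).comp l.toContinuousMap))

lemma chainA_d (l : Path (pointP basePt) (zetaMap basePt (pointP basePt))) :
    chainA l ≫ (Chains (hesse basePt)).d 1 0 = 0 := by
  simp only [chainA, Preadditive.add_comp, pathChain_d]
  simp [zetaMap_three]

/-- `a` is the homology class of the cycle `A = (1 + ζ + ζ²)(λ')` on the curve over the base
point. -/
def IsClassA (a : H1 (hesse basePt)) : Prop :=
  ∃ l, IsLambdaPath l ∧ a = cycleClass (chainA l) (chainA_d l)

/-- The class `a - F_∞(a)` on the curve over the (real) base point. -/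
def antiInvariantPart (a : H1 (hesse basePt)) : H1 (hesse basePt) :=
  a - H1map (conjMap basePt_eq_conj) a

/-! ### Continuation of homology classes along a path in the base -/

/-- The total space of the family of curves `X_{c(s)}`, `0 ≤ s ≤ 1`, over a path `c`. -/
def pathFamily {t₀ t₁ : ℂ} (c : Path t₀ t₁) : Set (I × P2) := {q | q.2 ∈ hesse (c q.1)}

/-- The inclusion of the curve `X_t` as the fibre over `s`, where `c(s) = t`. -/
def fibreIncl {t₀ t₁ : ℂ} (c : Path t₀ t₁) (s : I) {t : ℂ} (h : c s = t) :
    C(hesse t, pathFamily c) where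
  toFun p := ⟨(s, p.1), by subst h; exact p.2⟩
  continuous_toFun := by fun_prop

/-- `b ∈ H₁(X_{t₁}, ℚ)` is the continuation of `a ∈ H₁(X_{t₀}, ℚ)` along the path `c` from `t₀` to
`t₁`, i.e. `b` is the parallel transport of `a` in the local system of the groups `H₁(X_t, ℚ)`: the
two classes agree in the homology of the family over `c`. When `c` runs in the smooth part of the
base, this family is a trivial fibre bundle over an interval, and the inclusions of both end
fibres are homotopy equivalences. -/
def IsContinuation {t₀ t₁ : ℂ} (c : Path t₀ t₁) (a : H1 (hesse t₀)) (b : H1 (hesse t₁)) : Prop :=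
  H1map (fibreIncl c 0 c.source) a = H1map (fibreIncl c 1 c.target) b

/-- The curved triangle: the set of values of `(x³ + y³ + 1)/(3xy)` on the torus
`|x| = |y| = 1`. -/
def curvedTriangle : Set ℂ :=
  {w | ∃ x y : ℂ, ‖x‖ = 1 ∧ ‖y‖ = 1 ∧ w = (x ^ 3 + y ^ 3 + 1) / (3 * x * y)}

/-- The paths along which `γ` is continued from the base point (which lies in the curved triangle)
to points outside of its interior. Such a path runs in `S(ℂ)`; it stays in the curved triangle up
to some time `s₀`, when it is on the open side with end points `ζ` and `ζ²` (the side that contains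
`-1/3`, that is, the part of the boundary with `2π/3 < arg < 4π/3`), and from then on it stays
outside of the interior. -/
def IsAdmissible {t : ℂ} (c : Path basePt t) : Prop :=
  (∀ s, c s ∈ smoothBase) ∧
    ∃ s₀ : I, (∀ s ≤ s₀, c s ∈ curvedTriangle) ∧ 2 * (c s₀).re < -‖c s₀‖ ∧
      ∀ s ≥ s₀, c s ∉ interior curvedTriangle

/-! ### The cycle of Deninger -/

/-- The set `X_t ∩ {|x| = 1, |y| > 1}`. -/
def deningerSet (t : ℂ) : Set (hesse t) :=
  {p | ∃ x y : ℂ, (p : P2) = affine x y ∧ ‖x‖ = 1 ∧ 1 < ‖y‖}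

/-- `g` is a simple closed path which parametrizes the closure of `X_t ∩ {|x| = 1, |y| > 1}`, in the
direction in which `x` runs counterclockwise on the unit circle. (When `t` is not in the curved
triangle, the set is already closed; when `t` is on the boundary of the triangle, the closure adds
finitely many points with `|y| = 1`.) -/
structure IsDeningerLoop {t : ℂ} (g : C(I, hesse t)) : Prop where
  closed : g 0 = g 1
  simple : Set.InjOn g (Set.Ico 0 1)
  range_eq : Set.range g = closure (deningerSet t)
  counterclockwise : ∃ θ : I → ℝ, Continuous θ ∧ StrictMono θ ∧
    ∀ s, ∃ y : ℂ, (g s : P2) = affine (Complex.exp (θ s * Complex.I)) y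

/-- `b` is the homology class of the cycle `γ' = X_t ∩ {|x| = 1, |y| > 1}`. -/
def IsDeningerClass {t : ℂ} (b : H1 (hesse t)) : Prop :=
  ∃ (g : C(I, hesse t)) (hg : IsDeningerLoop g), b = loopClass g hg.closed

end HesseCubic

end

/-!
Write `f(t) = 3|t|⁴ - 8 Re t³ + 6|t|² - 1`. Up to the factor `27`, this is the discriminant of the
self-inversive cubic `X³ - 3tX² + 3t̄X - 1`, whose roots are all on the unit circle exactly when `t`
is in the curved triangle. So the triangle is the set `f ≤ 0`, and since `f` increases along rays,
its interior is the set `f < 0` (`triangleFn_nonpos`, `triangleFn_nonneg`, `notMem_interior`).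

*Continuation.* A point of a Hesse cubic can be moved to a neighbouring cubic along the conjugate
of the gradient. Over compact parts of the smooth base this gives the homotopy lifting property
(`exists_lift`). Therefore continuation along a path is unique (`injective_H1map_fibreIncl`), it
only depends on the homotopy class of the path (`IsContinuation.of_homotopy`), and it is given by
explicit continuous families of closed paths (`isContinuation_loopClass`). Identities between
classes are proved for `1`-chains modulo boundaries (`ChainClass`).

*The cycle of Deninger.* The points of `X_t` with `|x| = 1` are `[e^{iη} : y : e^{-iη}]`, where `y`
is a root of `y³ - 3ty + 2c` and `c = cos 3η`. If `f(t) ≥ 0` and `t³ ≠ 1`, one root is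
in the closed unit disc and strictly smaller in absolute value than the other two, which are not
in the open disc: this is so for large `t`, and no root crosses the circle on the ray from infinity
to `t` (`exists_isRootTriple_norm`, `IsRootTriple.norm_ne`). The other two
roots are interchanged by `η ↦ η + π` (up to the sign of `y`), and together they form one closed
curve with period `2π` (`deninger`). Every parametrization of the cycle is homologous to this one
(`isDeningerClass_iff`), complex conjugation reverses it (`H1map_conjMap_of_isDeningerClass`), and
its class is locally constant in `t` (`isContinuation_of_isDeningerClass`).

*The cycle `A`.* For `0 ≤ t ≤ 1`, Cardano's formula with principal roots gives a sheet of the curve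
over the closed unit disc in the coordinate `1/y` (`sheet`). Two such sheets contain a path `λ` over
the polygon of the statement; it is the only one over `t = 1/∛2` (`IsLambdaPath.eq`), and it varies
continuously with `t`, down to the Fermat cubic `t = 0` (`isContinuation_lambdaClass`). There the
sheet is a disc whose boundary lies over `|y| = 1`, and so `λ - F_∞(λ)` is homologous to a third of
the circle on which `|y| = 1` and `x²/y` is real (`pathClass_lambda_sub`). The three translates of
this third under `ζ` form the whole circle: on the Fermat cubic, `A - F_∞(A)` is the class of
`yCircle` (`lambdaClass_sub`).

*Comparison.* The circle persists for all real `t ≤ 0`. At `t = -100` it is homotopic to the cycle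
of Deninger: both project to the annulus `1 ≤ |y| ≤ 20`, over which `x` is a function of `y`
(`loopClass_deninger_eq_yCircle`). From `-100` the cycle of Deninger is continued, outside of the
triangle and within the sector `2π/3 < arg t < 4π/3`, to the point where a given admissible path
leaves the triangle (`exists_continuation_sector`). The path just described and the first part of
the admissible path both run in the plane slit along the rays from the cube roots of unity to
infinity, which is star-shaped; hence they are homotopic (`IsContinuation.of_slitBase`). On the
rest of the admissible path the cycle of Deninger is locally constant
(`IsAdmissible.isContinuation`).
-/

noncomputable section

namespace HesseCubic

open CategoryTheory AlgebraicTopology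
open scoped unitInterval LinearAlgebra.Projectivization

section

open scoped Simplicial

/-! ### One-chains modulo boundaries -/

section ChainClasses

variable {X Y : Type} [TopologicalSpace X] [TopologicalSpace Y]

/-- The group of rational singular `1`-boundaries of `X`, as a subgroup of the `1`-chains. -/
def boundaries (X : Type) [TopologicalSpace X] :
    AddSubgroup (ModuleCat.of ℚ ℚ ⟶ (Chains X).X 1) :=
  (Preadditive.rightComp (ModuleCat.of ℚ ℚ) ((Chains X).d 2 1)).range

/-- Singular `1`-chains (not necessarily cycles) modulo boundaries. Relations between the homology
classes of cycles made of paths are proved in this group, where each path has a class of its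
own. -/
abbrev ChainClass (X : Type) [TopologicalSpace X] : Type :=
  (ModuleCat.of ℚ ℚ ⟶ (Chains X).X 1) ⧸ boundaries X

/-- The class of a path modulo boundaries. -/
def pathClass (g : C(I, X)) : ChainClass X := QuotientAddGroup.mk (pathChain g)

/-- The chain map induced by a continuous map. -/
abbrev chainsMap (f : C(X, Y)) : Chains X ⟶ Chains Y :=
  ((singularChainComplexFunctor (ModuleCat.{0} ℚ)).obj (ModuleCat.of ℚ ℚ)).map (TopCat.ofHom f)

lemma pathChain_map (f : C(X, Y)) (g : C(I, X)) :
    pathChain g ≫ (chainsMap f).f 1 = pathChain (f.comp g) := by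
  exact SSet.ι_chainComplexMap_f _ _ (TopCat.toSSet.map (TopCat.ofHom f))
    (ModuleCat.of ℚ ℚ) (pathSimplex g)

/-- The map induced on `1`-chains modulo boundaries. -/
def ChainClass.map (f : C(X, Y)) : ChainClass X →+ ChainClass Y :=
  QuotientAddGroup.map _ _ (Preadditive.rightComp (ModuleCat.of ℚ ℚ) ((chainsMap f).f 1)) (by
    rintro _ ⟨w, rfl⟩
    refine ⟨w ≫ (chainsMap f).f 2, ?_⟩
    simp [Preadditive.rightComp])

lemma ChainClass.map_mk (f : C(X, Y)) (z : ModuleCat.of ℚ ℚ ⟶ (Chains X).X 1) :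
    ChainClass.map f (QuotientAddGroup.mk z) = QuotientAddGroup.mk (z ≫ (chainsMap f).f 1) := rfl

lemma ChainClass.map_pathClass (f : C(X, Y)) (g : C(I, X)) :
    ChainClass.map f (pathClass g) = pathClass (f.comp g) := by
  rw [pathClass, ChainClass.map_mk, pathChain_map, pathClass]

lemma cycleClass_sub (z z' : ModuleCat.of ℚ ℚ ⟶ (Chains X).X 1)
    (hz : z ≫ (Chains X).d 1 0 = 0) (hz' : z' ≫ (Chains X).d 1 0 = 0) :
    cycleClass (z - z') (by rw [Preadditive.sub_comp, hz, hz', sub_zero]) =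
      cycleClass z hz - cycleClass z' hz' := by
  have : (Chains X).liftCycles (z - z') 0 (by simp)
      (by rw [Preadditive.sub_comp, hz, hz', sub_zero]) =
      (Chains X).liftCycles z 0 (by simp) hz - (Chains X).liftCycles z' 0 (by simp) hz' := by
    rw [← cancel_mono ((Chains X).iCycles 1)]
    simp only [Preadditive.sub_comp, HomologicalComplex.liftCycles_i]
  simp only [cycleClass, this, Preadditive.sub_comp]
  rfl

/-- Cycles which agree modulo boundaries have the same homology class. -/
lemma cycleClass_eq {z z' : ModuleCat.of ℚ ℚ ⟶ (Chains X).X 1}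
    (hz : z ≫ (Chains X).d 1 0 = 0) (hz' : z' ≫ (Chains X).d 1 0 = 0)
    (h : (QuotientAddGroup.mk z : ChainClass X) = QuotientAddGroup.mk z') :
    cycleClass z hz = cycleClass z' hz' := by
  rw [← sub_eq_zero, ← cycleClass_sub]
  obtain ⟨w, hw⟩ := (QuotientAddGroup.eq_iff_sub_mem.1 h : z - z' ∈ boundaries X)
  have h0 := (Chains X).liftCycles_homologyπ_eq_zero_of_boundary (z - z') 0 (by simp)
    (i' := 2) w hw.symm
  simp only [cycleClass]
  rw [h0]
  rfl

lemma H1map_cycleClass (f : C(X, Y)) (z : ModuleCat.of ℚ ℚ ⟶ (Chains X).X 1)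
    (hz : z ≫ (Chains X).d 1 0 = 0) :
    H1map f (cycleClass z hz) = cycleClass (z ≫ (chainsMap f).f 1)
      (by rw [Category.assoc, (chainsMap f).comm, reassoc_of% hz, Limits.zero_comp]) := by
  have h := HomologicalComplex.homologyπ_naturality (chainsMap f) 1
  have h2 : (Chains X).liftCycles z 0 (by simp) hz ≫ (Chains X).homologyπ 1 ≫
      HomologicalComplex.homologyMap (chainsMap f) 1 =
      (Chains Y).liftCycles (z ≫ (chainsMap f).f 1) 0 (by simp)
      (by rw [Category.assoc, (chainsMap f).comm, reassoc_of% hz, Limits.zero_comp]) ≫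
      (Chains Y).homologyπ 1 := by
    rw [h, ← Category.assoc, HomologicalComplex.liftCycles_comp_cyclesMap]
  exact congrArg (fun φ : ModuleCat.of ℚ ℚ ⟶ H1 Y => φ.hom (1 : ℚ)) h2

lemma H1map_loopClass (f : C(X, Y)) (g : C(I, X)) (hg : g 0 = g 1) :
    H1map f (loopClass g hg) = loopClass (f.comp g) (congrArg f hg) := by
  rw [loopClass, H1map_cycleClass]
  exact cycleClass_eq _ _ (by rw [pathChain_map])

lemma loopClass_eq {g g' : C(I, X)} (hg : g 0 = g 1) (hg' : g' 0 = g' 1)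
    (h : pathClass g = pathClass g') : loopClass g hg = loopClass g' hg' :=
  cycleClass_eq _ _ h

lemma cycleClass_eq_neg {z z' : ModuleCat.of ℚ ℚ ⟶ (Chains X).X 1}
    (hz : z ≫ (Chains X).d 1 0 = 0) (hz' : z' ≫ (Chains X).d 1 0 = 0)
    (h : (QuotientAddGroup.mk z : ChainClass X) = - QuotientAddGroup.mk z') :
    cycleClass z hz = - cycleClass z' hz' := by
  have hd : (z' - z') ≫ (Chains X).d 1 0 = 0 := by rw [Preadditive.sub_comp, sub_self]
  have h1 : cycleClass z hz = cycleClass (z' - z' - z')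
      (by rw [Preadditive.sub_comp, hd, hz', sub_zero]) :=
    cycleClass_eq _ _ (by rw [h, sub_self, zero_sub]; rfl)
  rw [h1, cycleClass_sub (z' - z') z' hd hz', cycleClass_sub z' z' hz' hz', sub_self, zero_sub]

/-- Homotopic maps induce the same map in homology. -/
lemma H1map_eq_of_homotopy {f g : C(X, Y)} (h : f.Homotopy g) : H1map f = H1map g := by
  have := TopCat.Homotopy.congr_homologyMap_singularChainComplexFunctor
    (f := TopCat.ofHom f) (g := TopCat.ofHom g) h (ModuleCat.of ℚ ℚ) 1
  exact congrArg ModuleCat.Hom.hom this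

lemma H1map_comp {Z : Type} [TopologicalSpace Z] (g : C(Y, Z)) (f : C(X, Y)) (a : H1 X) :
    H1map (g.comp f) a = H1map g (H1map f a) := by
  have := ((singularHomologyFunctor (ModuleCat.{0} ℚ) 1).obj (ModuleCat.of ℚ ℚ)).map_comp
    (TopCat.ofHom f) (TopCat.ofHom g)
  exact congrArg (fun φ : H1 X ⟶ H1 Z => φ.hom a) this

lemma H1map_id (a : H1 X) : H1map (ContinuousMap.id X) a = a := by
  have := ((singularHomologyFunctor (ModuleCat.{0} ℚ) 1).obj (ModuleCat.of ℚ ℚ)).map_id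
    (TopCat.of X)
  exact congrArg (fun φ : H1 X ⟶ H1 X => φ.hom a) this

end ChainClasses

/-! ### Relations between paths modulo boundaries -/

section Paths

variable {X : Type} [TopologicalSpace X] {E : Type} [AddCommGroup E] [Module ℝ E]
  [TopologicalSpace E] [ContinuousAdd E] [ContinuousSMul ℝ E]

/-- The segment from `a` to `b` in a convex set. -/
def convexSegment {C : Set E} (hC : Convex ℝ C) (a b : C) : C(I, C) where
  toFun s := ⟨(1 - (s : ℝ)) • (a : E) + (s : ℝ) • (b : E),
    hC a.2 b.2 (sub_nonneg.2 s.2.2) s.2.1 (by ring)⟩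
  continuous_toFun := by fun_prop

/-- The affine `2`-simplex with vertices `a`, `b`, `c` in a convex set. -/
def convexTriangle {C : Set E} (hC : Convex ℝ C) (a b c : C) : C(stdSimplex ℝ (Fin 3), C) where
  toFun p := ⟨p.1 0 • (a : E) + p.1 1 • (b : E) + p.1 2 • (c : E), by
    have h := hC.sum_mem (t := Finset.univ) (w := p.1) (z := ![(a : E), b, c])
      (fun i _ => p.2.1 i) p.2.2 (by intro i _; fin_cases i <;> simp)
    simpa [Fin.sum_univ_three] using h⟩
  continuous_toFun := by
    refine Continuous.subtype_mk ?_ _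
    have h (i : Fin 3) : Continuous fun p : stdSimplex ℝ (Fin 3) => p.1 i :=
      (continuous_apply i).comp continuous_subtype_val
    exact (((h 0).smul continuous_const).add ((h 1).smul continuous_const)).add
      ((h 2).smul continuous_const)

/-- The singular `2`-simplex given by a map. -/
def triangleSimplex (τ : C(stdSimplex ℝ (Fin 3), X)) :
    (TopCat.toSSet.obj (TopCat.of X)) _⦋2⦌ :=
  ((TopCat.of X).toSSetObjEquiv (.op ⦋2⦌)).symm τ

lemma triangleSimplex_δ {i : Fin 3} (τ : C(stdSimplex ℝ (Fin 3), X)) (g : C(I, X))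
    (h : ∀ p : stdSimplex ℝ (Fin 2), τ (stdSimplex.map (SimplexCategory.δ i) p) =
      g (stdSimplexHomeomorphUnitInterval p)) :
    (TopCat.toSSet.obj (TopCat.of X)).δ i (triangleSimplex τ) = pathSimplex g := by
  apply ((TopCat.of X).toSSetObjEquiv (.op ⦋1⦌)).injective
  ext p
  exact h p

lemma stdSimplex_map_apply {f : Fin 2 → Fin 3} {i k : Fin 3} (h0 : f 0 = i) (h1 : f 1 = k)
    (p : stdSimplex ℝ (Fin 2)) (j : Fin 3) :
    (stdSimplex.map f p).1 j = (if i = j then p.1 0 else 0) + (if k = j then p.1 1 else 0) := by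
  have h := FunOnFinite.linearMap_apply_apply ℝ ℝ f p.1 j
  refine h.trans ?_
  rw [Finset.sum_filter, Fin.sum_univ_two, h0, h1]

/-- The three sides of an affine triangle. -/
lemma pathClass_triangle {C : Set E} (hC : Convex ℝ C) (G : C(C, X)) (a b c : C) :
    pathClass (G.comp (convexSegment hC a b)) + pathClass (G.comp (convexSegment hC b c)) =
      pathClass (G.comp (convexSegment hC a c)) := by
  have key := (TopCat.toSSet.obj (TopCat.of X)).ιChainComplex_d (R := ModuleCat.of ℚ ℚ)
    (triangleSimplex (G.comp (convexTriangle hC a b c)))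
  have hs (p : stdSimplex ℝ (Fin 2)) : p.1 0 = 1 - p.1 1 := by
    have := p.2.2
    rw [Fin.sum_univ_two] at this
    linarith
  have h0 : (TopCat.toSSet.obj (TopCat.of X)).δ 0
      (triangleSimplex (G.comp (convexTriangle hC a b c))) =
        pathSimplex (G.comp (convexSegment hC b c)) := by
    refine triangleSimplex_δ _ _ fun p => congrArg G (Subtype.ext ?_)
    change _ = (1 - p.1 1) • (b : E) + p.1 1 • (c : E)
    rw [← hs]
    have e := stdSimplex_map_apply (f := SimplexCategory.δ (0 : Fin 3)) (i := 1) (k := 2)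
      rfl rfl p
    simp [convexTriangle, e]
  have h1 : (TopCat.toSSet.obj (TopCat.of X)).δ 1
      (triangleSimplex (G.comp (convexTriangle hC a b c))) =
        pathSimplex (G.comp (convexSegment hC a c)) := by
    refine triangleSimplex_δ _ _ fun p => congrArg G (Subtype.ext ?_)
    change _ = (1 - p.1 1) • (a : E) + p.1 1 • (c : E)
    rw [← hs]
    have e := stdSimplex_map_apply (f := SimplexCategory.δ (1 : Fin 3)) (i := 0) (k := 2)
      rfl rfl p
    simp [convexTriangle, e]
  have h2 : (TopCat.toSSet.obj (TopCat.of X)).δ 2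
      (triangleSimplex (G.comp (convexTriangle hC a b c))) =
        pathSimplex (G.comp (convexSegment hC a b)) := by
    refine triangleSimplex_δ _ _ fun p => congrArg G (Subtype.ext ?_)
    change _ = (1 - p.1 1) • (a : E) + p.1 1 • (b : E)
    rw [← hs]
    have e := stdSimplex_map_apply (f := SimplexCategory.δ (2 : Fin 3)) (i := 0) (k := 1)
      rfl rfl p
    simp [convexTriangle, e]
  rw [Fin.sum_univ_three] at key
  simp only [h0, h1, h2] at key
  have sgn (u v w : ModuleCat.of ℚ ℚ ⟶ (Chains X).X 1) : (-1 : ℤ) ^ ((0 : Fin 3) : ℕ) • u +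
      (-1 : ℤ) ^ ((1 : Fin 3) : ℕ) • v + (-1 : ℤ) ^ ((2 : Fin 3) : ℕ) • w = u - v + w := by
    simp [sub_eq_add_neg]
  have key' := key.trans (sgn _ _ _)
  rw [← sub_eq_zero]
  refine (QuotientAddGroup.eq_zero_iff (N := boundaries X)
    (pathChain (G.comp (convexSegment hC a b)) + pathChain (G.comp (convexSegment hC b c)) -
      pathChain (G.comp (convexSegment hC a c)))).2 ⟨_, key'.trans ?_⟩
  have comm (u v w : ModuleCat.of ℚ ℚ ⟶ (Chains X).X 1) : u - v + w = w + u - v := by abel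
  exact comm _ _ _

lemma pathClass_const (p : X) : pathClass (ContinuousMap.const I p) = 0 := by
  have h := pathClass_triangle (E := ℝ) convex_univ (ContinuousMap.const _ p)
    ⟨0, trivial⟩ ⟨0, trivial⟩ ⟨0, trivial⟩
  exact add_eq_left.1 h

/-- The sides of a singular square. -/
lemma pathClass_square (h : C(I × I, X)) :
    pathClass (h.comp (.prodMk (.const I 0) (.id I))) +
      pathClass (h.comp (.prodMk (.id I) (.const I 1))) =
    pathClass (h.comp (.prodMk (.id I) (.const I 0))) +
      pathClass (h.comp (.prodMk (.const I 1) (.id I))) := by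
  have hC : Convex ℝ (Set.Icc (0 : ℝ) 1 ×ˢ Set.Icc (0 : ℝ) 1) :=
    (convex_Icc 0 1).prod (convex_Icc 0 1)
  let G : C((Set.Icc (0 : ℝ) 1 ×ˢ Set.Icc (0 : ℝ) 1 : Set (ℝ × ℝ)), X) :=
    h.comp ⟨fun q => (⟨q.1.1, q.2.1⟩, ⟨q.1.2, q.2.2⟩), by fun_prop⟩
  have m (a b : I) : ((a : ℝ), (b : ℝ)) ∈ Set.Icc (0 : ℝ) 1 ×ˢ Set.Icc (0 : ℝ) 1 := ⟨a.2, b.2⟩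
  have h1 := pathClass_triangle hC G ⟨_, m 0 0⟩ ⟨_, m 0 1⟩ ⟨_, m 1 1⟩
  have h2 := pathClass_triangle hC G ⟨_, m 0 0⟩ ⟨_, m 1 0⟩ ⟨_, m 1 1⟩
  have h3 := h1.trans h2.symm
  convert h3 using 3 <;> (ext s; simp [G, convexSegment])

/-- A homotopy of closed paths. -/
lemma pathClass_eq_of_homotopy (h : C(I × I, X)) (hh : ∀ s, h (s, 0) = h (s, 1)) :
    pathClass (h.comp (.prodMk (.const I 0) (.id I))) =
      pathClass (h.comp (.prodMk (.const I 1) (.id I))) := by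
  have := pathClass_square h
  have e : h.comp (.prodMk (.id I) (.const I 1)) = h.comp (.prodMk (.id I) (.const I 0)) := by
    ext s; exact (hh s).symm
  rw [e, add_comm] at this
  exact add_left_cancel this

/-- The class of a path in the image of a convex set only depends on its end points. -/
lemma pathClass_comp_eq_segment {C : Set E} (hC : Convex ℝ C) (G : C(C, X)) (α : C(I, C)) :
    pathClass (G.comp α) = pathClass (G.comp (convexSegment hC (α 0) (α 1))) := by
  let h : C(I × I, C) := ⟨fun q => ⟨(1 - (q.1 : ℝ)) • (α q.2 : E) +
      (q.1 : ℝ) • (convexSegment hC (α 0) (α 1) q.2 : E),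
    hC (α q.2).2 (convexSegment hC (α 0) (α 1) q.2).2 (sub_nonneg.2 q.1.2.2) q.1.2.1 (by ring)⟩,
    by fun_prop⟩
  have := pathClass_square (G.comp h)
  have e0 : (G.comp h).comp (.prodMk (.id I) (.const I 1)) = .const I (G (α 1)) := by
    ext s
    refine congrArg G (Subtype.ext ?_)
    simp [h, convexSegment, ← add_smul]
  have e1 : (G.comp h).comp (.prodMk (.id I) (.const I 0)) = .const I (G (α 0)) := by
    ext s
    refine congrArg G (Subtype.ext ?_)
    simp [h, convexSegment, ← add_smul]
  rw [e0, e1, pathClass_const, pathClass_const, add_zero, zero_add] at this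
  convert this using 2 <;> (ext s; refine congrArg G (Subtype.ext ?_); simp [h])

/-- The path `s ↦ g (a + s (b - a))` which runs through `g` from `a` to `b`. -/
def arc (g : C(ℝ, X)) (a b : ℝ) : C(I, X) :=
  g.comp ⟨fun s => (1 - (s : ℝ)) * a + s * b, by fun_prop⟩

lemma arc_zero (g : C(ℝ, X)) (a b : ℝ) : arc g a b 0 = g a := by simp [arc]

lemma arc_one (g : C(ℝ, X)) (a b : ℝ) : arc g a b 1 = g b := by simp [arc]

lemma pathClass_comp_eq_arc (g : C(ℝ, X)) (α : C(I, ℝ)) :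
    pathClass (g.comp α) = pathClass (arc g (α 0) (α 1)) := by
  have := pathClass_comp_eq_segment (E := ℝ) (C := Set.univ) convex_univ
    (g.comp ⟨Subtype.val, continuous_subtype_val⟩) ⟨fun s => ⟨α s, trivial⟩, by fun_prop⟩
  exact this

lemma pathClass_arc_add (g : C(ℝ, X)) (a b c : ℝ) :
    pathClass (arc g a b) + pathClass (arc g b c) = pathClass (arc g a c) :=
  pathClass_triangle (E := ℝ) (C := Set.univ) convex_univ
    (g.comp ⟨Subtype.val, continuous_subtype_val⟩) ⟨a, trivial⟩ ⟨b, trivial⟩ ⟨c, trivial⟩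

/-- A path is the sum of its restrictions to `[0, r]` and `[r, 1]`. -/
lemma pathClass_split (g : C(I, X)) (r : I) :
    pathClass g = pathClass (arc (g.comp ⟨Set.projIcc 0 1 zero_le_one, continuous_projIcc⟩) 0 r) +
      pathClass (arc (g.comp ⟨Set.projIcc 0 1 zero_le_one, continuous_projIcc⟩) r 1) := by
  rw [pathClass_arc_add]
  congr 1
  ext s
  simp [arc]

end Paths

end

/-! ### The topology of the projective plane -/

/-- The defining polynomial of the Hesse cubic. -/
def hessePoly (t : ℂ) (v : Fin 3 → ℂ) : ℂ :=
  v 0 ^ 3 + v 1 ^ 3 + v 2 ^ 3 - 3 * t * v 0 * v 1 * v 2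

@[fun_prop]
lemma continuous_hessePoly {Y : Type} [TopologicalSpace Y] {f : Y → ℂ} {v : Y → Fin 3 → ℂ}
    (hf : Continuous f) (hv : Continuous v) : Continuous fun y => hessePoly (f y) (v y) := by
  unfold hessePoly
  fun_prop

/-- The point of the projective plane with homogeneous coordinates `v`. The value at `v = 0` is
an arbitrary point. -/
def toP2 (v : Fin 3 → ℂ) : P2 :=
  open Classical in if h : v ≠ 0 then Projectivization.mk ℂ v h else affine 0 0

lemma toP2_of_ne_zero {v : Fin 3 → ℂ} (h : v ≠ 0) : toP2 v = Projectivization.mk ℂ v h := by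
  simp [toP2, h]

lemma affine_eq_toP2 (x y : ℂ) : affine x y = toP2 ![x, y, 1] :=
  (toP2_of_ne_zero (affine_ne_zero x y)).symm

lemma toP2_mem_hesse {t : ℂ} {v : Fin 3 → ℂ} (h : v ≠ 0) :
    toP2 v ∈ hesse t ↔ hessePoly t v = 0 := by
  rw [toP2_of_ne_zero h, mk_mem_hesse, hessePoly, sub_eq_zero]

lemma toP2_eq_iff {v w : Fin 3 → ℂ} (hv : v ≠ 0) (hw : w ≠ 0) :
    toP2 v = toP2 w ↔ ∃ a : ℂ, a ≠ 0 ∧ v = a • w := by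
  rw [toP2_of_ne_zero hv, toP2_of_ne_zero hw, Projectivization.mk_eq_mk_iff]
  constructor
  · rintro ⟨a, ha⟩
    exact ⟨a, a.ne_zero, ha.symm⟩
  · rintro ⟨a, ha, h⟩
    exact ⟨Units.mk0 a ha, h.symm⟩

lemma toP2_smul {a : ℂ} (ha : a ≠ 0) (v : Fin 3 → ℂ) : toP2 (a • v) = toP2 v := by
  by_cases h : v = 0
  · simp [h]
  · exact (toP2_eq_iff (smul_ne_zero ha h) h).2 ⟨a, ha, rfl⟩

lemma exists_toP2 (p : P2) : ∃ v : Fin 3 → ℂ, ‖v‖ = 1 ∧ toP2 v = p := by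
  induction p using Projectivization.ind with
  | h v hv =>
    have h : (‖v‖ : ℂ)⁻¹ ≠ 0 := by simpa using hv
    refine ⟨(‖v‖ : ℂ)⁻¹ • v, ?_, ?_⟩
    · rw [norm_smul]
      simp [hv]
    · rw [toP2_smul h, toP2_of_ne_zero hv]

lemma isQuotientMap_mk : Topology.IsQuotientMap
    (fun v : {v : Fin 3 → ℂ // v ≠ 0} => Projectivization.mk ℂ v.1 v.2) :=
  isQuotientMap_quotient_mk'

lemma continuousOn_toP2 : ContinuousOn toP2 {v | v ≠ 0} := by
  rw [continuousOn_iff_continuous_domRestrict]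
  refine isQuotientMap_mk.continuous.congr fun v => ?_
  exact (toP2_of_ne_zero v.2).symm

lemma continuous_toP2 {Y : Type} [TopologicalSpace Y] {f : Y → Fin 3 → ℂ} (hf : Continuous f)
    (h : ∀ y, f y ≠ 0) : Continuous fun y => toP2 (f y) :=
  continuousOn_toP2.comp_continuous hf h

/-- The matrix of the orthogonal projection to the line which is given by a point. -/
def projMatrix (p : P2) (i j : Fin 3) : ℂ :=
  p.rep i * starRingEnd ℂ (p.rep j) / ∑ k, p.rep k * starRingEnd ℂ (p.rep k)

lemma projMatrix_toP2 {v : Fin 3 → ℂ} (hv : v ≠ 0) (i j : Fin 3) :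
    projMatrix (toP2 v) i j =
      v i * starRingEnd ℂ (v j) / ∑ k, v k * starRingEnd ℂ (v k) := by
  rw [toP2_of_ne_zero hv]
  obtain ⟨a, ha⟩ := Projectivization.exists_smul_eq_mk_rep ℂ v hv
  have h0 : (a : ℂ) * starRingEnd ℂ a ≠ 0 := by simp
  rw [projMatrix, ← ha, ← mul_div_mul_left (v i * _) _ h0, Finset.mul_sum]
  congr 1
  · simp [Units.smul_def]; ring
  · refine Finset.sum_congr rfl fun k _ => ?_
    simp [Units.smul_def]; ring

lemma sum_mul_conj_ne_zero {v : Fin 3 → ℂ} (hv : v ≠ 0) :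
    ∑ k, v k * starRingEnd ℂ (v k) ≠ 0 := by
  have e : ∑ k, v k * starRingEnd ℂ (v k) = ((∑ k, Complex.normSq (v k) : ℝ) : ℂ) := by
    simp [Complex.mul_conj]
  rw [e, Ne, Complex.ofReal_eq_zero, Finset.sum_eq_zero_iff_of_nonneg
    fun _ _ => Complex.normSq_nonneg _]
  intro h
  exact hv (funext fun k => Complex.normSq_eq_zero.1 (h k (Finset.mem_univ k)))

lemma continuous_projMatrix (i j : Fin 3) : Continuous fun p => projMatrix p i j := by
  rw [isQuotientMap_mk.continuous_iff]
  have h (k : Fin 3) : Continuous fun v : {v : Fin 3 → ℂ // v ≠ 0} => v.1 k :=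
    (continuous_apply k).comp continuous_subtype_val
  have h2 : Continuous fun v : {v : Fin 3 → ℂ // v ≠ 0} =>
      v.1 i * starRingEnd ℂ (v.1 j) / ∑ k, v.1 k * starRingEnd ℂ (v.1 k) := by
    refine Continuous.div ((h i).mul (Complex.continuous_conj.comp (h j)))
      (continuous_finsetSum _ fun k _ => (h k).mul (Complex.continuous_conj.comp (h k)))
      fun v => sum_mul_conj_ne_zero v.2
  refine h2.congr fun v => ?_
  rw [← projMatrix_toP2 v.2, toP2_of_ne_zero v.2]
  rfl

lemma projMatrix_injective : Function.Injective projMatrix := by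
  intro p q h
  obtain ⟨v, hv1, rfl⟩ := exists_toP2 p
  obtain ⟨w, hw1, rfl⟩ := exists_toP2 q
  have hv : v ≠ 0 := fun h => by simp [h] at hv1
  have hw : w ≠ 0 := fun h => by simp [h] at hw1
  obtain ⟨j, hj⟩ := Function.ne_iff.1 hv
  have hj : v j ≠ 0 := hj
  have key (i : Fin 3) : v i * starRingEnd ℂ (v j) / ∑ k, v k * starRingEnd ℂ (v k) =
      w i * starRingEnd ℂ (w j) / ∑ k, w k * starRingEnd ℂ (w k) := by
    rw [← projMatrix_toP2 hv, ← projMatrix_toP2 hw, h]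
  have hv' := sum_mul_conj_ne_zero hv
  have hw' := sum_mul_conj_ne_zero hw
  have hvj : starRingEnd ℂ (v j) ≠ 0 := by simpa using hj
  have e (i : Fin 3) : v i = (starRingEnd ℂ (w j) * (∑ k, v k * starRingEnd ℂ (v k)) /
      (starRingEnd ℂ (v j) * ∑ k, w k * starRingEnd ℂ (w k))) * w i := by
    have := key i
    field_simp at this ⊢
    linear_combination this
  refine (toP2_eq_iff hv hw).2 ⟨_, ?_, funext e⟩
  intro h0
  have := e j
  rw [h0, zero_mul] at this
  exact hj this

instance : T2Space P2 :=
  T2Space.of_injective_continuous projMatrix_injective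
    (continuous_pi fun i => continuous_pi fun j => continuous_projMatrix i j)

instance : CompactSpace P2 := by
  have h : IsCompact (toP2 '' Metric.sphere 0 1) :=
    (isCompact_sphere (0 : Fin 3 → ℂ) 1).image_of_continuousOn
      (continuousOn_toP2.mono fun v hv => by
        rintro rfl
        simp at hv)
  refine ⟨h.of_isClosed_subset isClosed_univ fun p _ => ?_⟩
  obtain ⟨v, hv, rfl⟩ := exists_toP2 p
  exact ⟨v, by simpa using hv, rfl⟩

lemma affine_inj {x y x' y' : ℂ} (h : affine x y = affine x' y') : x = x' ∧ y = y' := by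
  rw [affine_eq_toP2, affine_eq_toP2, toP2_eq_iff (affine_ne_zero _ _) (affine_ne_zero _ _)] at h
  obtain ⟨a, -, h⟩ := h
  have h2 : a = 1 := by simpa using (congrFun h 2).symm
  subst h2
  exact ⟨by simpa using congrFun h 0, by simpa using congrFun h 1⟩

lemma affine_coord (x y : ℂ) : projMatrix (affine x y) 2 2 ≠ 0 ∧
    projMatrix (affine x y) 0 2 / projMatrix (affine x y) 2 2 = x ∧
    projMatrix (affine x y) 1 2 / projMatrix (affine x y) 2 2 = y := by
  have h := sum_mul_conj_ne_zero (affine_ne_zero x y)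
  simp only [affine_eq_toP2, projMatrix_toP2 (affine_ne_zero x y)]
  refine ⟨?_, ?_, ?_⟩
  · exact div_ne_zero (by simp) h
  · rw [div_div_div_cancel_right₀ h]; simp
  · rw [div_div_div_cancel_right₀ h]; simp

/-- The affine coordinates of a continuous family of points are continuous. -/
lemma continuous_affine_coord {Y : Type} [TopologicalSpace Y] {f : Y → P2} (hf : Continuous f)
    {x y : Y → ℂ} (h : ∀ s, f s = affine (x s) (y s)) : Continuous x ∧ Continuous y := by
  have c (i j : Fin 3) : Continuous fun s => projMatrix (f s) i j :=
    (continuous_projMatrix i j).comp hf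
  have h22 (s : Y) : projMatrix (f s) 2 2 ≠ 0 := by rw [h]; exact (affine_coord _ _).1
  constructor
  · refine ((c 0 2).div (c 2 2) h22).congr fun s => ?_
    rw [Pi.div_apply, h]; exact (affine_coord _ _).2.1
  · refine ((c 1 2).div (c 2 2) h22).congr fun s => ?_
    rw [Pi.div_apply, h]; exact (affine_coord _ _).2.2

lemma continuous_affine : Continuous fun q : ℂ × ℂ => affine q.1 q.2 := by
  simp only [affine_eq_toP2]
  refine continuous_toP2 ?_ fun q => affine_ne_zero _ _
  refine continuous_pi fun i => ?_
  fin_cases i <;> simp <;> fun_prop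

/-! ### Roots of cubic polynomials -/

/-- A function with values in a compact set which is characterized by a closed relation is
continuous. -/
lemma continuous_of_unique {Y K : Type} [TopologicalSpace Y] [TopologicalSpace K]
    {C : Set K} (hC : IsCompact C) {r : Set (Y × K)} (hr : IsClosed r) {f : Y → K}
    (hf : ∀ y, f y ∈ C ∧ (y, f y) ∈ r) (uniq : ∀ y, ∀ z ∈ C, (y, z) ∈ r → z = f y) :
    Continuous f := by
  have := isCompact_iff_compactSpace.1 hC
  have : Continuous fun y => (⟨f y, (hf y).1⟩ : C) := by
    refine continuous_iff_isClosed.2 fun A hA => ?_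
    have h1 : IsClosed ((fun q : Y × C => (q.1, (q.2 : K))) ⁻¹' r ∩ Prod.snd ⁻¹' A) :=
      (hr.preimage (by fun_prop)).inter (hA.preimage continuous_snd)
    convert! isClosedMap_fst_of_compactSpace _ h1 using 1
    ext y
    constructor
    · intro hy
      exact ⟨(y, ⟨f y, (hf y).1⟩), ⟨(hf y).2, hy⟩, rfl⟩
    · rintro ⟨⟨y', z⟩, ⟨h2, h3⟩, rfl⟩
      have : z = ⟨f y', (hf y').1⟩ := Subtype.ext (uniq y' z z.2 h2)
      change (⟨f y', _⟩ : C) ∈ A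
      rw [← this]
      exact h3
  exact continuous_subtype_val.comp this

lemma exists_quadratic_roots (p q : ℂ) : ∃ a b : ℂ, p = -(a + b) ∧ q = a * b := by
  obtain ⟨s, hs⟩ := IsAlgClosed.exists_eq_mul_self (p ^ 2 - 4 * q)
  exact ⟨(-p + s) / 2, (-p - s) / 2, by ring, by linear_combination (-1 / 4) * hs⟩

lemma exists_cubic_roots (p q r : ℂ) :
    ∃ a b c : ℂ, p = -(a + b + c) ∧ q = a * b + b * c + c * a ∧ r = -(a * b * c) := by
  obtain ⟨a, ha⟩ := Complex.exists_root (f := Polynomial.X ^ 3 + Polynomial.C p * Polynomial.X ^ 2 +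
    Polynomial.C q * Polynomial.X + Polynomial.C r) (by
      have : (Polynomial.X ^ 3 + Polynomial.C p * Polynomial.X ^ 2 +
        Polynomial.C q * Polynomial.X + Polynomial.C r : Polynomial ℂ).degree = 3 := by
        compute_degree!
      rw [this]; norm_num)
  simp [Polynomial.IsRoot] at ha
  obtain ⟨b, c, h1, h2⟩ := exists_quadratic_roots (a + p) (a ^ 2 + p * a + q)
  refine ⟨a, b, c, by linear_combination h1, by linear_combination h2 - a * h1, ?_⟩
  linear_combination ha - a * h2

/-! ### Homotopy lifting for the family of curves -/

/-- A cubic polynomial whose constant term is small compared with its linear term has exactly one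
small root. -/
lemma existsUnique_small_root {a₀ a₁ a₂ a₃ : ℂ} {m M ρ : ℝ} (hρ : 0 < ρ) (hM : 0 ≤ M)
    (h₀ : 3 * ‖a₀‖ ≤ m * ρ) (h₁ : m ≤ ‖a₁‖) (h₂ : ‖a₂‖ ≤ M) (h₃ : ‖a₃‖ ≤ M)
    (hm : 2 * M * ρ + 3 * M * ρ ^ 2 < m) :
    ∃! s : ℂ, ‖s‖ ≤ ρ ∧ a₀ + a₁ * s + a₂ * s ^ 2 + a₃ * s ^ 3 = 0 := by
  have hm0 : 0 < m := lt_of_le_of_lt (by positivity) hm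
  refine existsUnique_of_exists_of_unique ?_ ?_
  · by_cases h : a₀ = 0
    · exact ⟨0, by simpa using hρ.le, by simp [h]⟩
    -- the inverses of the roots add up to `-a₁ / a₀`, so that one of them is large
    obtain ⟨x, y, z, e1, e2, e3⟩ := exists_cubic_roots (a₁ / a₀) (a₂ / a₀) (a₃ / a₀)
    have key : ∃ w : ℂ, ‖a₁ / a₀‖ ≤ 3 * ‖w‖ ∧
        w ^ 3 + a₁ / a₀ * w ^ 2 + a₂ / a₀ * w + a₃ / a₀ = 0 := by
      by_contra! hc
      have hx := mt (hc x) (by rw [not_not, e1, e2, e3]; ring)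
      have hy := mt (hc y) (by rw [not_not, e1, e2, e3]; ring)
      have hz := mt (hc z) (by rw [not_not, e1, e2, e3]; ring)
      have : ‖a₁ / a₀‖ ≤ ‖x‖ + ‖y‖ + ‖z‖ := by
        rw [e1, norm_neg]
        exact norm_add₃_le
      linarith
    obtain ⟨w, hw, hw'⟩ := key
    have hn : 0 < ‖a₁ / a₀‖ := norm_pos_iff.2 (div_ne_zero (norm_pos_iff.1 (hm0.trans_le h₁)) h)
    have hw0 : w ≠ 0 := norm_pos_iff.1 (by linarith)
    refine ⟨w⁻¹, ?_, ?_⟩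
    · rw [norm_inv, inv_le_iff_one_le_mul₀ (norm_pos_iff.2 hw0)]
      rw [norm_div, div_le_iff₀ (norm_pos_iff.2 h)] at hw
      have h5 : m ≤ ‖w‖ * (m * ρ) := by
        calc m ≤ 3 * ‖w‖ * ‖a₀‖ := h₁.trans hw
          _ = ‖w‖ * (3 * ‖a₀‖) := by ring
          _ ≤ _ := by gcongr
      by_contra! h6
      nlinarith
    · field_simp at hw' ⊢
      linear_combination hw'
  · rintro s s' ⟨hs, es⟩ ⟨hs', es'⟩
    by_contra hne
    have h4 : (s - s') * (a₁ + a₂ * (s + s') + a₃ * (s ^ 2 + s * s' + s' ^ 2)) = 0 := by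
      linear_combination es - es'
    have h5 := (mul_eq_zero.1 h4).resolve_left (sub_ne_zero.2 hne)
    have h6 : a₁ = -(a₂ * (s + s') + a₃ * (s ^ 2 + s * s' + s' ^ 2)) := by
      linear_combination h5
    have h7 : ‖a₁‖ ≤ M * (ρ + ρ) + M * (ρ ^ 2 + ρ * ρ + ρ ^ 2) := by
      rw [h6, norm_neg]
      refine (norm_add_le _ _).trans (add_le_add ?_ ?_)
      · rw [norm_mul]
        exact mul_le_mul h₂ ((norm_add_le _ _).trans (add_le_add hs hs')) (norm_nonneg _) hM
      · rw [norm_mul]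
        refine mul_le_mul h₃ (norm_add₃_le.trans ?_) (norm_nonneg _) hM
        rw [norm_pow, norm_mul, norm_pow]
        gcongr
    nlinarith

/-- The complex conjugate of the gradient of the Hesse polynomial, up to a factor `3`. -/
def gradConj (t : ℂ) (v : Fin 3 → ℂ) : Fin 3 → ℂ :=
  ![starRingEnd ℂ (v 0 ^ 2 - t * v 1 * v 2), starRingEnd ℂ (v 1 ^ 2 - t * v 0 * v 2),
    starRingEnd ℂ (v 2 ^ 2 - t * v 0 * v 1)]

@[fun_prop]
lemma continuous_gradConj {Y : Type} [TopologicalSpace Y] {f : Y → ℂ} {v : Y → Fin 3 → ℂ}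
    (hf : Continuous f) (hv : Continuous v) : Continuous fun y => gradConj (f y) (v y) := by
  refine continuous_pi fun i => ?_
  fin_cases i <;> simp [gradConj] <;> fun_prop

/-- The linear coefficient of the Hesse polynomial along the conjugate gradient. -/
def linCoeff (t : ℂ) (v : Fin 3 → ℂ) : ℂ :=
  3 * ((v 0 ^ 2 - t * v 1 * v 2) * gradConj t v 0 + (v 1 ^ 2 - t * v 0 * v 2) * gradConj t v 1 +
    (v 2 ^ 2 - t * v 0 * v 1) * gradConj t v 2)

/-- The quadratic coefficient of the Hesse polynomial along the conjugate gradient. -/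
def quadCoeff (t : ℂ) (v : Fin 3 → ℂ) : ℂ :=
  3 * (v 0 * gradConj t v 0 ^ 2 + v 1 * gradConj t v 1 ^ 2 + v 2 * gradConj t v 2 ^ 2) -
    3 * t * (v 0 * gradConj t v 1 * gradConj t v 2 + v 1 * gradConj t v 0 * gradConj t v 2 +
      v 2 * gradConj t v 0 * gradConj t v 1)

lemma hessePoly_add_smul (t s : ℂ) (v : Fin 3 → ℂ) :
    hessePoly t (v + s • gradConj t v) = hessePoly t v + linCoeff t v * s +
      quadCoeff t v * s ^ 2 + hessePoly t (gradConj t v) * s ^ 3 := by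
  simp only [hessePoly, linCoeff, quadCoeff, Pi.add_apply, Pi.smul_apply, smul_eq_mul]
  ring

/-- The Hesse cubics over `S` are smooth: the linear coefficient is a positive multiple of the
squared norm of the gradient. -/
lemma linCoeff_ne_zero {t : ℂ} (ht : t ∈ smoothBase) {v : Fin 3 → ℂ} (hv : v ≠ 0) :
    linCoeff t v ≠ 0 := by
  intro h
  have e : linCoeff t v = ((3 * (Complex.normSq (v 0 ^ 2 - t * v 1 * v 2) +
      Complex.normSq (v 1 ^ 2 - t * v 0 * v 2) +
      Complex.normSq (v 2 ^ 2 - t * v 0 * v 1)) : ℝ) : ℂ) := by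
    push_cast
    simp only [linCoeff, gradConj, ← Complex.mul_conj]
    rfl
  rw [e, Complex.ofReal_eq_zero] at h
  have n0 := Complex.normSq_nonneg (v 0 ^ 2 - t * v 1 * v 2)
  have n1 := Complex.normSq_nonneg (v 1 ^ 2 - t * v 0 * v 2)
  have n2 := Complex.normSq_nonneg (v 2 ^ 2 - t * v 0 * v 1)
  have z0 := Complex.normSq_eq_zero.1 (by linarith : Complex.normSq (v 0 ^ 2 - t * v 1 * v 2) = 0)
  have z1 := Complex.normSq_eq_zero.1 (by linarith : Complex.normSq (v 1 ^ 2 - t * v 0 * v 2) = 0)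
  have z2 := Complex.normSq_eq_zero.1 (by linarith : Complex.normSq (v 2 ^ 2 - t * v 0 * v 1) = 0)
  -- a combination of the three equations gives `(1 - t ^ 3) (v₀ v₁ v₂) ^ 2 = 0`
  have hp : (1 - t ^ 3) * (v 0 * v 1 * v 2) ^ 2 = 0 := by
    linear_combination v 1 ^ 2 * v 2 ^ 2 * z0 + t * v 1 * v 2 * v 2 ^ 2 * z1 +
      t ^ 2 * v 1 * v 2 * v 0 * v 2 * z2
  have h1 : (1 - t ^ 3) ≠ 0 := fun h => ht (by linear_combination -h)
  have h2 : v 0 * v 1 * v 2 = 0 := by simpa [h1] using hp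
  have c0 : v 0 ^ 3 = 0 := by linear_combination v 0 * z0 + t * h2
  have c1 : v 1 ^ 3 = 0 := by linear_combination v 1 * z1 + t * h2
  have c2 : v 2 ^ 3 = 0 := by linear_combination v 2 * z2 + t * h2
  apply hv
  funext i
  fin_cases i
  · exact eq_zero_of_pow_eq_zero c0
  · exact eq_zero_of_pow_eq_zero c1
  · exact eq_zero_of_pow_eq_zero c2

/-- Uniform bounds for the coefficients of the Hesse polynomials along conjugate gradients. -/
lemma exists_coeff_bounds {C : Set ℂ} (hC : IsCompact C) (hS : C ⊆ smoothBase) :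
    ∃ m M ρ : ℝ, 0 < m ∧ (∀ t ∈ C, ∀ v : Fin 3 → ℂ, ‖v‖ = 1 → m ≤ ‖linCoeff t v‖) ∧ 0 ≤ M ∧
      (∀ t ∈ C, ∀ v : Fin 3 → ℂ, ‖v‖ = 1 → ‖quadCoeff t v‖ ≤ M) ∧
      (∀ t ∈ C, ∀ v : Fin 3 → ℂ, ‖v‖ = 1 → ‖hessePoly t (gradConj t v)‖ ≤ M) ∧
      (∀ t ∈ C, ∀ v : Fin 3 → ℂ, ‖v‖ = 1 → ‖gradConj t v‖ ≤ M) ∧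
      0 < ρ ∧ 2 * M * ρ + 3 * M * ρ ^ 2 < m ∧ ρ * M < 1 := by
  have hK : IsCompact (C ×ˢ Metric.sphere (0 : Fin 3 → ℂ) 1) := hC.prod (isCompact_sphere _ _)
  have ne {v : Fin 3 → ℂ} (hv : ‖v‖ = 1) : v ≠ 0 := fun h => by simp [h] at hv
  have c1 : Continuous fun q : ℂ × (Fin 3 → ℂ) => linCoeff q.1 q.2 := by
    unfold linCoeff; fun_prop
  have c2 : Continuous fun q : ℂ × (Fin 3 → ℂ) => quadCoeff q.1 q.2 := by
    unfold quadCoeff; fun_prop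
  have c3 : Continuous fun q : ℂ × (Fin 3 → ℂ) => hessePoly q.1 (gradConj q.1 q.2) := by fun_prop
  have c4 : Continuous fun q : ℂ × (Fin 3 → ℂ) => gradConj q.1 q.2 := by fun_prop
  obtain ⟨B₁, hB₁⟩ := hK.exists_bound_of_continuousOn
    (f := fun q : ℂ × (Fin 3 → ℂ) => (linCoeff q.1 q.2)⁻¹)
    (c1.continuousOn.inv₀ fun q hq => linCoeff_ne_zero (hS (Set.mem_prod.1 hq).1)
      (ne (by simpa using (Set.mem_prod.1 hq).2)))
  obtain ⟨B₂, hB₂⟩ := hK.exists_bound_of_continuousOn c2.continuousOn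
  obtain ⟨B₃, hB₃⟩ := hK.exists_bound_of_continuousOn c3.continuousOn
  obtain ⟨B₄, hB₄⟩ := hK.exists_bound_of_continuousOn c4.continuousOn
  obtain ⟨m, hm0, hm⟩ : ∃ m : ℝ, 0 < m ∧ ∀ t ∈ C, ∀ v : Fin 3 → ℂ, ‖v‖ = 1 →
      m ≤ ‖linCoeff t v‖ := by
    refine ⟨(max B₁ 1)⁻¹, by positivity, fun t ht v hv => ?_⟩
    have h := hB₁ (t, v) (Set.mk_mem_prod ht (by simpa using hv))
    have hp : 0 < ‖linCoeff t v‖ := norm_pos_iff.2 (linCoeff_ne_zero (hS ht) (ne hv))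
    rw [norm_inv] at h
    exact inv_le_of_inv_le₀ hp (h.trans (le_max_left _ _))
  obtain ⟨M, hM0, hM2, hM3, hM4⟩ : ∃ M : ℝ, 0 ≤ M ∧
      (∀ t ∈ C, ∀ v : Fin 3 → ℂ, ‖v‖ = 1 → ‖quadCoeff t v‖ ≤ M) ∧
      (∀ t ∈ C, ∀ v : Fin 3 → ℂ, ‖v‖ = 1 → ‖hessePoly t (gradConj t v)‖ ≤ M) ∧
      (∀ t ∈ C, ∀ v : Fin 3 → ℂ, ‖v‖ = 1 → ‖gradConj t v‖ ≤ M) := by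
    refine ⟨max (max B₂ B₃) (max B₄ 0), by simp, fun t ht v hv => ?_, fun t ht v hv => ?_,
      fun t ht v hv => ?_⟩
    · exact (hB₂ (t, v) (Set.mk_mem_prod ht (by simpa using hv))).trans (by simp)
    · exact (hB₃ (t, v) (Set.mk_mem_prod ht (by simpa using hv))).trans (by simp)
    · exact (hB₄ (t, v) (Set.mk_mem_prod ht (by simpa using hv))).trans (by simp)
  obtain ⟨ρ, hρ0, hρ1, hρ2⟩ : ∃ ρ : ℝ, 0 < ρ ∧ 2 * M * ρ + 3 * M * ρ ^ 2 < m ∧ ρ * M < 1 := by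
    refine ⟨min (1 / (M + 1)) (min 1 (m / (6 * (M + 1)))), by positivity, ?_, ?_⟩
    · set ρ := min (1 / (M + 1)) (min 1 (m / (6 * (M + 1))))
      have h0 : 0 < ρ := by positivity
      have h1 : ρ ≤ 1 := (min_le_right _ _).trans (min_le_left _ _)
      have h2 : ρ ≤ m / (6 * (M + 1)) := (min_le_right _ _).trans (min_le_right _ _)
      rw [le_div_iff₀ (by positivity)] at h2
      nlinarith [mul_nonneg hM0 h0.le]
    · have h : min (1 / (M + 1)) (min 1 (m / (6 * (M + 1)))) ≤ 1 / (M + 1) := min_le_left _ _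
      calc _ ≤ 1 / (M + 1) * M := by gcongr
        _ < 1 := by rw [div_mul_eq_mul_div, div_lt_one (by positivity)]; linarith
  exact ⟨m, M, ρ, hm0, hm, hM0, hM2, hM3, hM4, hρ0, hρ1, hρ2⟩

/-- Over a compact part of `S`, neighbouring curves can be projected to each other: a point `[v]`
of `X_t` is moved along the conjugate gradient to a point of `X_u`. -/
lemma exists_projection {C : Set ℂ} (hC : IsCompact C) (hS : C ⊆ smoothBase) :
    ∃ δ > 0, ∃ R : ℂ × ℂ × P2 → P2,
      ContinuousOn R {q | q.1 ∈ C ∧ q.2.1 ∈ C ∧ dist q.1 q.2.1 ≤ δ ∧ q.2.2 ∈ hesse q.1} ∧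
      (∀ t ∈ C, ∀ u ∈ C, dist t u ≤ δ → ∀ p ∈ hesse t, R (t, u, p) ∈ hesse u) ∧
      ∀ t ∈ C, ∀ p ∈ hesse t, R (t, t, p) = p := by
  have ne {v : Fin 3 → ℂ} (hv : ‖v‖ = 1) : v ≠ 0 := fun h => by simp [h] at hv
  obtain ⟨m, M, ρ, hm0, hm, hM0, hM2, hM3, hM4, hρ0, hρ1, hρ2⟩ := exists_coeff_bounds hC hS
  have hw {u : ℂ} (hu : u ∈ C) {v : Fin 3 → ℂ} (hv : ‖v‖ = 1) {s : ℂ} (hs : ‖s‖ ≤ ρ) :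
      v + s • gradConj u v ≠ 0 := by
    intro h
    have h1 : ‖v‖ ≤ ρ * M := by
      rw [eq_neg_of_add_eq_zero_left h, norm_neg, norm_smul]
      exact mul_le_mul hs (hM4 u hu v hv) (norm_nonneg _) hρ0.le
    linarith
  -- the relation between `(t, u, [v])` and `[v + s • gradConj u v]`
  let Z : Set (ℂ × ℂ × (Fin 3 → ℂ) × ℂ) := {z | z.1 ∈ C ∧ z.2.1 ∈ C ∧ ‖z.2.2.1‖ = 1 ∧
    ‖z.2.2.2‖ ≤ ρ ∧ hessePoly z.2.1 (z.2.2.1 + z.2.2.2 • gradConj z.2.1 z.2.2.1) = 0}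
  have hZ : IsCompact Z := by
    have h1 : IsCompact (C ×ˢ C ×ˢ Metric.sphere (0 : Fin 3 → ℂ) 1 ×ˢ
        Metric.closedBall (0 : ℂ) ρ) :=
      hC.prod (hC.prod ((isCompact_sphere _ _).prod (isCompact_closedBall _ _)))
    have h2 : IsClosed ((fun z : ℂ × ℂ × (Fin 3 → ℂ) × ℂ =>
        hessePoly z.2.1 (z.2.2.1 + z.2.2.2 • gradConj z.2.1 z.2.2.1)) ⁻¹' {0}) := by
      exact isClosed_singleton.preimage (by fun_prop)
    convert h1.inter_right h2 using 1
    ext z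
    simp [Z, Set.mem_prod, and_assoc]
  let f : ℂ × ℂ × (Fin 3 → ℂ) × ℂ → (ℂ × ℂ × P2) × P2 := fun z =>
    ((z.1, z.2.1, toP2 z.2.2.1), toP2 (z.2.2.1 + z.2.2.2 • gradConj z.2.1 z.2.2.1))
  have hf : ContinuousOn f Z := by
    have h1 : ContinuousOn (fun z : ℂ × ℂ × (Fin 3 → ℂ) × ℂ => toP2 z.2.2.1) Z :=
      continuousOn_toP2.comp (by fun_prop) fun z hz => ne hz.2.2.1
    have h2 : ContinuousOn (fun z : ℂ × ℂ × (Fin 3 → ℂ) × ℂ =>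
        toP2 (z.2.2.1 + z.2.2.2 • gradConj z.2.1 z.2.2.1)) Z := by
      refine continuousOn_toP2.comp (Continuous.continuousOn ?_)
        fun z hz => hw hz.2.1 hz.2.2.1 hz.2.2.2.1
      fun_prop
    exact (ContinuousOn.prodMk (by fun_prop) (ContinuousOn.prodMk (by fun_prop) h1)).prodMk h2
  have hr : IsClosed (f '' Z) := (hZ.image_of_continuousOn hf).isClosed
  have root {t : ℂ} (ht : t ∈ C) {u : ℂ} (hu : u ∈ C) (d : dist t u ≤ m * ρ / 9)
      {v : Fin 3 → ℂ} (hv : ‖v‖ = 1) (hvt : hessePoly t v = 0) :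
      ∃! s : ℂ, ‖s‖ ≤ ρ ∧ hessePoly u (v + s • gradConj u v) = 0 := by
    simp only [hessePoly_add_smul]
    refine existsUnique_small_root hρ0 hM0 ?_ (hm u hu v hv) (hM2 u hu v hv) (hM3 u hu v hv) hρ1
    have e : hessePoly u v = 3 * (t - u) * (v 0 * v 1 * v 2) := by
      rw [← sub_zero (hessePoly u v), ← hvt]
      simp only [hessePoly]; ring
    have hvi (i : Fin 3) : ‖v i‖ ≤ 1 := hv ▸ norm_le_pi_norm v i
    have h3 : ‖v 0 * v 1 * v 2‖ ≤ 1 := by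
      rw [norm_mul, norm_mul]
      exact mul_le_one₀ (mul_le_one₀ (hvi 0) (norm_nonneg _) (hvi 1)) (norm_nonneg _) (hvi 2)
    rw [e, norm_mul, norm_mul, ← dist_eq_norm]
    have : (‖(3 : ℂ)‖) = 3 := by simp
    rw [this]
    have : 3 * dist t u * ‖v 0 * v 1 * v 2‖ ≤ 3 * dist t u * 1 := by gcongr
    linarith
  let D : Set (ℂ × ℂ × P2) :=
    {q | q.1 ∈ C ∧ q.2.1 ∈ C ∧ dist q.1 q.2.1 ≤ m * ρ / 9 ∧ q.2.2 ∈ hesse q.1}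
  have uniq (q : ℂ × ℂ × P2) (hq : q ∈ D) : ∃! p : P2, (q, p) ∈ f '' Z := by
    obtain ⟨t, u, p⟩ := q
    obtain ⟨ht, hu, d, hp⟩ := hq
    obtain ⟨v, hv, rfl⟩ := exists_toP2 p
    have hvt := (toP2_mem_hesse (ne hv)).1 hp
    obtain ⟨s, ⟨hs1, hs2⟩, hs3⟩ := root ht hu d hv hvt
    refine ⟨_, ⟨(t, u, v, s), ⟨ht, hu, hv, hs1, hs2⟩, rfl⟩, ?_⟩
    rintro p' ⟨⟨t', u', v', s'⟩, ⟨ht', hu', hv', hs1', hs2'⟩, h⟩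
    simp only [f, Prod.mk.injEq] at h ht' hu' hv' hs1' hs2'
    obtain ⟨⟨rfl, rfl, h⟩, rfl⟩ := h
    -- a change of the representative by a phase `a` changes the root by `a ^ 3`
    obtain ⟨a, ha, rfl⟩ := (toP2_eq_iff (ne hv') (ne hv)).1 h
    have ha1 : ‖a‖ = 1 := by rwa [norm_smul, hv, mul_one] at hv'
    have hac : a * starRingEnd ℂ a = 1 := by
      rw [Complex.mul_conj, Complex.normSq_eq_norm_sq, ha1]; simp
    have hg : gradConj u' (a • v) = (starRingEnd ℂ a) ^ 2 • gradConj u' v := by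
      ext i
      fin_cases i <;> simp [gradConj] <;> ring
    have hsum : a • v + s' • gradConj u' (a • v) =
        a • (v + ((starRingEnd ℂ a) ^ 3 * s') • gradConj u' v) := by
      rw [hg, smul_add, smul_smul, smul_smul]
      congr 2
      linear_combination (-(starRingEnd ℂ a) ^ 2 * s') * hac
    have hhom (w : Fin 3 → ℂ) : hessePoly u' (a • w) = a ^ 3 * hessePoly u' w := by
      simp only [hessePoly, Pi.smul_apply, smul_eq_mul]; ring
    rw [hsum, hhom] at hs2'
    have := hs3 ((starRingEnd ℂ a) ^ 3 * s') ⟨by simpa [ha1] using hs1',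
      (mul_eq_zero.1 hs2').resolve_left (pow_ne_zero 3 ha)⟩
    change toP2 (a • v + s' • gradConj u' (a • v)) = _
    rw [hsum, this, toP2_smul ha]
  choose! R hR1 hR2 using uniq
  refine ⟨m * ρ / 9, by positivity, R, ?_, ?_, ?_⟩
  · rw [continuousOn_iff_continuous_domRestrict]
    refine continuous_of_unique (K := P2) isCompact_univ
      (r := (fun x : D × P2 => ((x.1 : ℂ × ℂ × P2), x.2)) ⁻¹' (f '' Z))
      (hr.preimage (by fun_prop)) (fun q => ⟨trivial, hR1 q q.2⟩) fun q p _ hp => hR2 q q.2 p hp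
  · intro t ht u hu d p hp
    obtain ⟨z, hz, e⟩ := hR1 (t, u, p) ⟨ht, hu, d, hp⟩
    simp only [f, Prod.mk.injEq] at e
    rw [← e.2, ← e.1.2.1]
    exact (toP2_mem_hesse (hw hz.2.1 hz.2.2.1 hz.2.2.2.1)).2 hz.2.2.2.2
  · intro t ht p hp
    refine (hR2 (t, t, p) ⟨ht, ht, by rw [dist_self]; positivity, hp⟩ p ?_).symm
    obtain ⟨v, hv, rfl⟩ := exists_toP2 p
    refine ⟨(t, t, v, 0), ⟨ht, ht, hv, by simpa using hρ0.le, ?_⟩, by simp [f]⟩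
    simpa using (toP2_mem_hesse (ne hv)).1 hp

/-- The homotopy lifting property of the family of Hesse cubics over `S`, for homotopies which
factor through a compact metric space `B` with bounded speed. Constant homotopies are lifted to
constant ones. -/
lemma exists_lift {Z B : Type} [TopologicalSpace Z] [PseudoMetricSpace B] [CompactSpace B]
    (c : C(B, ℂ)) (hc : ∀ b, c b ∈ smoothBase) (φ : C(Z × I, B))
    (hφ : ∀ z s s', dist (φ (z, s)) (φ (z, s')) ≤ dist s s') (p : C(Z, P2))
    (hp : ∀ z, p z ∈ hesse (c (φ (z, 0)))) :
    ∃ q : C(Z × I, P2), (∀ z s, q (z, s) ∈ hesse (c (φ (z, s)))) ∧ (∀ z, q (z, 0) = p z) ∧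
      ∀ z, (∀ s, φ (z, s) = φ (z, 0)) → ∀ s, q (z, s) = p z := by
  obtain ⟨δ, hδ, R, hRc, hR, hR'⟩ := exists_projection (C := Set.range c)
    (isCompact_range c.continuous) (by rintro _ ⟨b, rfl⟩; exact hc b)
  have huc := CompactSpace.uniformContinuous_of_continuous c.continuous
  obtain ⟨ε, hε, hcε⟩ := Metric.uniformContinuous_iff.1 huc δ hδ
  obtain ⟨n, hn⟩ := exists_nat_one_div_lt hε
  -- the homotopy is lifted up to the time `j / (n + 1)`, and stopped there
  let a (j : ℕ) : I := Set.projIcc 0 1 zero_le_one ((j : ℝ) / (n + 1))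
  have ha (j : ℕ) (s : I) : dist (min s (a j)) (min s (a (j + 1))) < ε := by
    refine lt_of_le_of_lt ?_ hn
    rw [Subtype.dist_eq, Real.dist_eq]
    have h1 : |((min s (a j) : I) : ℝ) - ((min s (a (j + 1)) : I) : ℝ)| ≤
        |(a j : ℝ) - (a (j + 1) : ℝ)| := by
      have e (x y : I) : ((min x y : I) : ℝ) = min (x : ℝ) y := Monotone.map_min fun _ _ h => h
      rw [e, e]
      have := abs_min_sub_min_le_max (s : ℝ) (a j) s (a (j + 1))
      simpa using this
    have h2 : |(a j : ℝ) - (a (j + 1) : ℝ)| ≤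
        |(j : ℝ) / (n + 1) - ((j + 1 : ℕ) : ℝ) / (n + 1)| :=
      Set.abs_projIcc_sub_projIcc zero_le_one
    refine (h1.trans h2).trans_eq ?_
    rw [← sub_div, abs_div, abs_of_pos (by positivity : (0 : ℝ) < n + 1)]
    simp
  have key (j : ℕ) : ∃ q : C(Z × I, P2), (∀ z s, q (z, s) ∈ hesse (c (φ (z, min s (a j))))) ∧
      (∀ z, q (z, 0) = p z) ∧ ∀ z, (∀ s, φ (z, s) = φ (z, 0)) → ∀ s, q (z, s) = p z := by
    induction j with
    | zero =>
      refine ⟨p.comp ⟨Prod.fst, continuous_fst⟩, fun z s => ?_, fun z => rfl, fun z _ s => rfl⟩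
      have : min s (a 0) = 0 := by
        have : a 0 = 0 := by simp [a]
        rw [this]; exact min_eq_right s.2.1
      rw [this]
      exact hp z
    | succ j ih =>
      obtain ⟨q, h1, h2, h3⟩ := ih
      have hd (z : Z) (s : I) :
          dist (c (φ (z, min s (a j)))) (c (φ (z, min s (a (j + 1))))) ≤ δ :=
        (hcε ((hφ _ _ _).trans_lt (ha j s))).le
      refine ⟨⟨fun x => R (c (φ (x.1, min x.2 (a j))), c (φ (x.1, min x.2 (a (j + 1)))), q x),
        hRc.comp_continuous (by fun_prop) fun x => ⟨⟨_, rfl⟩, ⟨_, rfl⟩, hd _ _, h1 _ _⟩⟩,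
        fun z s => ?_, fun z => ?_, fun z hz s => ?_⟩
      · exact hR _ ⟨_, rfl⟩ _ ⟨_, rfl⟩ (hd z s) _ (h1 z s)
      · have e (j : ℕ) : min (0 : I) (a j) = 0 := min_eq_left (a j).2.1
        have h4 := h1 z 0
        simp only [ContinuousMap.coe_mk, e, h2] at h4 ⊢
        exact hR' _ ⟨_, rfl⟩ _ h4
      · have h4 := h1 z s
        simp only [ContinuousMap.coe_mk, hz (min _ _), h3 z hz] at h4 ⊢
        exact hR' _ ⟨_, rfl⟩ _ h4
  obtain ⟨q, h1, h2, h3⟩ := key (n + 1)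
  refine ⟨q, fun z s => ?_, h2, h3⟩
  have : min s (a (n + 1)) = s := by
    have : a (n + 1) = 1 := by
      have h : ((n + 1 : ℕ) : ℝ) / (n + 1) = 1 := by
        push_cast; exact div_self (by positivity)
      simp only [a, h]
      exact Set.projIcc_right zero_le_one
    rw [this]; exact min_eq_left s.2.2
  have h4 := h1 z s
  rwa [this] at h4

/-! ### Continuation of homology classes -/

section Continuation

variable {t₀ t₁ : ℂ}

lemma continuous_max_dist (τ s s' : I) : dist (max τ s) (max τ s') ≤ dist s s' := by
  rw [Subtype.dist_eq, Subtype.dist_eq, Real.dist_eq, Real.dist_eq]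
  have e (x y : I) : ((max x y : I) : ℝ) = max (x : ℝ) y := Monotone.map_max fun _ _ h => h
  rw [e, e]
  have := abs_max_sub_max_le_max (τ : ℝ) s τ s'
  simpa using this

/-- Every class can be continued along a path in `S`. -/
lemma exists_isContinuation (c : Path t₀ t₁) (hc : ∀ s, c s ∈ smoothBase) :
    ∃ φ : C(hesse t₀, hesse t₁), ∀ a, IsContinuation c a (H1map φ a) := by
  obtain ⟨q, h1, h2, -⟩ := exists_lift (Z := hesse t₀) c.toContinuousMap hc
    ⟨Prod.snd, continuous_snd⟩ (fun _ _ _ => le_rfl) ⟨Subtype.val, continuous_subtype_val⟩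
    (fun p => by simp)
  let φ : C(hesse t₀, hesse t₁) := ⟨fun p => ⟨q (p, 1), by simpa using h1 p 1⟩, by fun_prop⟩
  refine ⟨φ, fun a => ?_⟩
  rw [IsContinuation, ← H1map_comp]
  exact congrArg (fun f => f a) (H1map_eq_of_homotopy
    (f := fibreIncl c 0 c.source) (g := (fibreIncl c 1 c.target).comp φ)
    { toFun := fun x => (⟨(x.1, q (x.2, x.1)), h1 x.2 x.1⟩ : pathFamily c)
      continuous_toFun := by fun_prop
      map_zero_left := fun p => Subtype.ext (Prod.ext rfl (h2 p))
      map_one_left := fun p => Subtype.ext rfl })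

/-- The continuation of a class is unique: the last fibre is a retract of the family, by the
homotopy lifting property for `(s, τ) ↦ max s τ`. -/
lemma injective_H1map_fibreIncl (c : Path t₀ t₁) (hc : ∀ s, c s ∈ smoothBase) :
    Function.Injective (H1map (fibreIncl c 1 c.target)) := by
  obtain ⟨q, h1, h2, h3⟩ := exists_lift (Z := pathFamily c) c.toContinuousMap hc
    ⟨fun x => max x.1.1.1 x.2, by fun_prop⟩ (fun _ _ _ => continuous_max_dist _ _ _)
    ⟨fun x => x.1.2, by fun_prop⟩
    (fun x => by
      have : max x.1.1 (0 : I) = x.1.1 := max_eq_left x.1.1.2.1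
      simpa [this] using (show x.1.2 ∈ hesse (c x.1.1) from x.2))
  have hm (τ : I) : max τ (1 : I) = 1 := max_eq_right τ.2.2
  let r : C(pathFamily c, hesse t₁) :=
    ⟨fun x => ⟨q (x, 1), by simpa [hm] using h1 x 1⟩, by fun_prop⟩
  have hr : r.comp (fibreIncl c 1 c.target) = ContinuousMap.id _ := by
    ext p
    refine congrArg Subtype.val (Subtype.ext ?_ : r _ = p)
    refine h3 (fibreIncl c 1 c.target p) (fun s => ?_) 1
    have h (s : I) : max (1 : I) s = 1 := max_eq_left s.2.2
    simp [fibreIncl, h]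
  intro a b h
  have := congrArg (H1map r) h
  rwa [← H1map_comp, ← H1map_comp, hr, H1map_id, H1map_id] at this

/-- Continuation along a path in `S` only depends on the homotopy class of the path. -/
lemma IsContinuation.of_homotopy {c c' : Path t₀ t₁} (H : c.Homotopy c')
    (hH : ∀ x, H x ∈ smoothBase) {a : H1 (hesse t₀)} {b : H1 (hesse t₁)}
    (h : IsContinuation c a b) : IsContinuation c' a b := by
  let E : Set ((I × I) × P2) := {x | x.2 ∈ hesse (H x.1)}
  obtain ⟨q, h1, h2, h3⟩ := exists_lift (Z := E) H.toContinuousMap hH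
    ⟨fun x => (x.1.1.1.1, max x.1.1.1.2 x.2), by fun_prop⟩
    (fun x s s' => by
      rw [Prod.dist_eq]
      simpa using continuous_max_dist x.1.1.2 s s')
    ⟨fun x => x.1.2, by fun_prop⟩
    (fun x => by
      have : max x.1.1.2 (0 : I) = x.1.1.2 := max_eq_left x.1.1.2.2.1
      simpa [this] using (show x.1.2 ∈ hesse (H x.1.1) from x.2))
  have hm (τ : I) : max τ (1 : I) = 1 := max_eq_right τ.2.2
  let r : C(E, hesse t₁) :=
    ⟨fun x => ⟨q (x, 1), by simpa [hm] using h1 x 1⟩, by fun_prop⟩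
  have hr (x : E) (hx : x.1.1.2 = 1) : (r x : P2) = x.1.2 := by
    refine h3 x (fun s => ?_) 1
    have h (s : I) : max (1 : I) s = 1 := max_eq_left s.2.2
    simp [hx, h]
  -- the retraction of the family over the path `H (u, ·)`
  have key (u : I) (d : Path t₀ t₁) (hd : ∀ s, H (u, s) = d s) (b : H1 (hesse t₁))
      (hb : IsContinuation d a b) :
      b = H1map (r.comp ⟨fun p : hesse t₀ => ⟨((u, 0), p.1), by simp [E]⟩, by fun_prop⟩) a := by
    let j : C(pathFamily d, E) := ⟨fun x => ⟨((u, x.1.1), x.1.2), by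
      change x.1.2 ∈ hesse (H (u, x.1.1)); rw [hd]; exact x.2⟩, by fun_prop⟩
    have h4 := congrArg (H1map (r.comp j)) hb
    rw [← H1map_comp, ← H1map_comp] at h4
    have h5 : (r.comp j).comp (fibreIncl d 1 d.target) = ContinuousMap.id _ := by
      ext p
      exact hr (j (fibreIncl d 1 d.target p)) rfl
    rw [h5, H1map_id] at h4
    rw [← h4]
    rfl
  obtain ⟨φ, hφ⟩ := exists_isContinuation c' (fun s => by simpa using hH (1, s))
  have e0 := key 0 c (by simp) b h
  have e1 := key 1 c' (by simp) _ (hφ a)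
  have e : b = H1map φ a := by
    rw [e0, e1]
    exact congrArg (fun f => f a) (H1map_eq_of_homotopy
      (f := r.comp ⟨fun p : hesse t₀ => ⟨((0, 0), p.1), by simp [E]⟩, by fun_prop⟩)
      (g := r.comp ⟨fun p : hesse t₀ => ⟨((1, 0), p.1), by simp [E]⟩, by fun_prop⟩)
      { toFun := fun x : I × hesse t₀ => r ⟨((x.1, 0), x.2.1), by simp [E]⟩
        continuous_toFun := by fun_prop
        map_zero_left := fun p => rfl
        map_one_left := fun p => rfl })
  rw [e]
  exact hφ a

/-- Continuation along two consecutive parts of a path. -/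
lemma IsContinuation.concat {t : ℂ} {c : Path t₀ t₁} {c₀ : Path t₀ t} {c₁ : Path t t₁}
    (α β : C(I, I)) (hα : ∀ s, c₀ s = c (α s)) (hβ : ∀ s, c₁ s = c (β s)) (h0 : α 0 = 0)
    (h1 : α 1 = β 0) (h2 : β 1 = 1) {a : H1 (hesse t₀)} {m : H1 (hesse t)} {b : H1 (hesse t₁)}
    (ha : IsContinuation c₀ a m) (hb : IsContinuation c₁ m b) : IsContinuation c a b := by
  let f : C(pathFamily c₀, pathFamily c) := ⟨fun x => ⟨(α x.1.1, x.1.2), by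
    change x.1.2 ∈ hesse (c (α x.1.1)); rw [← hα]; exact x.2⟩, by fun_prop⟩
  let g : C(pathFamily c₁, pathFamily c) := ⟨fun x => ⟨(β x.1.1, x.1.2), by
    change x.1.2 ∈ hesse (c (β x.1.1)); rw [← hβ]; exact x.2⟩, by fun_prop⟩
  have e1 := congrArg (H1map f) ha
  have e2 := congrArg (H1map g) hb
  rw [← H1map_comp, ← H1map_comp] at e1 e2
  have f0 : f.comp (fibreIncl c₀ 0 c₀.source) = fibreIncl c 0 c.source := by
    exact ContinuousMap.ext fun p =>
      Subtype.ext (congrArg (fun s : I => ((s, p.1) : I × P2)) h0)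
  have f1 : f.comp (fibreIncl c₀ 1 c₀.target) = g.comp (fibreIncl c₁ 0 c₁.source) := by
    exact ContinuousMap.ext fun p =>
      Subtype.ext (congrArg (fun s : I => ((s, p.1) : I × P2)) h1)
  have g1 : g.comp (fibreIncl c₁ 1 c₁.target) = fibreIncl c 1 c.target := by
    exact ContinuousMap.ext fun p =>
      Subtype.ext (congrArg (fun s : I => ((s, p.1) : I × P2)) h2)
  rw [IsContinuation, ← f0, ← g1, e1, f1, e2]

lemma IsContinuation.trans {t : ℂ} {c₀ : Path t₀ t} {c₁ : Path t t₁} {a : H1 (hesse t₀)}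
    {m : H1 (hesse t)} {b : H1 (hesse t₁)} (ha : IsContinuation c₀ a m)
    (hb : IsContinuation c₁ m b) : IsContinuation (c₀.trans c₁) a b := by
  refine IsContinuation.concat
    (α := ⟨fun s => ⟨s / 2, by have := s.2.1; have := s.2.2; constructor <;> linarith⟩,
      by fun_prop⟩)
    (β := ⟨fun s => ⟨(1 + s) / 2, by have := s.2.1; have := s.2.2; constructor <;> linarith⟩,
      by fun_prop⟩)
    (fun s => ?_) (fun s => ?_) ?_ ?_ ?_ ha hb
  · rw [Path.trans_apply, dif_pos]
    · congr 1
      ext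
      simp only [ContinuousMap.coe_mk]; ring
    · simp only [ContinuousMap.coe_mk]; linarith [s.2.2]
  · rw [Path.trans_apply]
    split_ifs with h
    · have hs : (s : ℝ) = 0 := by
        simp only [ContinuousMap.coe_mk] at h; linarith [s.2.1]
      have hs' : s = 0 := Subtype.ext hs
      subst hs'
      have : (⟨2 * ((1 + ((0 : I) : ℝ)) / 2), by simp⟩ : I) = 1 := Subtype.ext (by simp)
      simp only [ContinuousMap.coe_mk, this, Path.source, Path.target]
    · congr 1
      ext
      simp only [ContinuousMap.coe_mk]; ring
  · ext; simp
  · ext; simp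
  · ext; simp

end Continuation

/-! ### The curved triangle -/

/-- The real polynomial which is negative in the interior of the curved triangle and vanishes on
its boundary. Up to the factor `27`, it is the discriminant of `X³ - 3tX² + 3t̄X - 1`. -/
def triangleFn (t : ℂ) : ℝ := 3 * ‖t‖ ^ 4 - 8 * (t ^ 3).re + 6 * ‖t‖ ^ 2 - 1

lemma continuous_triangleFn : Continuous triangleFn := by unfold triangleFn; fun_prop

lemma re_pow_three_le (t : ℂ) : (t ^ 3).re ≤ ‖t‖ ^ 3 :=
  (Complex.re_le_norm (t ^ 3)).trans_eq (norm_pow t 3)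

lemma triangleFn_discr {a b c t : ℂ} (h1 : 3 * t = a + b + c)
    (h2 : 3 * starRingEnd ℂ t = a * b + b * c + c * a) (h3 : a * b * c = 1) :
    (27 * triangleFn t : ℂ) = ((a - b) * (b - c) * (c - a)) ^ 2 := by
  have hn : ((‖t‖ : ℝ) : ℂ) ^ 2 = t * starRingEnd ℂ t := (Complex.mul_conj' t).symm
  have hr : (((t ^ 3).re : ℝ) : ℂ) = (t ^ 3 + starRingEnd ℂ t ^ 3) / 2 := by
    rw [Complex.re_eq_add_conj, map_pow]
  have ht : t = (a + b + c) / 3 := by rw [← h1]; ring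
  have ht' : starRingEnd ℂ t = (a * b + b * c + c * a) / 3 := by rw [← h2]; ring
  rw [triangleFn]
  push_cast
  rw [show ((‖t‖ : ℝ) : ℂ) ^ 4 = (((‖t‖ : ℝ) : ℂ) ^ 2) ^ 2 by ring, hn, hr, ht', ht]
  linear_combination (-4 * (a + b + c) ^ 3 + 18 * (a + b + c) * (a * b + b * c + c * a)
    - 27 * (a * b * c + 1)) * (-h3)

/-- For `t` in the triangle, the three roots `x²/y`, `y²/x`, `1/(xy)` are on the unit circle, and
their difference product is purely imaginary. -/
lemma triangleFn_nonpos {t : ℂ} (ht : t ∈ curvedTriangle) : triangleFn t ≤ 0 := by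
  obtain ⟨x, y, hx, hy, rfl⟩ := ht
  have hx0 : x ≠ 0 := fun h => by simp [h] at hx
  have hy0 : y ≠ 0 := fun h => by simp [h] at hy
  have cx : starRingEnd ℂ x = x⁻¹ := (Complex.inv_eq_conj hx).symm
  have cy : starRingEnd ℂ y = y⁻¹ := (Complex.inv_eq_conj hy).symm
  set D : ℂ := (x ^ 2 / y - y ^ 2 / x) * (y ^ 2 / x - 1 / (x * y)) * (1 / (x * y) - x ^ 2 / y)
    with hD
  have key := triangleFn_discr (t := (x ^ 3 + y ^ 3 + 1) / (3 * x * y)) (a := x ^ 2 / y)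
    (b := y ^ 2 / x) (c := 1 / (x * y)) (by field_simp)
    (by simp only [map_div₀, map_add, map_mul, map_pow, cx, cy, map_one, Complex.conj_ofNat]
        field_simp; ring) (by field_simp)
  rw [← hD] at key
  have hconj : starRingEnd ℂ D = -D := by
    rw [hD]
    simp only [map_div₀, map_sub, map_mul, map_pow, cx, cy, map_one]
    field_simp
    ring
  have hre : D.re = 0 := by
    have := congrArg Complex.re hconj
    simp at this
    linarith
  have := congrArg Complex.re key
  rw [pow_two, Complex.mul_re D D, hre] at this
  have e : ((27 * triangleFn ((x ^ 3 + y ^ 3 + 1) / (3 * x * y)) : ℂ)).re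
      = 27 * triangleFn ((x ^ 3 + y ^ 3 + 1) / (3 * x * y)) := by
    simp
  rw [e] at this
  nlinarith [mul_self_nonneg D.im]

/-- The cubic `X³ - 3tX² + 3t̄X - 1` is self-inversive: with a root `a` off the unit circle it has
the root `1/ā ≠ a`, the third root is on the circle, and the difference product is real. -/
lemma triangleFn_nonneg_of_norm_ne_one {a b c t : ℂ} (h1 : 3 * t = a + b + c)
    (h2 : 3 * starRingEnd ℂ t = a * b + b * c + c * a) (h3 : a * b * c = 1) (ha : ‖a‖ ≠ 1) :
    0 ≤ triangleFn t := by
  have ha0 : a ≠ 0 := by rintro rfl; simp at h3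
  have hb0 : b ≠ 0 := by rintro rfl; simp at h3
  have hc0 : c ≠ 0 := by rintro rfl; simp at h3
  set w := (starRingEnd ℂ a)⁻¹ with hw
  have hca0 : starRingEnd ℂ a ≠ 0 := by simpa using ha0
  have hroot : a ^ 3 - 3 * t * a ^ 2 + 3 * starRingEnd ℂ t * a - 1 = 0 := by
    rw [h1, h2]; linear_combination h3
  have hroot' := congrArg (starRingEnd ℂ) hroot
  simp only [map_sub, map_add, map_mul, map_pow, map_one, map_zero, Complex.conj_conj,
    Complex.conj_ofNat] at hroot'
  have hw3 : w ^ 3 - 3 * t * w ^ 2 + 3 * starRingEnd ℂ t * w - 1 = 0 := by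
    rw [hw]
    field_simp
    linear_combination -hroot'
  have hprod : (w - a) * ((w - b) * (w - c)) = 0 := by
    have : w ^ 3 - (a + b + c) * w ^ 2 + (a * b + b * c + c * a) * w - 1 = 0 := by
      rw [← h1, ← h2]; exact hw3
    linear_combination this - h3
  have hwa : w - a ≠ 0 := by
    intro h
    apply ha
    have h' : a * starRingEnd ℂ a = 1 := by
      rw [← inv_mul_cancel₀ hca0, ← hw, sub_eq_zero.1 h]
    rw [Complex.mul_conj'] at h'
    have h'' : ‖a‖ ^ 2 = 1 := by exact_mod_cast h'
    nlinarith [norm_nonneg a]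
  -- the real difference product
  have main : ∀ b c : ℂ, c ≠ 0 → a * b * c = 1 → 3 * t = a + b + c →
      3 * starRingEnd ℂ t = a * b + b * c + c * a → w = b → 0 ≤ triangleFn t := by
    intro b c hc0 h3 h1 h2 hwb
    have key := triangleFn_discr h1 h2 h3
    set D := (a - b) * (b - c) * (c - a) with hD
    have ca : starRingEnd ℂ a = b⁻¹ := by rw [← hwb, hw, inv_inv]
    have cb : starRingEnd ℂ b = a⁻¹ := by rw [← hwb, hw, map_inv₀, Complex.conj_conj]
    have hb0 : b ≠ 0 := by rintro rfl; simp at h3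
    have hc : c = (a * b)⁻¹ := by field_simp; linear_combination h3
    have cc : starRingEnd ℂ c = c⁻¹ := by
      rw [hc, map_inv₀, map_mul, ca, cb]; field_simp
    have hconj : starRingEnd ℂ D = D := by
      rw [hD]
      simp only [map_sub, map_mul, ca, cb, cc]
      rw [hc]
      field_simp
    obtain ⟨r, hr⟩ := Complex.conj_eq_iff_real.1 hconj
    rw [hr] at key
    have : 27 * triangleFn t = r ^ 2 := by exact_mod_cast key
    nlinarith [sq_nonneg r]
  rcases mul_eq_zero.1 (mul_eq_zero.1 hprod |>.resolve_left hwa) with h | h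
  · exact main b c hc0 h3 h1 h2 (sub_eq_zero.1 h)
  · exact main c b hb0 (by linear_combination h3) (by linear_combination h1)
      (by linear_combination h2) (sub_eq_zero.1 h)

lemma mem_curvedTriangle_of_neg {t : ℂ} (ht : triangleFn t < 0) : t ∈ curvedTriangle := by
  obtain ⟨a, b, c, h1, h2, h3⟩ := exists_cubic_roots (-(3 * t)) (3 * starRingEnd ℂ t) (-1)
  have h1 : 3 * t = a + b + c := by linear_combination -h1
  have h3 : a * b * c = 1 := by linear_combination h3
  have ha : ‖a‖ = 1 := by
    by_contra h
    exact ht.not_ge (triangleFn_nonneg_of_norm_ne_one h1 h2 h3 h)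
  have hb : ‖b‖ = 1 := by
    by_contra h
    exact ht.not_ge (triangleFn_nonneg_of_norm_ne_one (a := b) (b := c) (c := a)
      (by linear_combination h1) (by linear_combination h2) (by linear_combination h3) h)
  obtain ⟨x, hx⟩ : ∃ x : ℂ, x ^ 3 = a ^ 2 * b := IsAlgClosed.exists_pow_nat_eq _ (by norm_num)
  have hx1 : ‖x‖ = 1 := by
    have : ‖x‖ ^ 3 = 1 := by rw [← norm_pow, hx]; simp [ha, hb]
    exact (pow_eq_one_iff_of_nonneg (norm_nonneg x) (by norm_num)).1 this
  have ha0 : a ≠ 0 := by rintro rfl; simp at ha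
  have hb0 : b ≠ 0 := by rintro rfl; simp at hb
  have hx0 : x ≠ 0 := by rintro rfl; simp at hx1
  refine ⟨x, x ^ 2 / a, hx1, by simp [hx1, ha], ?_⟩
  have hc : c = (a * b)⁻¹ := by field_simp; linear_combination h3
  have hb' : b = x ^ 3 / a ^ 2 := by rw [hx]; field_simp
  have ht' : t = (a + b + c) / 3 := by rw [← h1]; ring
  rw [ht', hc, hb']
  field_simp

lemma triangleFn_nonneg {t : ℂ} (ht : t ∉ interior curvedTriangle) : 0 ≤ triangleFn t := by
  by_contra h
  push Not at h
  exact ht (mem_interior.2 ⟨{s | triangleFn s < 0}, fun s hs => mem_curvedTriangle_of_neg hs,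
    isOpen_lt continuous_triangleFn continuous_const, h⟩)

/-- The function is strictly increasing along rays. -/
lemma triangleFn_lt_smul {t : ℂ} (ht : t ≠ 0) {r : ℝ} (hr : 1 < r) :
    triangleFn t < triangleFn (r * t) := by
  have hm : 0 < ‖t‖ := norm_pos_iff.2 ht
  have hR := re_pow_three_le t
  have e : ((r * t : ℂ) ^ 3).re = r ^ 3 * (t ^ 3).re := by
    rw [mul_pow, ← Complex.ofReal_pow, Complex.re_ofReal_mul]
  have hn : ‖(r * t : ℂ)‖ = r * ‖t‖ := by simp [abs_of_pos (zero_lt_one.trans hr)]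
  rw [triangleFn, triangleFn, e, hn]
  set m := ‖t‖
  set R := (t ^ 3).re
  have h3 : 0 < r ^ 3 - 1 := by nlinarith [sq_nonneg r]
  have q : 0 < 3 * (r ^ 3 + r ^ 2 + r + 1) * m ^ 2 - 8 * (r ^ 2 + r + 1) * m + 6 * (r + 1) := by
    have hA : 0 < 3 * (r ^ 3 + r ^ 2 + r + 1) := by positivity
    have h := mul_pos (mul_pos (sub_pos.2 hr) (sub_pos.2 hr))
      (show 0 < r ^ 2 + 4 * r + 1 by positivity)
    -- the discriminant of `q` as a quadratic polynomial in `m` is negative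
    by_contra hq
    push Not at hq
    have := mul_nonpos_of_nonneg_of_nonpos hA.le hq
    nlinarith [sq_nonneg (3 * (r ^ 3 + r ^ 2 + r + 1) * m - 4 * (r ^ 2 + r + 1))]
  have := mul_pos (mul_pos (pow_pos hm 2) (sub_pos.2 hr)) q
  nlinarith [mul_le_mul_of_nonneg_left hR h3.le]

lemma triangleFn_zero : triangleFn 0 = -1 := by simp [triangleFn]

/-- Since the function is at most zero on the triangle and increases along rays, it is negative in
the interior. -/
lemma notMem_interior {t : ℂ} (ht : 0 ≤ triangleFn t) : t ∉ interior curvedTriangle := by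
  intro h
  have ht0 : t ≠ 0 := by rintro rfl; rw [triangleFn_zero] at ht; linarith
  have hc : ContinuousAt (fun r : ℝ => (r * t : ℂ)) 1 := by fun_prop
  have hnear : ∀ᶠ r : ℝ in nhds 1, (r * t : ℂ) ∈ curvedTriangle :=
    hc (by simpa using mem_interior_iff_mem_nhds.1 h)
  have h2 : ∀ᶠ r : ℝ in nhdsWithin 1 (Set.Ioi 1), (r * t : ℂ) ∈ curvedTriangle ∧ 1 < r :=
    (hnear.filter_mono nhdsWithin_le_nhds).and self_mem_nhdsWithin
  obtain ⟨r, hr, hr1⟩ := h2.exists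
  linarith [triangleFn_nonpos hr, triangleFn_lt_smul ht0 hr1]

lemma third_le_norm {t : ℂ} (ht : 0 ≤ triangleFn t) : 1 / 3 ≤ ‖t‖ := by
  by_contra h
  push Not at h
  have hR : -(t ^ 3).re ≤ ‖t‖ ^ 3 := (Complex.re_le_norm (-(t ^ 3))).trans_eq
    ((norm_neg _).trans (norm_pow t 3))
  rw [triangleFn] at ht
  have := norm_nonneg t
  have : (‖t‖ + 1) ^ 3 * (3 * ‖t‖ - 1) < 0 :=
    mul_neg_of_pos_of_neg (by positivity) (by linarith)
  nlinarith

lemma triangleFn_pos_of_one_lt_norm {t : ℂ} (ht : 1 < ‖t‖) : 0 < triangleFn t := by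
  have hR := re_pow_three_le t
  have : 0 < (‖t‖ - 1) ^ 3 * (3 * ‖t‖ + 1) := mul_pos (pow_pos (by linarith) 3) (by linarith)
  rw [triangleFn]
  nlinarith

lemma triangleFn_of_pow_eq {t : ℂ} {r : ℝ} (hr : 0 ≤ r) (h : t ^ 3 = (r ^ 3 : ℝ)) :
    triangleFn t = (r - 1) ^ 3 * (3 * r + 1) := by
  have hn : ‖t‖ = r := by
    have : ‖t‖ ^ 3 = r ^ 3 := by rw [← norm_pow, h, Complex.norm_real]; simp [abs_of_nonneg hr]
    exact (pow_left_inj₀ (norm_nonneg t) hr (by norm_num)).1 this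
  rw [triangleFn, h, Complex.ofReal_re, hn]
  ring

lemma triangleFn_ofReal (r : ℝ) : triangleFn r = (r - 1) ^ 3 * (3 * r + 1) := by
  rw [triangleFn, ← Complex.ofReal_pow, Complex.ofReal_re, Complex.norm_real,
    show ‖r‖ ^ 4 = (‖r‖ ^ 2) ^ 2 by ring]
  simp only [Real.norm_eq_abs, sq_abs]
  ring

lemma mem_smoothBase_of_pos {t : ℂ} (ht : 0 < triangleFn t) : t ∈ smoothBase := by
  intro h
  rw [triangleFn_of_pow_eq zero_le_one (by simpa using h)] at ht
  simp at ht

/-- The complex plane, slit from the cube roots of unity to infinity along rays. -/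
def slitBase : Set ℂ := {t | (t ^ 3).im = 0 → (t ^ 3).re < 1}

lemma slitBase_subset : slitBase ⊆ smoothBase := by
  intro t ht h
  have := ht (by simp [h])
  simp [h] at this

lemma starConvex_slitBase : StarConvex ℝ 0 slitBase := by
  intro t ht a r ha hr har
  rw [smul_zero, zero_add]
  intro h
  have e : (r • t) ^ 3 = ((r ^ 3 : ℝ) : ℂ) * t ^ 3 := by
    rw [Complex.real_smul]; push_cast; ring
  rw [e, Complex.re_ofReal_mul]
  rw [e, Complex.im_ofReal_mul] at h
  rcases hr.eq_or_lt with rfl | hr0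
  · simp
  · have h3 := ht ((mul_eq_zero.1 h).resolve_left (by positivity))
    have hr3 : r ^ 3 ≤ 1 := pow_le_one₀ hr (by linarith)
    have : 0 < r ^ 3 := by positivity
    nlinarith

lemma exists_cube_of_notMem_slitBase {t : ℂ} (h : t ∉ slitBase) :
    ∃ r : ℝ, 1 ≤ r ∧ t ^ 3 = (r ^ 3 : ℝ) := by
  simp only [slitBase, Set.mem_ofPred_eq, not_forall, not_lt] at h
  obtain ⟨him, hre⟩ := h
  refine ⟨(t ^ 3).re ^ (1 / 3 : ℝ), Real.one_le_rpow hre (by norm_num), ?_⟩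
  have : ((t ^ 3).re ^ (1 / 3 : ℝ)) ^ 3 = (t ^ 3).re := by
    rw [← Real.rpow_natCast, ← Real.rpow_mul (by linarith)]
    norm_num
  rw [this]
  exact Complex.ext (by simp) (by simpa using him)

lemma mem_slitBase {t : ℂ} (hK : t ∈ curvedTriangle) (hS : t ∈ smoothBase) : t ∈ slitBase := by
  by_contra h
  obtain ⟨r, hr, h⟩ := exists_cube_of_notMem_slitBase h
  have hf := triangleFn_nonpos hK
  rw [triangleFn_of_pow_eq (by linarith) h] at hf
  rcases hr.eq_or_lt with rfl | hr
  · exact hS (by simpa using h)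
  · have : 0 < (r - 1) ^ 3 * (3 * r + 1) := mul_pos (pow_pos (by linarith) 3) (by linarith)
    linarith

/-- The open sector `2π/3 < arg t < 4π/3`. -/
def sector : Set ℂ := {t | 2 * t.re < -‖t‖}

lemma sector_subset : sector ⊆ slitBase := by
  intro t ht h
  have ht : 2 * t.re < -‖t‖ := ht
  have hn : ‖t‖ ^ 2 = t.re ^ 2 + t.im ^ 2 := by
    rw [← Complex.normSq_eq_norm_sq, Complex.normSq_apply]; ring
  have h0 := norm_nonneg t
  have e : (t ^ 3).im = t.im * (3 * t.re ^ 2 - t.im ^ 2) := by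
    simp [pow_succ]; ring
  have e' : (t ^ 3).re = t.re * (t.re ^ 2 - 3 * t.im ^ 2) := by
    simp [pow_succ]; ring
  have h4 : 0 < 3 * t.re ^ 2 - t.im ^ 2 := by nlinarith
  rw [e] at h
  have h5 := (mul_eq_zero.1 h).resolve_right h4.ne'
  rw [e', h5]
  nlinarith [sq_nonneg t.re]

lemma convex_sector : Convex ℝ sector := by
  intro s hs t ht a b ha hb hab
  have hs : 2 * s.re < -‖s‖ := hs
  have ht : 2 * t.re < -‖t‖ := ht
  have := norm_add_le (a • s) (b • t)
  rw [norm_smul, norm_smul, Real.norm_of_nonneg ha, Real.norm_of_nonneg hb] at this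
  show 2 * (a • s + b • t).re < -‖a • s + b • t‖
  simp only [Complex.add_re, Complex.smul_re, smul_eq_mul]
  rcases ha.eq_or_lt with rfl | ha
  · have : b = 1 := by linarith
    subst this
    simpa using ht
  · nlinarith

/-! ### Paths in the base -/

lemma basePt_pow : basePt ^ 3 = 1 / 2 := by
  rw [basePt, ← Complex.ofReal_pow, inv_pow, ← Real.rpow_natCast, ← Real.rpow_mul (by norm_num)]
  norm_num

/-- The base point as a real number. -/
def baseReal : ℝ := ((2 : ℝ) ^ (1 / 3 : ℝ))⁻¹

lemma basePt_eq : basePt = (baseReal : ℂ) := rfl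

lemma baseReal_pos : 0 < baseReal := by unfold baseReal; positivity

lemma baseReal_pow : baseReal ^ 3 = 1 / 2 := by
  have := basePt_pow
  rw [basePt_eq] at this
  have h : ((baseReal ^ 3 : ℝ) : ℂ) = ((1 / 2 : ℝ) : ℂ) := by push_cast; simpa using this
  exact_mod_cast h

lemma baseReal_lt_one : baseReal < 1 := by
  by_contra h
  push Not at h
  have := one_le_pow₀ h (n := 3)
  rw [baseReal_pow] at this
  norm_num at this

lemma neg_third_mem : (-1 / 3 : ℂ) ∈ curvedTriangle := ⟨1, -1, by simp, by simp, by norm_num⟩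

lemma ofReal_mem_slitBase {r : ℝ} (hr : r < 1) : (r : ℂ) ∈ slitBase := by
  intro _
  rw [← Complex.ofReal_pow, Complex.ofReal_re]
  nlinarith [sq_nonneg (r + 1), sq_nonneg r, sq_nonneg (r + 1 / 2)]

lemma joinedIn_basePt : JoinedIn (curvedTriangle ∩ smoothBase) basePt (-1 / 3) := by
  apply JoinedIn.of_segment_subset
  intro z hz
  obtain ⟨a, b, ha, hb, hab, rfl⟩ := hz
  have e : a • basePt + b • (-1 / 3 : ℂ) = ((a * baseReal + b * (-1 / 3) : ℝ) : ℂ) := by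
    rw [basePt_eq, Complex.real_smul, Complex.real_smul]; push_cast; ring
  have h1 := baseReal_pos
  have h2 := baseReal_lt_one
  rcases ha.eq_or_lt with rfl | ha
  · have : b = 1 := by linarith
    subst this
    refine ⟨by simpa using neg_third_mem, slitBase_subset ?_⟩
    rw [e]
    exact ofReal_mem_slitBase (by norm_num)
  · rw [e]
    have hlt : a * baseReal + b * (-1 / 3) < 1 := by nlinarith
    have hgt : -1 / 3 < a * baseReal + b * (-1 / 3) := by nlinarith
    refine ⟨mem_curvedTriangle_of_neg ?_, slitBase_subset (ofReal_mem_slitBase hlt)⟩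
    rw [triangleFn_ofReal]
    exact mul_neg_of_neg_of_pos (Odd.pow_neg (by decide) (by linarith)) (by linarith)

/-- The points of the smooth base where the cycle of Deninger is defined. -/
def outerBase : Set ℂ := {t | 0 ≤ triangleFn t} ∩ smoothBase

lemma ne_zero_of_mem_outerBase {t : ℂ} (ht : t ∈ outerBase) : t ≠ 0 := by
  rintro rfl
  have : 0 ≤ triangleFn 0 := ht.1
  rw [triangleFn_zero] at this
  linarith

lemma smul_mem_outerBase {t : ℂ} (ht : t ∈ outerBase) {r : ℝ} (hr : 1 ≤ r) :
    (r * t : ℂ) ∈ outerBase := by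
  rcases hr.eq_or_lt with rfl | hr
  · simpa using ht
  · have := triangleFn_lt_smul (ne_zero_of_mem_outerBase ht) hr
    have h0 : 0 ≤ triangleFn t := ht.1
    exact ⟨show 0 ≤ triangleFn _ by linarith, mem_smoothBase_of_pos (by linarith)⟩

lemma mem_outerBase_of_one_lt_norm {t : ℂ} (ht : 1 < ‖t‖) : t ∈ outerBase :=
  ⟨(triangleFn_pos_of_one_lt_norm ht).le,
    mem_smoothBase_of_pos (triangleFn_pos_of_one_lt_norm ht)⟩

lemma segment_ray {t z : ℂ} {r : ℝ} (hr : 1 ≤ r) (hz : z ∈ segment ℝ t (r * t)) :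
    ∃ q : ℝ, 1 ≤ q ∧ z = q * t := by
  obtain ⟨a, b, ha, hb, hab, rfl⟩ := hz
  refine ⟨a + b * r, by nlinarith, ?_⟩
  rw [Complex.real_smul, Complex.real_smul]; push_cast; ring

lemma joinedIn_ray {t : ℂ} (ht : t ∈ outerBase) {r : ℝ} (hr : 1 ≤ r) :
    JoinedIn outerBase t (r * t) := by
  apply JoinedIn.of_segment_subset
  intro z hz
  obtain ⟨q, hq, rfl⟩ := segment_ray hr hz
  exact smul_mem_outerBase ht hq

/-- Points outside of the triangle can be moved along rays to a large circle. -/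
lemma joinedIn_outerBase {s t : ℂ} (hs : s ∈ outerBase) (ht : t ∈ outerBase) :
    JoinedIn outerBase s t := by
  have hR : ∀ t ∈ outerBase, ∃ u ∈ Metric.sphere (0 : ℂ) 3, JoinedIn outerBase t u ∨
      JoinedIn outerBase u t := by
    intro t ht
    have h0 : 0 < ‖t‖ := norm_pos_iff.2 (ne_zero_of_mem_outerBase ht)
    refine ⟨((3 / ‖t‖ : ℝ) : ℂ) * t, by simp; field_simp, ?_⟩
    rcases le_total ‖t‖ 3 with h | h
    · left
      exact joinedIn_ray ht (by rw [le_div_iff₀ h0]; linarith)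
    · right
      have h1 : 3 / ‖t‖ * (‖t‖ / 3) = 1 := by field_simp
      have hmem : ((3 / ‖t‖ : ℝ) : ℂ) * t ∈ outerBase :=
        mem_outerBase_of_one_lt_norm (by simp; field_simp; norm_num)
      have := joinedIn_ray hmem (r := ‖t‖ / 3) (by linarith)
      rwa [← mul_assoc, ← Complex.ofReal_mul, mul_comm (‖t‖ / 3), h1, Complex.ofReal_one,
        one_mul] at this
  obtain ⟨u, hu, hsu⟩ := hR s hs
  obtain ⟨v, hv, htv⟩ := hR t ht
  have hpc : IsPathConnected (Metric.sphere (0 : ℂ) 3) :=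
    isPathConnected_sphere (by rw [Complex.rank_real_complex]; norm_num) 0 (by norm_num)
  have huv : JoinedIn outerBase u v := (hpc.joinedIn u hu v hv).mono fun z hz =>
    mem_outerBase_of_one_lt_norm (by rw [mem_sphere_zero_iff_norm.1 hz]; norm_num)
  have h1 : JoinedIn outerBase s u := hsu.elim id JoinedIn.symm
  have h2 : JoinedIn outerBase v t := htv.elim JoinedIn.symm id
  exact (h1.trans huv).trans h2

lemma neg_third_mem_outerBase : (-1 / 3 : ℂ) ∈ outerBase := by
  have e : (-1 / 3 : ℂ) = ((-1 / 3 : ℝ) : ℂ) := by push_cast; ring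
  rw [e]
  refine ⟨?_, slitBase_subset (ofReal_mem_slitBase (by norm_num))⟩
  show 0 ≤ triangleFn _
  rw [triangleFn_ofReal]
  norm_num

lemma exists_isAdmissible {t : ℂ} (ht : t ∈ outerBase) : ∃ c : Path basePt t, IsAdmissible c := by
  obtain ⟨c₀, h₀⟩ := joinedIn_basePt
  obtain ⟨c₁, h₁⟩ := joinedIn_outerBase neg_third_mem_outerBase ht
  refine ⟨c₀.trans c₁, ?_, ⟨1 / 2, by norm_num⟩, ?_, ?_, ?_⟩
  · intro s
    rw [Path.trans_apply]
    split_ifs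
    exacts [(h₀ _).2, (h₁ _).2]
  · intro s hs
    have hs : (s : ℝ) ≤ 1 / 2 := hs
    rw [Path.trans_apply, dif_pos hs]
    exact (h₀ _).1
  · rw [Path.trans_apply, dif_pos le_rfl]
    have : c₀ ⟨2 * (1 / 2), by norm_num⟩ = -1 / 3 := by
      convert c₀.target using 2
      norm_num
    rw [this]
    norm_num
  · intro s hs
    have hs : 1 / 2 ≤ (s : ℝ) := hs
    rcases hs.eq_or_lt with h | h
    · have e : (c₀.trans c₁) s = -1 / 3 := by
        rw [Path.trans_apply, dif_pos h.symm.le]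
        convert c₀.target using 2
        apply Subtype.ext
        simp [← h]
      rw [e]
      exact notMem_interior neg_third_mem_outerBase.1
    · rw [Path.trans_apply, dif_neg h.not_ge]
      exact notMem_interior (h₁ _).1

lemma joinedIn_sector {t : ℂ} (ht : t ∈ outerBase) (hs : t ∈ sector) :
    JoinedIn (outerBase ∩ sector) (-100) t := by
  have h0 : 0 < ‖t‖ := norm_pos_iff.2 (ne_zero_of_mem_outerBase ht)
  set r : ℝ := 1 + 100 / ‖t‖ with hr
  have hr1 : 1 ≤ r := by rw [hr]; have := div_pos (by norm_num : (0 : ℝ) < 100) h0; linarith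
  have hray : ∀ q : ℝ, 1 ≤ q → (q * t : ℂ) ∈ sector := by
    intro q hq
    have hs : 2 * t.re < -‖t‖ := hs
    show 2 * (q * t : ℂ).re < -‖(q * t : ℂ)‖
    rw [Complex.re_ofReal_mul, norm_mul, Complex.norm_real, Real.norm_of_nonneg (by linarith)]
    nlinarith
  have h1 : JoinedIn (outerBase ∩ sector) t (r * t) := by
    apply JoinedIn.of_segment_subset
    intro z hz
    obtain ⟨q, hq, rfl⟩ := segment_ray hr1 hz
    exact ⟨smul_mem_outerBase ht hq, hray q hq⟩
  have h100 : (-100 : ℂ) ∈ sector := by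
    show 2 * (-100 : ℂ).re < -‖(-100 : ℂ)‖
    norm_num
  have hn : ‖(r * t : ℂ)‖ = ‖t‖ + 100 := by
    rw [norm_mul, Complex.norm_real, Real.norm_of_nonneg (by linarith), hr]
    field_simp
  have hre : (r * t : ℂ).re < -50 := by
    have : 2 * (r * t : ℂ).re < -‖(r * t : ℂ)‖ := hray r hr1
    rw [hn] at this
    linarith
  refine JoinedIn.trans (JoinedIn.of_segment_subset fun z hz => ⟨?_, ?_⟩) h1.symm
  · apply mem_outerBase_of_one_lt_norm
    obtain ⟨a, b, ha, hb, hab, rfl⟩ := hz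
    have h3 := Complex.re_le_norm (-(a • (-100 : ℂ) + b • (r * t : ℂ)))
    rw [norm_neg] at h3
    refine lt_of_lt_of_le ?_ h3
    simp only [Complex.neg_re, Complex.add_re, Complex.smul_re, smul_eq_mul, Complex.re_ofNat]
    nlinarith
  · exact convex_sector.segment_subset h100 (hray r hr1) hz

/-! ### The roots of `y³ - 3ty + 2c` -/

/-- `u`, `v`, `w` are the roots of `y³ - 3ty + 2c`. For `c = cos 3η`, these are the values of `y`
for which the point `[e^{iη} : y : e^{-iη}]` lies on `X_t`. -/
def IsRootTriple (t : ℂ) (c : ℝ) (u v w : ℂ) : Prop :=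
  u + v + w = 0 ∧ u * v + v * w + w * u = -(3 * t) ∧ u * v * w = -(2 * c)

lemma exists_isRootTriple (t : ℂ) (c : ℝ) : ∃ u v w, IsRootTriple t c u v w := by
  obtain ⟨u, v, w, h1, h2, h3⟩ := exists_cubic_roots 0 (-(3 * t)) (2 * c)
  exact ⟨u, v, w, by linear_combination h1, h2.symm, by rw [h3, neg_neg]⟩

namespace IsRootTriple

variable {t : ℂ} {c : ℝ} {u v w : ℂ}

lemma root_iff (h : IsRootTriple t c u v w) (y : ℂ) :
    y ^ 3 - 3 * t * y + 2 * c = 0 ↔ y = u ∨ y = v ∨ y = w := by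
  obtain ⟨h1, h2, h3⟩ := h
  have e : y ^ 3 - 3 * t * y + 2 * c = (y - u) * ((y - v) * (y - w)) := by
    linear_combination y ^ 2 * h1 - y * h2 + h3
  rw [e, mul_eq_zero, mul_eq_zero, sub_eq_zero, sub_eq_zero, sub_eq_zero]

lemma rotate (h : IsRootTriple t c u v w) : IsRootTriple t c v w u :=
  ⟨by linear_combination h.1, by linear_combination h.2.1, by linear_combination h.2.2⟩

lemma swap (h : IsRootTriple t c u v w) : IsRootTriple t c u w v :=
  ⟨by linear_combination h.1, by linear_combination h.2.1, by linear_combination h.2.2⟩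

lemma root (h : IsRootTriple t c u v w) : u ^ 3 - 3 * t * u + 2 * c = 0 :=
  (h.root_iff u).2 (Or.inl rfl)

lemma norm_le (h : IsRootTriple t c u v w) (hc : |c| ≤ 1) : ‖u‖ ≤ 3 * ‖t‖ + 3 := by
  have e : u ^ 3 = 3 * t * u - 2 * c := by linear_combination h.root
  have h1 : ‖u‖ ^ 3 ≤ 3 * ‖t‖ * ‖u‖ + 2 := by
    rw [← norm_pow, e]
    refine (norm_sub_le _ _).trans ?_
    simp only [norm_mul, Complex.norm_real, Real.norm_eq_abs, RCLike.norm_ofNat]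
    linarith
  by_contra hu
  push Not at hu
  have h0 := norm_nonneg t
  have h3 : 3 * ‖u‖ < ‖u‖ * ‖u‖ := by nlinarith
  have h4 : (3 * ‖t‖ + 3) * ‖u‖ < ‖u‖ * ‖u‖ := by nlinarith
  nlinarith

lemma min_ordered (h : IsRootTriple t c u v w) :
    ∃ u v w, IsRootTriple t c u v w ∧ ‖u‖ ≤ ‖v‖ ∧ ‖v‖ ≤ ‖w‖ := by
  rcases le_total ‖u‖ ‖v‖ with h1 | h1 <;> rcases le_total ‖v‖ ‖w‖ with h2 | h2 <;>
    rcases le_total ‖u‖ ‖w‖ with h3 | h3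
  · exact ⟨u, v, w, h, h1, h2⟩
  · exact ⟨u, v, w, h, h1, h2⟩
  · exact ⟨u, w, v, h.swap, h3, h2⟩
  · exact ⟨w, u, v, h.rotate.rotate, h3, h1⟩
  · exact ⟨v, u, w, h.rotate.swap, h1, h3⟩
  · exact ⟨v, w, u, h.rotate, h2, h3⟩
  · exact ⟨w, v, u, h.rotate.rotate.swap, h2, h1⟩
  · exact ⟨w, v, u, h.rotate.rotate.swap, h2, h1⟩

end IsRootTriple

/-- If a root is on the unit circle, `X_t` has a point with `|x| = |y| = 1`. -/
lemma mem_curvedTriangle_of_root {t y : ℂ} {c : ℝ} (hc : |c| ≤ 1)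
    (h : y ^ 3 - 3 * t * y + 2 * c = 0) (hy : ‖y‖ = 1) : t ∈ curvedTriangle := by
  obtain ⟨hc1, hc2⟩ := abs_le.1 hc
  set η : ℝ := Real.arccos c / 3
  set e := Complex.exp (η * Complex.I) with he
  have hn : ‖e‖ = 1 := Complex.norm_exp_ofReal_mul_I η
  have e0 : e ≠ 0 := Complex.exp_ne_zero _
  have hy0 : y ≠ 0 := by rintro rfl; simp at hy
  have hcos : (2 * c : ℂ) = e ^ 3 + (e ^ 3)⁻¹ := by
    have h3 : e ^ 3 = Complex.exp (Real.arccos c * Complex.I) := by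
      rw [he, ← Complex.exp_nat_mul]
      congr 1
      simp only [η]; push_cast; ring
    rw [h3, ← Complex.exp_neg, ← neg_mul, ← Complex.two_cos, ← Complex.ofReal_cos,
      Real.cos_arccos hc1 hc2]
  refine ⟨e ^ 2, y * e, by simp [hn], by simp [hn, hy], ?_⟩
  rw [hcos] at h
  field_simp
  field_simp at h
  linear_combination -h

/-- For large `|t|`, exactly one root lies inside the unit circle. -/
lemma IsRootTriple.of_four_lt {t : ℂ} {c : ℝ} {u v w : ℂ} (h : IsRootTriple t c u v w)
    (hc : |c| ≤ 1) (ht : 4 < ‖t‖) (h1 : ‖u‖ ≤ ‖v‖) (h2 : ‖v‖ ≤ ‖w‖) :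
    ‖u‖ ≤ 1 ∧ 1 ≤ ‖v‖ ∧ 1 ≤ ‖w‖ := by
  have hsum : 3 * ‖t‖ ≤ ‖u‖ * ‖v‖ + ‖v‖ * ‖w‖ + ‖w‖ * ‖u‖ := by
    have := norm_add₃_le (a := u * v) (b := v * w) (c := w * u)
    rw [h.2.1, norm_neg] at this
    simpa using this
  have hprod : ‖u‖ * ‖v‖ * ‖w‖ ≤ 2 := by
    rw [← norm_mul, ← norm_mul, h.2.2, norm_neg]
    simpa using hc
  have hw : ‖w‖ ≤ ‖u‖ + ‖v‖ := by
    have : w = -(u + v) := by linear_combination h.1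
    rw [this, norm_neg]
    exact norm_add_le _ _
  have := norm_nonneg u
  have hv : 1 ≤ ‖v‖ := by
    by_contra hv
    push Not at hv
    nlinarith
  refine ⟨?_, hv, hv.trans h2⟩
  by_contra hu
  push Not at hu
  have hvw : ‖v‖ * ‖w‖ ≤ 2 := by nlinarith
  have huw : ‖w‖ * ‖u‖ ≤ 2 := by nlinarith
  have huv : ‖u‖ * ‖v‖ ≤ 2 := by nlinarith
  linarith

lemma isClosed_setOf_exists {Y K : Type} [TopologicalSpace Y] [TopologicalSpace K]
    {C : Set K} (hC : IsCompact C) {r : Set (Y × K)} (hr : IsClosed r) :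
    IsClosed {y | ∃ z ∈ C, (y, z) ∈ r} := by
  have := isCompact_iff_compactSpace.1 hC
  have h1 : IsClosed ((fun q : Y × C => (q.1, (q.2 : K))) ⁻¹' r) := hr.preimage (by fun_prop)
  convert! isClosedMap_fst_of_compactSpace _ h1 using 1
  ext y
  constructor
  · rintro ⟨z, hz, h⟩
    exact ⟨(y, ⟨z, hz⟩), h, rfl⟩
  · rintro ⟨⟨y', z⟩, h2, rfl⟩
    exact ⟨z, z.2, h2⟩

/-- When `t` is not in the interior of the curved triangle, the cubic `y³ - 3ty + 2c` has one root
in the closed unit disc, and two in the closure of its complement. The position of the roots with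
respect to the circle does not change along the ray from `t` to infinity, since there is no
root on the circle outside of the triangle. -/
lemma exists_isRootTriple_norm {t : ℂ} (ht : 0 ≤ triangleFn t) {c : ℝ} (hc : |c| ≤ 1) :
    ∃ u v w, IsRootTriple t c u v w ∧ ‖u‖ ≤ 1 ∧ 1 ≤ ‖v‖ ∧ 1 ≤ ‖w‖ := by
  have ht0 : t ≠ 0 := by rintro rfl; rw [triangleFn_zero] at ht; linarith
  have hn : 0 < ‖t‖ := norm_pos_iff.2 ht0
  set R : ℝ := 2 + 5 / ‖t‖ with hR
  have hRt : 4 < ‖(R * t : ℂ)‖ := by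
    have : 0 < 5 / ‖t‖ := by positivity
    rw [norm_mul, Complex.norm_real, Real.norm_of_nonneg (by positivity), hR, add_mul,
      div_mul_cancel₀ _ hn.ne']
    linarith
  have hR1 : 1 < R := by
    have : 0 < 5 / ‖t‖ := by positivity
    linarith
  have norm_smul_le {r : ℝ} (hr : r ∈ Set.Icc 1 R) : 3 * ‖(r * t : ℂ)‖ + 3 ≤ 3 * (R * ‖t‖) + 3 := by
    rw [norm_mul, Complex.norm_real, Real.norm_of_nonneg (by linarith [hr.1])]
    nlinarith [hr.2]
  let B := Metric.closedBall (0 : ℂ) (3 * (R * ‖t‖) + 3)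
  have hB : IsCompact (B ×ˢ B ×ˢ B) := (isCompact_closedBall _ _).prod
    ((isCompact_closedBall _ _).prod (isCompact_closedBall _ _))
  have mem_B {r : ℝ} {u v w : ℂ} (hr : r ∈ Set.Icc 1 R) (h : IsRootTriple (r * t) c u v w) :
      (u, v, w) ∈ B ×ˢ B ×ˢ B := by
    refine Set.mk_mem_prod ?_ (Set.mk_mem_prod ?_ ?_)
    · exact mem_closedBall_zero_iff.2 ((h.norm_le hc).trans (norm_smul_le hr))
    · exact mem_closedBall_zero_iff.2 ((h.rotate.norm_le hc).trans (norm_smul_le hr))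
    · exact mem_closedBall_zero_iff.2 ((h.rotate.rotate.norm_le hc).trans (norm_smul_le hr))
  let T : Set (ℝ × ℂ × ℂ × ℂ) := {q | IsRootTriple (q.1 * t) c q.2.1 q.2.2.1 q.2.2.2}
  have hT : IsClosed T := by
    refine (isClosed_eq (by fun_prop) continuous_const).inter
      ((isClosed_eq (by fun_prop) (by fun_prop)).inter (isClosed_eq (by fun_prop) continuous_const))
  -- `A₁`: one root inside and two outside of the circle; `A₂`: any other position of the roots
  let A₁ := {r | ∃ q ∈ B ×ˢ B ×ˢ B, (r, q) ∈ T ∩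
    ({q : ℝ × ℂ × ℂ × ℂ | ‖q.2.1‖ ≤ 1} ∩ ({q | 1 ≤ ‖q.2.2.1‖} ∩ {q | 1 ≤ ‖q.2.2.2‖}))}
  let A₂ := {r | ∃ q ∈ B ×ˢ B ×ˢ B, (r, q) ∈ T ∩
    (({q : ℝ × ℂ × ℂ × ℂ | ‖q.2.1‖ ≤ 1} ∩ {q | ‖q.2.2.1‖ ≤ 1}) ∪
      ({q : ℝ × ℂ × ℂ × ℂ | 1 ≤ ‖q.2.1‖} ∩ ({q | 1 ≤ ‖q.2.2.1‖} ∩ {q | 1 ≤ ‖q.2.2.2‖})))}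
  have hA₁ : IsClosed A₁ := by
    refine isClosed_setOf_exists hB (hT.inter ?_)
    exact (isClosed_le (by fun_prop) continuous_const).inter
      ((isClosed_le continuous_const (by fun_prop)).inter
        (isClosed_le continuous_const (by fun_prop)))
  have hA₂ : IsClosed A₂ := by
    refine isClosed_setOf_exists hB (hT.inter (IsClosed.union ?_ ?_))
    · exact (isClosed_le (by fun_prop) continuous_const).inter
        (isClosed_le (by fun_prop) continuous_const)
    · exact (isClosed_le continuous_const (by fun_prop)).inter
        ((isClosed_le continuous_const (by fun_prop)).inter
          (isClosed_le continuous_const (by fun_prop)))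
  have hcover : Set.Ioc 1 R ⊆ A₁ ∪ A₂ := by
    intro r hr
    obtain ⟨_, _, _, h⟩ := exists_isRootTriple (r * t) c
    obtain ⟨u, v, w, h, huv, hvw⟩ := h.min_ordered
    have hm := mem_B ⟨hr.1.le, hr.2⟩ h
    rcases le_total ‖u‖ 1 with hu | hu
    · rcases le_total ‖v‖ 1 with hv | hv
      · exact Or.inr ⟨(u, v, w), hm, h, Or.inl ⟨hu, hv⟩⟩
      · exact Or.inl ⟨(u, v, w), hm, h, hu, hv, hv.trans hvw⟩
    · exact Or.inr ⟨(u, v, w), hm, h, Or.inr ⟨hu, hu.trans huv, (hu.trans huv).trans hvw⟩⟩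
  have hdisj : ∀ r ∈ Set.Ioc 1 R, r ∉ A₁ ∩ A₂ := by
    rintro r hr ⟨⟨⟨u, v, w⟩, -, h, hu, hv, hw⟩, ⟨⟨u', v', w'⟩, -, h', h2⟩⟩
    change IsRootTriple (r * t) c u v w at h
    change IsRootTriple (r * t) c u' v' w' at h'
    have hpos : 0 < triangleFn (r * t) := ht.trans_lt (triangleFn_lt_smul ht0 hr.1)
    have hne {y : ℂ} (hy : y ^ 3 - 3 * (r * t) * y + 2 * c = 0) : ‖y‖ ≠ 1 := fun h1 =>
      hpos.not_ge (triangleFn_nonpos (mem_curvedTriangle_of_root hc hy h1))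
    have hu := hu.lt_of_ne (hne h.root)
    have hv := hv.lt_of_ne (hne h.rotate.root).symm
    have hw := hw.lt_of_ne (hne h.rotate.rotate.root).symm
    rcases h2 with ⟨h2, h3⟩ | ⟨h2, h3, h4⟩
    · have h2 : ‖u'‖ ≤ 1 := h2
      have h3 : ‖v'‖ ≤ 1 := h3
      have h2u : u' = u := by
        rcases (h.root_iff u').1 h'.root with e | e | e
        · exact e
        · rw [e] at h2; linarith
        · rw [e] at h2; linarith
      have h3u : v' = u := by
        rcases (h.root_iff v').1 h'.rotate.root with e | e | e
        · exact e
        · rw [e] at h3; linarith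
        · rw [e] at h3; linarith
      have hvw' : v = w' := by
        rcases (h'.root_iff v).1 h.rotate.root with e | e | e
        · rw [e] at hv; linarith
        · rw [e] at hv; linarith
        · exact e
      have hww' : w = w' := by
        rcases (h'.root_iff w).1 h.rotate.rotate.root with e | e | e
        · rw [e] at hw; linarith
        · rw [e] at hw; linarith
        · exact e
      have : u = -(2 * v) := by linear_combination h.1 + hvw' - hww'
      have hn2 := congrArg norm this
      rw [norm_neg, norm_mul, RCLike.norm_ofNat] at hn2
      linarith
    · have h2 : 1 ≤ ‖u'‖ := h2
      have h3 : 1 ≤ ‖v'‖ := h3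
      have h4 : 1 ≤ ‖w'‖ := h4
      rcases (h'.root_iff u).1 h.root with e | e | e <;> rw [e] at hu <;> linarith
  have hRA : R ∈ A₁ := by
    obtain ⟨_, _, _, h⟩ := exists_isRootTriple (R * t) c
    obtain ⟨u, v, w, h, huv, hvw⟩ := h.min_ordered
    exact ⟨(u, v, w), mem_B ⟨hR1.le, le_rfl⟩ h, h, h.of_four_lt hc hRt huv hvw⟩
  have hsub : Set.Ioc 1 R ⊆ A₁ := by
    intro r hr
    rcases hcover hr with h | h
    · exact h
    · obtain ⟨x, hx, hx2⟩ := isPreconnected_closed_iff.1 isPreconnected_Ioc A₁ A₂ hA₁ hA₂ hcover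
        ⟨R, ⟨hR1, le_rfl⟩, hRA⟩ ⟨r, hr, h⟩
      exact absurd hx2 (hdisj x hx)
  have h1 : (1 : ℝ) ∈ A₁ := by
    apply hA₁.closure_subset_iff.2 hsub
    rw [closure_Ioc hR1.ne]
    exact ⟨le_rfl, hR1.le⟩
  obtain ⟨⟨u, v, w⟩, -, h, h2⟩ := h1
  change IsRootTriple ((1 : ℝ) * t) c u v w at h
  rw [Complex.ofReal_one, one_mul] at h
  exact ⟨u, v, w, h, h2⟩

/-- If two roots are on the unit circle and the third one is not inside of it, then `t` is in the
interior of the triangle or one of its vertices. -/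
lemma IsRootTriple.norm_ne {t : ℂ} (ht : t ∈ outerBase) {c : ℝ} {u v w : ℂ}
    (h : IsRootTriple t c u v w) (hu : ‖u‖ = 1) (hw : 1 ≤ ‖w‖) : ‖v‖ ≠ 1 := by
  intro hv
  have hu0 : u ≠ 0 := by rintro rfl; simp at hu
  have hv0 : v ≠ 0 := by rintro rfl; simp at hv
  have cu : starRingEnd ℂ u = u⁻¹ := (Complex.inv_eq_conj hu).symm
  have cv : starRingEnd ℂ v = v⁻¹ := (Complex.inv_eq_conj hv).symm
  have e1 : u * v * (u + v) = 2 * c := by linear_combination u * v * h.1 - h.2.2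
  have e2 := congrArg (starRingEnd ℂ) e1
  simp only [map_mul, map_add, cu, cv, Complex.conj_ofReal, Complex.conj_ofNat] at e2
  have e3 : u + v = 2 * c * (u * v) ^ 2 := by
    field_simp at e2
    linear_combination e2
  have huv : u + v ≠ 0 := by
    intro h0
    have : w = 0 := by linear_combination h.1 - h0
    rw [this, norm_zero] at hw
    linarith
  have e4 : (u * v) ^ 3 = 1 := by
    apply mul_left_cancel₀ huv
    linear_combination (u * v) ^ 2 * e1 - e3
  have et : t = (4 * c ^ 2 - 1) / 3 * (u * v) := by
    have : 3 * t = (u + v) ^ 2 - u * v := by linear_combination h.2.1 - (u + v) * h.1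
    rw [e3] at this
    linear_combination this / 3 + 4 / 3 * c ^ 2 * (u * v) * e4
  have hc : 1 ≤ 4 * c ^ 2 := by
    have : ‖w‖ = 2 * |c| := by
      have hn := congrArg norm h.2.2
      simpa [hu, hv] using hn
    rw [this] at hw
    nlinarith [sq_abs c, abs_nonneg c]
  have h3 : t ^ 3 = (((4 * c ^ 2 - 1) / 3) ^ 3 : ℝ) := by
    rw [et, mul_pow, e4]; push_cast; ring
  have hf : 0 ≤ triangleFn t := ht.1
  rw [triangleFn_of_pow_eq (by linarith) h3] at hf
  have hc2 : c ^ 2 ≤ 1 := by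
    have hn := congrArg norm e1
    rw [norm_mul, norm_mul, hu, hv] at hn
    have := norm_add_le u v
    simp only [norm_mul, Complex.norm_real, Real.norm_eq_abs, RCLike.norm_ofNat] at hn
    rw [hu, hv] at this
    have : |c| ≤ 1 := by linarith
    nlinarith [sq_abs c, abs_nonneg c]
  rcases (show (4 * c ^ 2 - 1) / 3 ≤ 1 by linarith).eq_or_lt with h5 | h5
  · exact ht.2 (by rw [h3, h5]; simp)
  · have : ((4 * c ^ 2 - 1) / 3 - 1) ^ 3 * (3 * ((4 * c ^ 2 - 1) / 3) + 1) < 0 :=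
      mul_neg_of_neg_of_pos (Odd.pow_neg (by decide) (by linarith)) (by nlinarith)
    linarith

/-- The root `u` in the closed unit disc is separated from the other two roots, which do not lie in
the open disc. -/
structure IsInnerTriple (t : ℂ) (c : ℝ) (u v w : ℂ) : Prop where
  triple : IsRootTriple t c u v w
  inner : ‖u‖ ≤ 1
  outer : 1 ≤ ‖v‖
  outer' : 1 ≤ ‖w‖
  lt : ‖u‖ < ‖v‖
  lt' : ‖u‖ < ‖w‖

lemma IsRootTriple.isInnerTriple {t : ℂ} (ht : t ∈ outerBase) {c : ℝ} {u v w : ℂ}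
    (h : IsRootTriple t c u v w) (h1 : ‖u‖ ≤ 1) (h2 : 1 ≤ ‖v‖) (h3 : 1 ≤ ‖w‖) :
    IsInnerTriple t c u v w := by
  refine ⟨h, h1, h2, h3, (h1.trans h2).lt_of_ne fun e => ?_, (h1.trans h3).lt_of_ne fun e => ?_⟩
  · exact h.norm_ne ht (by linarith) h3 (by linarith)
  · exact h.swap.norm_ne ht (by linarith) h2 (by linarith)

lemma IsInnerTriple.unique {t : ℂ} {c : ℝ} {u v w u' v' w' : ℂ} (h : IsInnerTriple t c u v w)
    (h' : IsInnerTriple t c u' v' w') : u' = u := by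
  rcases (h.triple.root_iff u').1 h'.triple.root with e | e | e
  · exact e
  all_goals
    have h1 := h.outer
    have h2 := h.outer'
    rcases (h'.triple.root_iff u).1 h.triple.root with e' | e' | e'
    · exact e'.symm
    · have := h.lt; have := h.lt'; have := h'.lt; have := h'.lt'
      rw [e] at *; rw [e'] at *; linarith [h'.inner]
    · have := h.lt; have := h.lt'; have := h'.lt; have := h'.lt'
      rw [e] at *; rw [e'] at *; linarith [h'.inner]

lemma exists_isInnerTriple {t : ℂ} (ht : t ∈ outerBase) {c : ℝ} (hc : |c| ≤ 1) :
    ∃ u v w, IsInnerTriple t c u v w := by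
  obtain ⟨u, v, w, h, h1, h2, h3⟩ := exists_isRootTriple_norm ht.1 hc
  exact ⟨u, v, w, h.isInnerTriple ht h1 h2 h3⟩

open Classical in
/-- The root of smallest absolute value of `y³ - 3ty + 2c`, for `t ∈ outerBase` and `|c| ≤ 1`; it
lies in the closed unit disc. The value is zero when there is no such root. -/
def innerRoot (t : ℂ) (c : ℝ) : ℂ :=
  if h : ∃ u v w, IsInnerTriple t c u v w then h.choose else 0

lemma IsInnerTriple.innerRoot_eq {t : ℂ} {c : ℝ} {u v w : ℂ} (h : IsInnerTriple t c u v w) :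
    innerRoot t c = u := by
  have h' : ∃ u v w, IsInnerTriple t c u v w := ⟨u, v, w, h⟩
  rw [innerRoot, dif_pos h']
  obtain ⟨v', w', h2⟩ := h'.choose_spec
  exact h.unique h2

lemma innerRoot_spec {t : ℂ} (ht : t ∈ outerBase) {c : ℝ} (hc : |c| ≤ 1) :
    ∃ v w, IsInnerTriple t c (innerRoot t c) v w := by
  obtain ⟨u, v, w, h⟩ := exists_isInnerTriple ht hc
  exact ⟨v, w, h.innerRoot_eq ▸ h⟩

lemma innerRoot_neg {t : ℂ} (ht : t ∈ outerBase) {c : ℝ} (hc : |c| ≤ 1) :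
    innerRoot t (-c) = -innerRoot t c := by
  obtain ⟨v, w, h⟩ := innerRoot_spec ht hc
  have : IsInnerTriple t (-c) (-innerRoot t c) (-v) (-w) := by
    refine ⟨⟨by linear_combination -h.triple.1, by linear_combination h.triple.2.1, ?_⟩,
      ?_, ?_, ?_, ?_, ?_⟩
    · push_cast; linear_combination -h.triple.2.2
    all_goals simp only [norm_neg]
    exacts [h.inner, h.outer, h.outer', h.lt, h.lt']
  exact this.innerRoot_eq

lemma innerRoot_conj {t : ℂ} (ht : t ∈ outerBase) {c : ℝ} (hc : |c| ≤ 1) :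
    innerRoot (starRingEnd ℂ t) c = starRingEnd ℂ (innerRoot t c) := by
  obtain ⟨v, w, h⟩ := innerRoot_spec ht hc
  have : IsInnerTriple (starRingEnd ℂ t) c (starRingEnd ℂ (innerRoot t c)) (starRingEnd ℂ v)
      (starRingEnd ℂ w) := by
    refine ⟨⟨?_, ?_, ?_⟩, ?_, ?_, ?_, ?_, ?_⟩
    · simpa using congrArg (starRingEnd ℂ) h.triple.1
    · simpa [Complex.conj_ofNat] using congrArg (starRingEnd ℂ) h.triple.2.1
    · simpa [Complex.conj_ofNat] using congrArg (starRingEnd ℂ) h.triple.2.2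
    all_goals simp only [RCLike.norm_conj]
    exacts [h.inner, h.outer, h.outer', h.lt, h.lt']
  exact this.innerRoot_eq

lemma continuous_innerRoot {Y : Type} [TopologicalSpace Y] {T : Y → ℂ} {c : Y → ℝ} {M : ℝ}
    (hT : Continuous T) (hc : Continuous c) (hTo : ∀ y, T y ∈ outerBase) (hc1 : ∀ y, |c y| ≤ 1)
    (hM : ∀ y, ‖T y‖ ≤ M) : Continuous fun y => innerRoot (T y) (c y) := by
  let B := Metric.closedBall (0 : ℂ) (3 * M + 3)
  have hB : IsCompact (B ×ˢ B) := (isCompact_closedBall _ _).prod (isCompact_closedBall _ _)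
  let r : Set ((Y × ℂ) × ℂ × ℂ) := {q | IsRootTriple (T q.1.1) (c q.1.1) q.1.2 q.2.1 q.2.2} ∩
    ({q | ‖q.1.2‖ ≤ 1} ∩ ({q | 1 ≤ ‖q.2.1‖} ∩ {q | 1 ≤ ‖q.2.2‖}))
  have hr : IsClosed r := by
    refine IsClosed.inter ?_ ?_
    · refine (isClosed_eq (by fun_prop) continuous_const).inter
        ((isClosed_eq (by fun_prop) (by fun_prop)).inter
          (isClosed_eq (by fun_prop) (by fun_prop)))
    · exact (isClosed_le (by fun_prop) continuous_const).inter
        ((isClosed_le continuous_const (by fun_prop)).inter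
          (isClosed_le continuous_const (by fun_prop)))
  refine continuous_of_unique (isCompact_closedBall (0 : ℂ) 1)
    (isClosed_setOf_exists hB hr) (fun y => ?_) ?_
  · obtain ⟨v, w, h⟩ := innerRoot_spec (hTo y) (hc1 y)
    refine ⟨mem_closedBall_zero_iff.2 h.inner, (v, w), Set.mk_mem_prod ?_ ?_, h.1, h.2, h.3, h.4⟩
    · exact mem_closedBall_zero_iff.2 ((h.triple.rotate.norm_le (hc1 y)).trans (by linarith [hM y]))
    · exact mem_closedBall_zero_iff.2
        ((h.triple.rotate.rotate.norm_le (hc1 y)).trans (by linarith [hM y]))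
  · rintro y z - ⟨⟨v, w⟩, -, h, h1, h2, h3⟩
    exact (IsRootTriple.isInnerTriple (hTo y) h h1 h2 h3).innerRoot_eq.symm

/-! ### The cycle of Deninger -/

lemma pathClass_arc_self {X : Type} [TopologicalSpace X] (g : C(ℝ, X)) (a : ℝ) :
    pathClass (arc g a a) = 0 :=
  add_eq_left.1 (pathClass_arc_add g a a a)

lemma continuousAt_cpow_ofReal {a : ℝ} (ha : 0 < a) {z : ℂ} (hz : z ∈ Complex.slitPlane ∨ z = 0) :
    ContinuousAt (fun z : ℂ => z ^ (a : ℂ)) z := by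
  rcases hz with hz | rfl
  · exact continuousAt_id.cpow continuousAt_const hz
  · have := Complex.continuousAt_cpow_zero_of_re_pos (z := (a : ℂ)) (by simpa using ha)
    exact this.comp (f := fun z : ℂ => (z, (a : ℂ))) (by fun_prop)

/-- The principal square root. -/
def csqrt (z : ℂ) : ℂ := z ^ ((2⁻¹ : ℝ) : ℂ)

lemma csqrt_sq (z : ℂ) : csqrt z ^ 2 = z := by
  rw [csqrt]; push_cast; exact Complex.cpow_ofNat_inv_pow z 2

lemma continuous_csqrt {Y : Type} [TopologicalSpace Y] {f : Y → ℂ} (hf : Continuous f)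
    (h : ∀ y, f y ∈ Complex.slitPlane ∨ f y = 0) : Continuous fun y => csqrt (f y) :=
  continuous_iff_continuousAt.2 fun y =>
    (continuousAt_cpow_ofReal (by norm_num) (h y)).comp (f := f) hf.continuousAt

lemma csqrt_conj {z : ℂ} (hz : z ∈ Complex.slitPlane) :
    csqrt (starRingEnd ℂ z) = starRingEnd ℂ (csqrt z) := by
  rw [csqrt, Complex.conj_cpow _ _ (Complex.slitPlane_arg_ne_pi hz), Complex.conj_ofReal, csqrt]

/-- One of the two roots of `y³ - 3ty + 2c` outside of the unit circle; it depends on the choice of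
a square root `s` of `12t`. -/
def outerRoot (t s : ℂ) (c : ℝ) : ℂ :=
  (-innerRoot t c + s * csqrt (1 - innerRoot t c ^ 2 / (4 * t))) / 2

lemma one_sub_mem_slitPlane {t : ℂ} (ht : t ∈ outerBase) {c : ℝ} (hc : |c| ≤ 1) :
    1 - innerRoot t c ^ 2 / (4 * t) ∈ Complex.slitPlane := by
  obtain ⟨v, w, h⟩ := innerRoot_spec ht hc
  have h3 := third_le_norm ht.1
  have hn : ‖innerRoot t c ^ 2 / (4 * t)‖ < 1 := by
    rw [norm_div, norm_pow, norm_mul, RCLike.norm_ofNat, div_lt_one (by linarith)]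
    nlinarith [h.inner, norm_nonneg (innerRoot t c)]
  left
  have := (Complex.re_le_norm _).trans_lt hn
  simpa using this

lemma outerRoot_neg {t s : ℂ} (ht : t ∈ outerBase) {c : ℝ} (hc : |c| ≤ 1) :
    outerRoot t s (-c) = (innerRoot t c + s * csqrt (1 - innerRoot t c ^ 2 / (4 * t))) / 2 := by
  rw [outerRoot, innerRoot_neg ht hc, neg_neg, neg_sq]

lemma outerRoot_spec {t s : ℂ} (ht : t ∈ outerBase) (hs : s ^ 2 = 12 * t) {c : ℝ} (hc : |c| ≤ 1) :
    IsInnerTriple t c (innerRoot t c) (outerRoot t s c) (-outerRoot t s (-c)) := by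
  obtain ⟨v, w, h⟩ := innerRoot_spec ht hc
  have ht0 := ne_zero_of_mem_outerBase ht
  have e1 : innerRoot t c + outerRoot t s c + -outerRoot t s (-c) = 0 := by
    rw [outerRoot_neg ht hc, outerRoot]; ring
  have e2 : outerRoot t s c * -outerRoot t s (-c) = innerRoot t c ^ 2 - 3 * t := by
    have hq := csqrt_sq (1 - innerRoot t c ^ 2 / (4 * t))
    have h12 : s ^ 2 * (1 - innerRoot t c ^ 2 / (4 * t)) = 12 * t - 3 * innerRoot t c ^ 2 := by
      rw [hs]; field_simp; ring
    rw [outerRoot_neg ht hc, outerRoot]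
    linear_combination -s ^ 2 / 4 * hq - h12 / 4
  have h1 := h.triple.1
  have h2 := h.triple.2.1
  have hvw : v * w = innerRoot t c ^ 2 - 3 * t := by
    linear_combination h2 - innerRoot t c * h1
  have key : (outerRoot t s c - v) * (outerRoot t s c - w) = 0 := by
    linear_combination outerRoot t s c * e1 - outerRoot t s c * h1 - e2 + hvw
  rcases mul_eq_zero.1 key with k | k
  · have hv : outerRoot t s c = v := sub_eq_zero.1 k
    have hw : -outerRoot t s (-c) = w := by linear_combination e1 - h1 - hv
    rw [hv, hw]
    exact h
  · have hv : outerRoot t s c = w := sub_eq_zero.1 k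
    have hw : -outerRoot t s (-c) = v := by linear_combination e1 - h1 - hv
    rw [hv, hw]
    exact ⟨h.triple.swap, h.inner, h.outer', h.outer, h.lt', h.lt⟩

/-- The two outer roots are different: a double root `v` satisfies `v² = t` and the third root is
`-2v`, which is too large for the inner root. -/
lemma outerRoot_ne {t s : ℂ} (ht : t ∈ outerBase) (hs : s ^ 2 = 12 * t) {c : ℝ} (hc : |c| ≤ 1) :
    outerRoot t s c ≠ -outerRoot t s (-c) := by
  intro h
  have hI := outerRoot_spec ht hs hc
  have h1 := hI.triple.1
  have h2 := hI.triple.2.1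
  rw [← h] at h1 h2
  have h4 : 4 * t = innerRoot t c ^ 2 := by
    linear_combination 4 / 3 * h2 - (outerRoot t s c * 2 / 3 + innerRoot t c) * h1
  have hn := congrArg norm h4
  rw [norm_mul, norm_pow, RCLike.norm_ofNat] at hn
  have := third_le_norm ht.1
  nlinarith [hI.inner, norm_nonneg (innerRoot t c)]

lemma continuous_outerRoot {Y : Type} [TopologicalSpace Y] {T S : Y → ℂ} {c : Y → ℝ} {M : ℝ}
    (hT : Continuous T) (hS : Continuous S) (hc : Continuous c) (hTo : ∀ y, T y ∈ outerBase)
    (hc1 : ∀ y, |c y| ≤ 1) (hM : ∀ y, ‖T y‖ ≤ M) :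
    Continuous fun y => outerRoot (T y) (S y) (c y) := by
  have h1 := continuous_innerRoot hT hc hTo hc1 hM
  have h0 (y : Y) : 4 * T y ≠ 0 := mul_ne_zero (by norm_num) (ne_zero_of_mem_outerBase (hTo y))
  have h2 : Continuous fun y => csqrt (1 - innerRoot (T y) (c y) ^ 2 / (4 * T y)) :=
    continuous_csqrt (continuous_const.sub ((h1.pow 2).div₀ (by fun_prop) h0))
      fun y => Or.inl (one_sub_mem_slitPlane (hTo y) (hc1 y))
  unfold outerRoot
  exact ((h1.neg).add (hS.mul h2)).div_const 2

lemma two_cos_three_mul (η : ℝ) : 2 * ((Real.cos (3 * η) : ℝ) : ℂ) =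
    Complex.exp (η * Complex.I) ^ 3 + (Complex.exp (η * Complex.I) ^ 3)⁻¹ := by
  rw [← Complex.exp_nat_mul, ← Complex.exp_neg, Complex.ofReal_cos, Complex.two_cos]
  congr 2 <;> push_cast <;> ring

/-- The point `[e^{iη} : y : e^{-iη}]`. -/
def torusPt (η : ℝ) (y : ℂ) : P2 :=
  affine (Complex.exp (η * Complex.I) ^ 2) (y * Complex.exp (η * Complex.I))

lemma affine_mem_hesse (t x y : ℂ) : affine x y ∈ hesse t ↔ x ^ 3 + y ^ 3 + 1 = 3 * t * x * y := by
  rw [affine, mk_mem_hesse]; simp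

lemma torusPt_mem_hesse {t : ℂ} {η : ℝ} {y : ℂ} :
    torusPt η y ∈ hesse t ↔ y ^ 3 - 3 * t * y + 2 * (Real.cos (3 * η) : ℝ) = 0 := by
  rw [torusPt, affine_mem_hesse, two_cos_three_mul]
  have e0 := Complex.exp_ne_zero (η * Complex.I)
  set e := Complex.exp (η * Complex.I)
  constructor
  · intro h
    field_simp
    linear_combination h
  · intro h
    field_simp at h
    linear_combination h

lemma exp_add_pi (η : ℝ) :
    Complex.exp ((η + Real.pi : ℝ) * Complex.I) = -Complex.exp (η * Complex.I) := by
  rw [Complex.ofReal_add, add_mul, Complex.exp_add, Complex.exp_pi_mul_I, mul_neg_one]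

lemma torusPt_add_pi (η : ℝ) (y : ℂ) : torusPt (η + Real.pi) y = torusPt η (-y) := by
  rw [torusPt, torusPt, exp_add_pi, neg_sq, mul_neg, neg_mul]

lemma cos_three_mul_add_pi (η : ℝ) : Real.cos (3 * (η + Real.pi)) = -Real.cos (3 * η) := by
  rw [show 3 * (η + Real.pi) = 3 * η + Real.pi + 2 * Real.pi by ring, Real.cos_add_two_pi,
    Real.cos_add_pi]

lemma continuous_torusPt {Y : Type} [TopologicalSpace Y] {η : Y → ℝ} {y : Y → ℂ}
    (hη : Continuous η) (hy : Continuous y) : Continuous fun s => torusPt (η s) (y s) := by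
  have h : Continuous fun s => ((Complex.exp (η s * Complex.I) ^ 2,
    y s * Complex.exp (η s * Complex.I)) : ℂ × ℂ) := by fun_prop
  exact continuous_affine.comp h

section Deninger

variable {t s : ℂ} (ht : t ∈ outerBase) (hs : s ^ 2 = 12 * t)

/-- The cycle of Deninger, parametrized by `ℝ` with period `2π`. -/
def deninger : C(ℝ, hesse t) where
  toFun η := ⟨torusPt η (outerRoot t s (Real.cos (3 * η))), torusPt_mem_hesse.2
    (outerRoot_spec ht hs (Real.abs_cos_le_one _)).triple.rotate.root⟩
  continuous_toFun := (continuous_torusPt continuous_id (continuous_outerRoot (M := ‖t‖)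
    continuous_const continuous_const (by fun_prop) (fun _ => ht)
    (fun _ => Real.abs_cos_le_one _) fun _ => le_rfl)).subtype_mk _

lemma deninger_coe (η : ℝ) :
    (deninger ht hs η : P2) = torusPt η (outerRoot t s (Real.cos (3 * η))) := rfl

lemma deninger_add_pi_coe (η : ℝ) : (deninger ht hs (η + Real.pi) : P2) =
    torusPt η (-outerRoot t s (-Real.cos (3 * η))) := by
  rw [deninger_coe, torusPt_add_pi, cos_three_mul_add_pi]

lemma deninger_periodic : Function.Periodic (deninger ht hs) (2 * Real.pi) := by
  intro η
  apply Subtype.ext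
  rw [two_mul, ← add_assoc, deninger_add_pi_coe, cos_three_mul_add_pi, neg_neg, torusPt_add_pi,
    neg_neg, deninger_coe]

lemma deninger_add_int_mul (η : ℝ) (k : ℤ) :
    deninger ht hs (η + k * (2 * Real.pi)) = deninger ht hs η :=
  (deninger_periodic ht hs).int_mul k η

lemma exists_int_of_exp_sq_eq {η η' : ℝ}
    (h : Complex.exp (η' * Complex.I) ^ 2 = Complex.exp (η * Complex.I) ^ 2) :
    ∃ k : ℤ, η' = η + k * (2 * Real.pi) ∨ η' = η + Real.pi + k * (2 * Real.pi) := by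
  rw [← Complex.exp_nat_mul, ← Complex.exp_nat_mul, Complex.exp_eq_exp_iff_exists_int] at h
  obtain ⟨n, hn⟩ := h
  have hn' : (η' : ℂ) = η + n * Real.pi := by
    apply mul_left_cancel₀ Complex.I_ne_zero
    push_cast at hn
    linear_combination hn / 2
  have hn'' : η' = η + n * Real.pi := by exact_mod_cast hn'
  obtain ⟨k, hk⟩ := Int.even_or_odd' n
  rcases hk with rfl | rfl
  · exact ⟨k, Or.inl (by rw [hn'']; push_cast; ring)⟩
  · exact ⟨k, Or.inr (by rw [hn'']; push_cast; ring)⟩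

lemma deninger_inj {η η' : ℝ} (h : deninger ht hs η' = deninger ht hs η) :
    ∃ k : ℤ, η' = η + k * (2 * Real.pi) := by
  obtain ⟨k, hk | hk⟩ := exists_int_of_exp_sq_eq (affine_inj (congrArg Subtype.val h)).1
  · exact ⟨k, hk⟩
  · rw [hk, deninger_add_int_mul] at h
    have h2 := congrArg Subtype.val h
    rw [deninger_add_pi_coe, deninger_coe] at h2
    have h3 := mul_right_cancel₀ (Complex.exp_ne_zero _) (affine_inj h2).2
    exact absurd h3.symm (outerRoot_ne ht hs (Real.abs_cos_le_one _))

lemma deninger_eq_or {η η' : ℝ}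
    (h : Complex.exp (η' * Complex.I) ^ 2 = Complex.exp (η * Complex.I) ^ 2) :
    deninger ht hs η' = deninger ht hs η ∨
      deninger ht hs η' = deninger ht hs (η + Real.pi) := by
  obtain ⟨k, rfl | rfl⟩ := exists_int_of_exp_sq_eq h
  · exact Or.inl (deninger_add_int_mul ht hs _ k)
  · exact Or.inr (deninger_add_int_mul ht hs _ k)

lemma exp_half_sq (θ : ℝ) :
    Complex.exp ((θ / 2 : ℝ) * Complex.I) ^ 2 = Complex.exp (θ * Complex.I) := by
  rw [← Complex.exp_nat_mul]; congr 1; push_cast; ring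

lemma deningerSet_subset : deningerSet t ⊆ Set.range (deninger ht hs) := by
  rintro p ⟨x, y, hp, hx, hy⟩
  set η : ℝ := x.arg / 2 with hη
  set e := Complex.exp (η * Complex.I) with he
  have hxe : x = e ^ 2 := by
    rw [he, hη, exp_half_sq]
    simpa [hx] using (Complex.norm_mul_exp_arg_mul_I x).symm
  have e0 : e ≠ 0 := Complex.exp_ne_zero _
  have hn : ‖e‖ = 1 := Complex.norm_exp_ofReal_mul_I η
  have hp' : (p : P2) = torusPt η (y / e) := by
    rw [hp, torusPt, ← he, ← hxe, div_mul_cancel₀ _ e0]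
  have hroot := torusPt_mem_hesse.1 (hp' ▸ p.2)
  have hI := outerRoot_spec ht hs (Real.abs_cos_le_one (3 * η))
  rcases (hI.triple.root_iff _).1 hroot with h | h | h
  · have := hI.inner
    rw [← h, norm_div, hn, div_one] at this
    linarith
  · exact ⟨η, Subtype.ext (by rw [hp', deninger_coe, h])⟩
  · exact ⟨η + Real.pi, Subtype.ext (by rw [hp', deninger_add_pi_coe, h])⟩

lemma isClosed_range_deninger : IsClosed (Set.range (deninger ht hs)) := by
  have h : deninger ht hs '' Set.Icc 0 (0 + 2 * Real.pi) = Set.range (deninger ht hs) :=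
    (deninger_periodic ht hs).image_Icc Real.two_pi_pos 0
  rw [← h]
  exact (isCompact_Icc.image (deninger ht hs).continuous).isClosed

include ht hs in
/-- The outer roots lie on the unit circle for finitely many `c` only: if `|y| = 1`, the real number
`c` can be eliminated from the equation of `y` and its conjugate, and `y` is a root of a nonzero
polynomial. -/
lemma finite_norm_outerRoot_eq_one :
    {c : ℝ | |c| ≤ 1 ∧ ‖outerRoot t s c‖ = 1}.Finite := by
  let p : Polynomial ℂ := Polynomial.X ^ 6 - Polynomial.C (3 * t) * Polynomial.X ^ 4 +
    Polynomial.C (3 * starRingEnd ℂ t) * Polynomial.X ^ 2 - 1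
  have hp : p ≠ 0 := by
    simp only [p]
    generalize 3 * t = a, 3 * starRingEnd ℂ t = b
    intro h
    have := congrArg (fun q : Polynomial ℂ => q.coeff 6) h
    simp [Polynomial.coeff_X_pow, Polynomial.coeff_one] at this
  have hfin : {y | p.IsRoot y}.Finite := Polynomial.finite_setOfPred_isRoot hp
  refine (hfin.image fun y => ((3 * t * y - y ^ 3) / 2).re).subset ?_
  rintro c ⟨hc, hn⟩
  set y := outerRoot t s c with hy
  have h1 : y ^ 3 - 3 * t * y + 2 * c = 0 := (outerRoot_spec ht hs hc).triple.rotate.root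
  have h2 := congrArg (starRingEnd ℂ) h1
  have hy0 : y ≠ 0 := by rintro h; simp [h] at hn
  simp only [map_add, map_sub, map_mul, map_pow, ← Complex.inv_eq_conj hn, Complex.conj_ofReal,
    Complex.conj_ofNat, map_zero] at h2
  refine ⟨y, ?_, ?_⟩
  · show Polynomial.IsRoot p y
    simp only [p, Polynomial.IsRoot, Polynomial.eval_sub, Polynomial.eval_add, Polynomial.eval_mul,
      Polynomial.eval_pow, Polynomial.eval_X, Polynomial.eval_C, Polynomial.eval_one]
    field_simp at h2
    linear_combination y ^ 3 * h1 - h2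
  · show ((3 * t * y - y ^ 3) / 2).re = c
    rw [show (3 * t * y - y ^ 3) / 2 = (c : ℂ) by linear_combination -h1 / 2, Complex.ofReal_re]

lemma countable_cos_three_mul_eq (a : ℝ) : {η : ℝ | Real.cos (3 * η) = a}.Countable := by
  rcases Set.eq_empty_or_nonempty {η : ℝ | Real.cos (3 * η) = a} with h | ⟨η₀, h₀⟩
  · rw [h]; exact Set.countable_empty
  · refine ((Set.countable_range fun k : ℤ => (2 * k * Real.pi + 3 * η₀) / 3).union
      (Set.countable_range fun k : ℤ => (2 * k * Real.pi - 3 * η₀) / 3)).mono fun η hη => ?_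
    have h : Real.cos (3 * η₀) = Real.cos (3 * η) := by
      rw [show Real.cos (3 * η₀) = a from h₀, show Real.cos (3 * η) = a from hη]
    obtain ⟨k, hk | hk⟩ := Real.cos_eq_cos_iff.1 h
    · exact Or.inl ⟨k, by simp only; linarith⟩
    · exact Or.inr ⟨k, by simp only; linarith⟩

/-- The standard parametrization runs through the closure of the set `|x| = 1`, `|y| > 1`, since it
meets the circle `|y| = 1` at countably many parameters only. -/
lemma range_deninger : Set.range (deninger ht hs) = closure (deningerSet t) := by
  apply Set.Subset.antisymm
  · have hc : {η : ℝ | ‖outerRoot t s (Real.cos (3 * η))‖ = 1}.Countable := by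
      refine ((finite_norm_outerRoot_eq_one ht hs).countable.biUnion
        fun a _ => countable_cos_three_mul_eq a).mono fun η hη => ?_
      exact Set.mem_biUnion (x := Real.cos (3 * η)) ⟨Real.abs_cos_le_one _, hη⟩ rfl
    have hd := hc.dense_compl ℝ
    rw [← Set.image_univ, ← hd.closure_eq]
    refine (image_closure_subset_closure_image (deninger ht hs).continuous).trans
      (closure_mono ?_)
    rintro _ ⟨η, hη, rfl⟩
    refine ⟨_, _, deninger_coe ht hs η, ?_, ?_⟩
    · rw [norm_pow, Complex.norm_exp_ofReal_mul_I, one_pow]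
    · rw [norm_mul, Complex.norm_exp_ofReal_mul_I, mul_one]
      exact lt_of_le_of_ne (outerRoot_spec ht hs (Real.abs_cos_le_one _)).outer fun h => hη h.symm
  · exact closure_minimal (deningerSet_subset ht hs) (isClosed_range_deninger ht hs)

lemma closed_arc_deninger :
    arc (deninger ht hs) 0 (2 * Real.pi) 0 = arc (deninger ht hs) 0 (2 * Real.pi) 1 := by
  rw [arc_zero, arc_one]
  exact (deninger_periodic ht hs).eq.symm

lemma arc_apply {X : Type} [TopologicalSpace X] (g : C(ℝ, X)) (a b : ℝ) (r : I) :
    arc g a b r = g ((1 - (r : ℝ)) * a + r * b) := rfl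

lemma isDeningerLoop_arc : IsDeningerLoop (arc (deninger ht hs) 0 (2 * Real.pi)) where
  closed := closed_arc_deninger ht hs
  simple := by
    intro r hr r' hr' h
    rw [arc_apply, arc_apply, mul_zero, zero_add, mul_zero, zero_add] at h
    obtain ⟨k, hk⟩ := deninger_inj ht hs h
    have hk' : (r : ℝ) = r' + k := by
      apply mul_right_cancel₀ Real.two_pi_pos.ne'
      linarith
    have h1 : (r : ℝ) < 1 := hr.2
    have h2 : (r' : ℝ) < 1 := hr'.2
    have h3 : -1 < (k : ℝ) := by linarith [r.2.1]
    have h4 : (k : ℝ) < 1 := by linarith [r'.2.1]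
    have : k = 0 := by
      have : -1 < k := by exact_mod_cast h3
      have : k < 1 := by exact_mod_cast h4
      omega
    apply Subtype.ext
    rw [hk', this]
    simp
  range_eq := by
    rw [← range_deninger ht hs]
    have h : deninger ht hs '' Set.Icc 0 (0 + 2 * Real.pi) = Set.range (deninger ht hs) :=
      (deninger_periodic ht hs).image_Icc Real.two_pi_pos 0
    rw [← h]
    ext p
    constructor
    · rintro ⟨r, rfl⟩
      refine ⟨_, ⟨?_, ?_⟩, rfl⟩ <;>
        simp only [ContinuousMap.coe_mk] <;> nlinarith [r.2.1, r.2.2, Real.two_pi_pos]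
    · rintro ⟨η, hη, rfl⟩
      refine ⟨⟨η / (2 * Real.pi), div_nonneg hη.1 Real.two_pi_pos.le,
        (div_le_one Real.two_pi_pos).2 (by linarith [hη.2])⟩, ?_⟩
      rw [arc_apply]
      congr 1
      have := Real.pi_ne_zero
      field_simp
      ring
  counterclockwise := by
    refine ⟨fun r => (r : ℝ) * (4 * Real.pi), by fun_prop, fun r r' h => ?_, fun r => ?_⟩
    · have h : (r : ℝ) < r' := h
      simp only
      nlinarith [Real.pi_pos]
    · refine ⟨outerRoot t s (Real.cos (3 * ((1 - (r : ℝ)) * 0 + r * (2 * Real.pi)))) *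
        Complex.exp (((1 - (r : ℝ)) * 0 + r * (2 * Real.pi) : ℝ) * Complex.I), ?_⟩
      rw [arc_apply, deninger_coe, torusPt, ← Complex.exp_nat_mul]
      congr 2
      push_cast
      ring

/-- Every parametrization of the cycle of Deninger is a reparametrization of the standard one. -/
lemma IsDeningerLoop.pathClass_eq {g : C(I, hesse t)} (hg : IsDeningerLoop g) :
    pathClass g = pathClass (arc (deninger ht hs) 0 (2 * Real.pi)) := by
  obtain ⟨θ, hθ, hmono, hx⟩ := hg.counterclockwise
  have hor (r : I) : g r = deninger ht hs (θ r / 2) ∨ g r = deninger ht hs (θ r / 2 + Real.pi) := by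
    have hr : g r ∈ Set.range (deninger ht hs) := by
      rw [range_deninger, ← hg.range_eq]; exact ⟨r, rfl⟩
    obtain ⟨η, hη⟩ := hr
    obtain ⟨y, hy⟩ := hx r
    rw [← hη]
    apply deninger_eq_or
    rw [← hη, deninger_coe, torusPt] at hy
    rw [exp_half_sq]
    exact (affine_inj hy).1
  have hclosed (a : ℝ) : IsClosed {r | g r = deninger ht hs (θ r / 2 + a)} :=
    isClosed_eq g.continuous ((deninger ht hs).continuous.comp
      ((hθ.div_const 2).add continuous_const))
  obtain ⟨a, ha⟩ : ∃ a : ℝ, ∀ r, g r = deninger ht hs (θ r / 2 + a) := by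
    by_contra hcon
    push Not at hcon
    obtain ⟨r₀, h₀⟩ := hcon 0
    obtain ⟨r₁, h₁⟩ := hcon Real.pi
    have h₀' := (hor r₀).resolve_left (by simpa using h₀)
    have h₁' := (hor r₁).resolve_right h₁
    obtain ⟨r, -, hr, hr'⟩ := isPreconnected_closed_iff.1 isPreconnected_univ _ _ (hclosed 0)
      (hclosed Real.pi) (fun r _ => by simpa using hor r) ⟨r₁, trivial, by simpa using h₁'⟩
      ⟨r₀, trivial, h₀'⟩
    obtain ⟨k, hk⟩ := deninger_inj ht hs ((hr'.symm.trans hr :))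
    have : (1 : ℝ) = k * 2 := by
      apply mul_right_cancel₀ Real.pi_ne_zero
      linarith
    have : (1 : ℤ) = k * 2 := by exact_mod_cast this
    omega
  let φ : C(I, ℝ) := ⟨fun r => θ r / 2 + a, (hθ.div_const 2).add continuous_const⟩
  have hφ : g = (deninger ht hs).comp φ := ContinuousMap.ext ha
  obtain ⟨k, hk⟩ : ∃ k : ℤ, φ 1 = φ 0 + k * (2 * Real.pi) :=
    deninger_inj ht hs (by
      have := hg.closed
      rw [hφ] at this
      exact this.symm)
  have hmonoφ : StrictMono φ := fun r r' h => by
    have := hmono h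
    show θ r / 2 + a < θ r' / 2 + a
    linarith
  have hkpos : 0 < (k : ℝ) := by
    have := hmonoφ (show (0 : I) < 1 from zero_lt_one)
    rw [hk] at this
    by_contra h
    nlinarith [Real.two_pi_pos]
  -- if the path ran around more than once, it would pass its starting point before time `1`
  have hk1 : k = 1 := by
    by_contra hne
    have hk2 : (2 : ℝ) ≤ k := by
      have h1 : 0 < k := by exact_mod_cast hkpos
      have : 2 ≤ k := by omega
      exact_mod_cast this
    have hiv : φ 0 + 2 * Real.pi ∈ φ '' Set.Icc 0 1 := by
      refine intermediate_value_Icc (zero_le_one) φ.continuous.continuousOn ⟨?_, ?_⟩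
      · linarith [Real.two_pi_pos]
      · rw [hk]; nlinarith [Real.two_pi_pos]
    obtain ⟨r, -, hr⟩ := hiv
    have h1 : g r = g 0 := by
      rw [hφ, ContinuousMap.comp_apply, hr, ContinuousMap.comp_apply]
      exact deninger_periodic ht hs (φ 0)
    have hr1 : r < 1 := hmonoφ.lt_iff_lt.1 (by rw [hr, hk]; nlinarith [Real.two_pi_pos])
    have := hg.simple ⟨r.2.1, hr1⟩ ⟨le_rfl, zero_lt_one⟩ h1
    rw [this] at hr
    linarith [Real.two_pi_pos]
  rw [hφ, pathClass_comp_eq_arc, hk, hk1, Int.cast_one, one_mul,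
    ← pathClass_arc_add (deninger ht hs) (φ 0) 0, ← pathClass_arc_add (deninger ht hs) 0
    (2 * Real.pi) (φ 0 + 2 * Real.pi)]
  have e : arc (deninger ht hs) (2 * Real.pi) (φ 0 + 2 * Real.pi) =
      arc (deninger ht hs) 0 (φ 0) := by
    refine ContinuousMap.ext fun r => ?_
    rw [arc_apply, arc_apply, ← deninger_periodic ht hs ((1 - (r : ℝ)) * 0 + r * φ 0)]
    congr 1
    ring
  rw [e, add_left_comm, pathClass_arc_add, add_eq_left]
  exact pathClass_arc_self _ _

/-- The class of the cycle of Deninger. -/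
def deningerClass : H1 (hesse t) := loopClass _ (closed_arc_deninger ht hs)

lemma isDeningerClass_iff (b : H1 (hesse t)) : IsDeningerClass b ↔ b = deningerClass ht hs := by
  constructor
  · rintro ⟨g, hg, rfl⟩
    exact loopClass_eq _ _ (hg.pathClass_eq ht hs)
  · rintro rfl
    exact ⟨_, isDeningerLoop_arc ht hs, rfl⟩

end Deninger

lemma triangleFn_conj (t : ℂ) : triangleFn (starRingEnd ℂ t) = triangleFn t := by
  rw [triangleFn, triangleFn, ← map_pow, Complex.conj_re, RCLike.norm_conj]

lemma conj_mem_outerBase {t : ℂ} (ht : t ∈ outerBase) : starRingEnd ℂ t ∈ outerBase := by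
  refine ⟨le_of_le_of_eq ht.1 (triangleFn_conj t).symm, fun h => ht.2 ?_⟩
  simpa using congrArg (starRingEnd ℂ) h

lemma conjMap_affine {t s : ℂ} (h : s = starRingEnd ℂ t) (p : hesse t) {x y : ℂ}
    (hp : (p : P2) = affine x y) :
    (conjMap h p : P2) = affine (starRingEnd ℂ x) (starRingEnd ℂ y) := by
  change Projectivization.map conjLin conjLin_injective p.1 = _
  rw [hp, affine, Projectivization.map_mk, affine]
  congr 1
  ext i
  fin_cases i <;> simp [conjLin]

lemma conj_exp_mul_I (η : ℝ) : starRingEnd ℂ (Complex.exp (η * Complex.I)) =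
    Complex.exp ((-η : ℝ) * Complex.I) := by
  rw [← Complex.exp_conj]; simp

lemma conjMap_torusPt {t s : ℂ} (h : s = starRingEnd ℂ t) (p : hesse t) {η : ℝ} {y : ℂ}
    (hp : (p : P2) = torusPt η y) :
    (conjMap h p : P2) = torusPt (-η) (starRingEnd ℂ y) := by
  rw [conjMap_affine h p hp, torusPt, map_pow, map_mul, conj_exp_mul_I]

lemma outerRoot_conj {t s : ℂ} (ht : t ∈ outerBase) {c : ℝ} (hc : |c| ≤ 1) :
    outerRoot (starRingEnd ℂ t) (starRingEnd ℂ s) c = starRingEnd ℂ (outerRoot t s c) := by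
  have h := csqrt_conj (one_sub_mem_slitPlane ht hc)
  simp only [map_sub, map_one, map_div₀, map_pow, map_mul, Complex.conj_ofNat] at h
  rw [outerRoot, outerRoot, innerRoot_conj ht hc, h]
  simp only [map_div₀, map_add, map_neg, map_mul, Complex.conj_ofNat]

/-- Complex conjugation reverses the cycle of Deninger. -/
lemma H1map_conjMap_of_isDeningerClass {t t' : ℂ} (h : t' = starRingEnd ℂ t) (ht : t ∈ outerBase)
    {γ' : H1 (hesse t)} {γ'' : H1 (hesse t')} (h' : IsDeningerClass γ')
    (h'' : IsDeningerClass γ'') : H1map (conjMap h) γ' = -γ'' := by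
  obtain ⟨s, hs⟩ : ∃ s : ℂ, s ^ 2 = 12 * t := IsAlgClosed.exists_pow_nat_eq _ two_pos
  have ht' : t' ∈ outerBase := h ▸ conj_mem_outerBase ht
  have hs' : starRingEnd ℂ s ^ 2 = 12 * t' := by
    rw [h]; simpa [Complex.conj_ofNat] using congrArg (starRingEnd ℂ) hs
  rw [(isDeningerClass_iff ht hs γ').1 h', (isDeningerClass_iff ht' hs' γ'').1 h'', deningerClass,
    H1map_loopClass]
  apply cycleClass_eq_neg
  change pathClass _ = -pathClass _
  have hconj (η : ℝ) : conjMap h (deninger ht hs η) = deninger ht' hs' (-η) := by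
    apply Subtype.ext
    rw [conjMap_torusPt h _ (deninger_coe ht hs η), deninger_coe]
    subst h
    rw [← outerRoot_conj ht (Real.abs_cos_le_one _), mul_neg, Real.cos_neg]
  have e : (conjMap h).comp (arc (deninger ht hs) 0 (2 * Real.pi)) =
      arc (deninger ht' hs') 0 (-(2 * Real.pi)) := by
    refine ContinuousMap.ext fun r => ?_
    rw [ContinuousMap.comp_apply, arc_apply, hconj, arc_apply]
    congr 1
    ring
  have e2 : arc (deninger ht' hs') (-(2 * Real.pi)) 0 = arc (deninger ht' hs') 0 (2 * Real.pi) := by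
    refine ContinuousMap.ext fun r => ?_
    rw [arc_apply, ← deninger_periodic ht' hs', arc_apply]
    congr 1
    ring
  rw [e, eq_neg_iff_add_eq_zero, ← e2, pathClass_arc_add]
  exact pathClass_arc_self _ _

/-! ### Continuation of classes of loops -/

/-- A family of closed paths over `c` gives the continuation of their classes. -/
lemma isContinuation_loopClass {t₀ t₁ : ℂ} (c : Path t₀ t₁) {F : I × I → P2} (hF : Continuous F)
    (hm : ∀ q, F q ∈ hesse (c q.1)) (hl : ∀ r, F (r, 0) = F (r, 1)) {g₀ : C(I, hesse t₀)}
    {g₁ : C(I, hesse t₁)} (h₀ : ∀ r, (g₀ r : P2) = F (0, r)) (h₁ : ∀ r, (g₁ r : P2) = F (1, r))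
    (hg₀ : g₀ 0 = g₀ 1) (hg₁ : g₁ 0 = g₁ 1) :
    IsContinuation c (loopClass g₀ hg₀) (loopClass g₁ hg₁) := by
  rw [IsContinuation, H1map_loopClass, H1map_loopClass]
  apply loopClass_eq
  let h : C(I × I, pathFamily c) := ⟨fun q => ⟨(q.1, F q), hm q⟩, by fun_prop⟩
  have := pathClass_eq_of_homotopy h fun r =>
    Subtype.ext (congrArg (fun p : P2 => (r, p)) (hl r))
  have e₀ : (fibreIncl c 0 c.source).comp g₀ = h.comp (.prodMk (.const I 0) (.id I)) :=
    ContinuousMap.ext fun r => Subtype.ext (congrArg (fun p : P2 => ((0 : I), p)) (h₀ r))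
  have e₁ : (fibreIncl c 1 c.target).comp g₁ = h.comp (.prodMk (.const I 1) (.id I)) :=
    ContinuousMap.ext fun r => Subtype.ext (congrArg (fun p : P2 => ((1 : I), p)) (h₁ r))
  rw [e₀, e₁, this]

lemma exists_continuous_sqrt (f : C(I, ℂ)) (hf : ∀ r, f r ≠ 0) :
    ∃ g : C(I, ℂ), ∀ r, g r ^ 2 = f r := by
  let γ : C(I, {z : ℂ // z ≠ 0}) := ⟨fun r => ⟨f r, hf r⟩, by fun_prop⟩
  let Γ := Complex.isCoveringMap_exp.liftPath γ (Complex.log (f 0))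
    (Subtype.ext (Complex.exp_log (hf 0)).symm)
  refine ⟨⟨fun r => Complex.exp (Γ r / 2), by fun_prop⟩, fun r => ?_⟩
  have := congrArg Subtype.val (congrFun (Complex.isCoveringMap_exp.liftPath_lifts γ
    (Complex.log (f 0)) (Subtype.ext (Complex.exp_log (hf 0)).symm)) r)
  refine Eq.trans ?_ this
  change Complex.exp (Γ r / 2) ^ 2 = Complex.exp (Γ r)
  rw [← Complex.exp_nat_mul]
  congr 1
  push_cast
  ring

/-- Outside of the interior of the curved triangle, the cycle of Deninger is locally constant: its
standard parametrization depends continuously on `t`, once a square root of `12t` is chosen along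
the path. -/
lemma isContinuation_of_isDeningerClass {t₀ t₁ : ℂ} (c : Path t₀ t₁) (hc : ∀ r, c r ∈ outerBase)
    {b₀ : H1 (hesse t₀)} {b₁ : H1 (hesse t₁)} (h₀ : IsDeningerClass b₀)
    (h₁ : IsDeningerClass b₁) : IsContinuation c b₀ b₁ := by
  obtain ⟨S, hS⟩ := exists_continuous_sqrt ⟨fun r => 12 * c r, by fun_prop⟩ fun r =>
    mul_ne_zero (by norm_num) (ne_zero_of_mem_outerBase (hc r))
  have ht₀ : t₀ ∈ outerBase := c.source ▸ hc 0
  have ht₁ : t₁ ∈ outerBase := c.target ▸ hc 1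
  have hs₀ : S 0 ^ 2 = 12 * t₀ := by rw [hS]; simp
  have hs₁ : S 1 ^ 2 = 12 * t₁ := by rw [hS]; simp
  rw [(isDeningerClass_iff ht₀ hs₀ b₀).1 h₀, (isDeningerClass_iff ht₁ hs₁ b₁).1 h₁]
  obtain ⟨M, hM⟩ := (isCompact_range c.continuous).isBounded.exists_norm_le
  let η : I → ℝ := fun r => (1 - (r : ℝ)) * 0 + r * (2 * Real.pi)
  let F : I × I → P2 := fun q => torusPt (η q.2) (outerRoot (c q.1) (S q.1)
    (Real.cos (3 * η q.2)))
  have hη : Continuous η := by fun_prop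
  refine isContinuation_loopClass (F := F) c ?_ ?_ ?_ ?_ ?_ _ _
  · exact continuous_torusPt (hη.comp continuous_snd) (continuous_outerRoot (M := M)
      (c.continuous.comp continuous_fst) (S.continuous.comp continuous_fst) (by fun_prop)
      (fun q => hc _) (fun q => Real.abs_cos_le_one _) fun q => hM _ ⟨_, rfl⟩)
  · intro q
    exact (deninger (hc q.1) (hS q.1) (η q.2)).2
  · intro r
    have h := congrArg Subtype.val (closed_arc_deninger (hc r) (hS r))
    exact h
  · intro r
    rw [arc_apply, deninger_coe]
    simp only [F, c.source, η]
  · intro r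
    rw [arc_apply, deninger_coe]
    simp only [F, c.target, η]

/-! ### The cycle `|y| = 1` over the negative real axis -/

lemma exists_realRoot {t c : ℝ} (ht : t ≤ 0) (hc : |c| ≤ 1) :
    ∃ x : ℝ, |x| ≤ 2 ∧ x ^ 3 - 3 * t * x + 2 * c = 0 := by
  obtain ⟨h1, h2⟩ := abs_le.1 hc
  have h : (0 : ℝ) ∈ (fun x : ℝ => x ^ 3 - 3 * t * x + 2 * c) '' Set.Icc (-2) 2 :=
    intermediate_value_Icc (by norm_num) (by fun_prop) ⟨by norm_num; linarith,
      by norm_num; linarith⟩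
  obtain ⟨x, hx, h0⟩ := h
  exact ⟨x, abs_le.2 hx, h0⟩

lemma realRoot_unique {t c x x' : ℝ} (ht : t ≤ 0) (h : x ^ 3 - 3 * t * x + 2 * c = 0)
    (h' : x' ^ 3 - 3 * t * x' + 2 * c = 0) : x' = x := by
  have e : (x' - x) * (x' ^ 2 + x' * x + x ^ 2 - 3 * t) = 0 := by linear_combination h' - h
  rcases mul_eq_zero.1 e with e | e
  · linarith
  · have h1 : x' ^ 2 + x' * x + x ^ 2 ≤ 0 := by linarith
    have h2 : x = 0 := by
      by_contra hx
      have := sq_pos_of_ne_zero hx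
      nlinarith [sq_nonneg (2 * x' + x)]
    have h3 : x' = 0 := by
      by_contra hx
      have := sq_pos_of_ne_zero hx
      nlinarith [sq_nonneg (2 * x + x')]
    rw [h2, h3]

open Classical in
/-- The unique real root of `x³ - 3tx + 2c`, for `t ≤ 0` and `|c| ≤ 1`. -/
def realRoot (t c : ℝ) : ℝ :=
  if h : ∃ x : ℝ, |x| ≤ 2 ∧ x ^ 3 - 3 * t * x + 2 * c = 0 then h.choose else 0

lemma realRoot_spec {t c : ℝ} (ht : t ≤ 0) (hc : |c| ≤ 1) :
    |realRoot t c| ≤ 2 ∧ realRoot t c ^ 3 - 3 * t * realRoot t c + 2 * c = 0 := by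
  have h := exists_realRoot ht hc
  rw [realRoot, dif_pos h]
  exact h.choose_spec

lemma realRoot_eq {t c x : ℝ} (ht : t ≤ 0) (hc : |c| ≤ 1) (h : x ^ 3 - 3 * t * x + 2 * c = 0) :
    realRoot t c = x :=
  realRoot_unique ht h (realRoot_spec ht hc).2

lemma realRoot_neg {t c : ℝ} (ht : t ≤ 0) (hc : |c| ≤ 1) : realRoot t (-c) = -realRoot t c :=
  realRoot_eq ht (by rwa [abs_neg]) (by linear_combination -(realRoot_spec ht hc).2)

lemma continuous_realRoot {Y : Type} [TopologicalSpace Y] {T c : Y → ℝ} (hT : Continuous T)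
    (hc : Continuous c) (hT0 : ∀ y, T y ≤ 0) (hc1 : ∀ y, |c y| ≤ 1) :
    Continuous fun y => realRoot (T y) (c y) := by
  refine continuous_of_unique (isCompact_Icc (a := (-2 : ℝ)) (b := 2))
    (r := {q : Y × ℝ | q.2 ^ 3 - 3 * T q.1 * q.2 + 2 * c q.1 = 0})
    (isClosed_eq (by fun_prop) continuous_const) (fun y => ?_) ?_
  · have h := realRoot_spec (hT0 y) (hc1 y)
    exact ⟨abs_le.1 h.1, h.2⟩
  · intro y z _ hz
    exact (realRoot_eq (hT0 y) (hc1 y) hz).symm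

/-- The point `[x : e^{iη} : e^{-iη}]`. -/
def torusPt' (η : ℝ) (x : ℂ) : P2 :=
  affine (x * Complex.exp (η * Complex.I)) (Complex.exp (η * Complex.I) ^ 2)

lemma torusPt'_mem_hesse {t : ℂ} {η : ℝ} {x : ℂ} :
    torusPt' η x ∈ hesse t ↔ x ^ 3 - 3 * t * x + 2 * (Real.cos (3 * η) : ℝ) = 0 := by
  rw [torusPt', affine_mem_hesse, two_cos_three_mul]
  have e0 := Complex.exp_ne_zero (η * Complex.I)
  set e := Complex.exp (η * Complex.I)
  constructor
  · intro h
    field_simp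
    linear_combination h
  · intro h
    field_simp at h
    linear_combination h

lemma torusPt'_add_pi (η : ℝ) (x : ℂ) : torusPt' (η + Real.pi) x = torusPt' η (-x) := by
  rw [torusPt', torusPt', exp_add_pi, neg_sq, mul_neg, neg_mul]

lemma continuous_torusPt' {Y : Type} [TopologicalSpace Y] {η : Y → ℝ} {x : Y → ℂ}
    (hη : Continuous η) (hx : Continuous x) : Continuous fun s => torusPt' (η s) (x s) := by
  have h : Continuous fun s => ((x s * Complex.exp (η s * Complex.I),
    Complex.exp (η s * Complex.I) ^ 2) : ℂ × ℂ) := by fun_prop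
  exact continuous_affine.comp h

/-- For real `t ≤ 0`, the component of the curve `|y| = 1` on which `x²/y` is real, parametrized by
`ℝ` with period `π`. -/
def yCircle {t : ℂ} {r : ℝ} (h : t = r) (hr : r ≤ 0) : C(ℝ, hesse t) where
  toFun η := ⟨torusPt' η (realRoot r (Real.cos (3 * η)) : ℝ), torusPt'_mem_hesse.2 (by
    have := (realRoot_spec hr (Real.abs_cos_le_one (3 * η))).2
    rw [h]
    exact_mod_cast this)⟩
  continuous_toFun := (continuous_torusPt' continuous_id (Complex.continuous_ofReal.comp
    (continuous_realRoot continuous_const (by fun_prop) (fun _ => hr)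
    fun _ => Real.abs_cos_le_one _))).subtype_mk _

lemma yCircle_coe {t : ℂ} {r : ℝ} (h : t = r) (hr : r ≤ 0) (η : ℝ) :
    (yCircle h hr η : P2) = torusPt' η (realRoot r (Real.cos (3 * η)) : ℝ) := rfl

lemma yCircle_periodic {t : ℂ} {r : ℝ} (h : t = r) (hr : r ≤ 0) :
    Function.Periodic (yCircle h hr) Real.pi := by
  intro η
  apply Subtype.ext
  rw [yCircle_coe, yCircle_coe, torusPt'_add_pi, cos_three_mul_add_pi,
    realRoot_neg hr (Real.abs_cos_le_one _), Complex.ofReal_neg, neg_neg]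

lemma closed_arc_yCircle {t : ℂ} {r : ℝ} (h : t = r) (hr : r ≤ 0) :
    arc (yCircle h hr) 0 Real.pi 0 = arc (yCircle h hr) 0 Real.pi 1 := by
  rw [arc_zero, arc_one]
  exact (yCircle_periodic h hr).eq.symm

lemma isContinuation_yCircle {t₀ t₁ : ℂ} (c : Path t₀ t₁) (ρ : C(I, ℝ)) (hc : ∀ s, c s = ρ s)
    (hρ : ∀ s, ρ s ≤ 0) {r₀ r₁ : ℝ} (h₀ : t₀ = r₀) (hr₀ : r₀ ≤ 0) (h₁ : t₁ = r₁) (hr₁ : r₁ ≤ 0) :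
    IsContinuation c (loopClass _ (closed_arc_yCircle h₀ hr₀))
      (loopClass _ (closed_arc_yCircle h₁ hr₁)) := by
  let η : I → ℝ := fun r => (1 - (r : ℝ)) * 0 + r * Real.pi
  have hη : Continuous η := by fun_prop
  let F : I × I → P2 := fun q => torusPt' (η q.2) (realRoot (ρ q.1) (Real.cos (3 * η q.2)) : ℝ)
  have e₀ : ρ 0 = r₀ := by
    have := hc 0; rw [c.source, h₀] at this; exact_mod_cast this.symm
  have e₁ : ρ 1 = r₁ := by
    have := hc 1; rw [c.target, h₁] at this; exact_mod_cast this.symm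
  refine isContinuation_loopClass (F := F) c ?_ ?_ ?_ ?_ ?_ _ _
  · exact continuous_torusPt' (hη.comp continuous_snd) (Complex.continuous_ofReal.comp
      (continuous_realRoot (ρ.continuous.comp continuous_fst) (by fun_prop) (fun q => hρ _)
      fun q => Real.abs_cos_le_one _))
  · intro q
    exact (yCircle (hc q.1) (hρ q.1) (η q.2)).2
  · intro r
    exact congrArg Subtype.val (closed_arc_yCircle (hc r) (hρ r))
  · intro r
    rw [arc_apply, yCircle_coe]
    simp only [F, e₀, η]
  · intro r
    rw [arc_apply, yCircle_coe]
    simp only [F, e₁, η]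

lemma zeta_eq : zeta = Complex.exp ((2 * Real.pi / 3 : ℝ) * Complex.I) := by
  rw [zeta]; congr 1; push_cast; ring

lemma zetaMap_affine {t : ℂ} (p : hesse t) {x y : ℂ} (hp : (p : P2) = affine x y) :
    (zetaMap t p : P2) = affine (zeta * x) (zeta ^ 2 * y) := by
  change Projectivization.map zetaLin zetaLin_injective p.1 = _
  rw [hp, affine, Projectivization.map_mk, affine]
  congr 1

lemma zetaMap_yCircle {t : ℂ} {r : ℝ} (h : t = r) (hr : r ≤ 0) (η : ℝ) :
    zetaMap t (yCircle h hr η) = yCircle h hr (η + 2 * Real.pi / 3) := by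
  apply Subtype.ext
  rw [zetaMap_affine _ (yCircle_coe h hr η), yCircle_coe, torusPt']
  have e : Complex.exp ((η + 2 * Real.pi / 3 : ℝ) * Complex.I) =
      zeta * Complex.exp (η * Complex.I) := by
    rw [zeta_eq, ← Complex.exp_add]; congr 1; push_cast; ring
  rw [e, show 3 * (η + 2 * Real.pi / 3) = 3 * η + 2 * Real.pi by ring, Real.cos_add_two_pi]
  congr 1 <;> ring

lemma zetaMap_comp_arc_yCircle {t : ℂ} {r : ℝ} (h : t = r) (hr : r ≤ 0) (a b : ℝ) :
    (zetaMap t).comp (arc (yCircle h hr) a b) =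
      arc (yCircle h hr) (a + 2 * Real.pi / 3) (b + 2 * Real.pi / 3) := by
  refine ContinuousMap.ext fun s => ?_
  rw [ContinuousMap.comp_apply, arc_apply, zetaMap_yCircle, arc_apply]
  congr 1
  ring

lemma arc_yCircle_sub_pi {t : ℂ} {r : ℝ} (h : t = r) (hr : r ≤ 0) (a b : ℝ) :
    arc (yCircle h hr) (a - Real.pi) (b - Real.pi) = arc (yCircle h hr) a b := by
  refine ContinuousMap.ext fun s => ?_
  rw [arc_apply, arc_apply, ← yCircle_periodic h hr]
  congr 1
  ring

/-- The circle is the sum of the three translates of its third part under the action of `ζ`. As the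
period is `π`, the two translates of `[-π/6, π/6]` are `[π/2, 5π/6]` and `[π/6, π/2]`. -/
lemma pathClass_arc_yCircle {t : ℂ} {r : ℝ} (h : t = r) (hr : r ≤ 0) :
    pathClass (arc (yCircle h hr) (-(Real.pi / 6)) (Real.pi / 6)) +
      pathClass ((zetaMap t).comp (arc (yCircle h hr) (-(Real.pi / 6)) (Real.pi / 6))) +
      pathClass ((zetaMap t).comp ((zetaMap t).comp
        (arc (yCircle h hr) (-(Real.pi / 6)) (Real.pi / 6)))) =
      pathClass (arc (yCircle h hr) 0 Real.pi) := by
  rw [zetaMap_comp_arc_yCircle, zetaMap_comp_arc_yCircle,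
    ← arc_yCircle_sub_pi h hr (-(Real.pi / 6) + 2 * Real.pi / 3 + 2 * Real.pi / 3),
    show -(Real.pi / 6) + 2 * Real.pi / 3 + 2 * Real.pi / 3 - Real.pi = Real.pi / 6 by ring,
    show Real.pi / 6 + 2 * Real.pi / 3 + 2 * Real.pi / 3 - Real.pi =
      -(Real.pi / 6) + 2 * Real.pi / 3 by ring, add_assoc,
    add_comm (pathClass (arc (yCircle h hr) (-(Real.pi / 6) + 2 * Real.pi / 3) _)),
    ← add_assoc, pathClass_arc_add, pathClass_arc_add,
    ← pathClass_arc_add _ _ 0,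
    show Real.pi / 6 + 2 * Real.pi / 3 = -(Real.pi / 6) + Real.pi by ring,
    ← pathClass_arc_add _ 0 Real.pi, add_left_comm]
  have e := arc_yCircle_sub_pi h hr Real.pi (-(Real.pi / 6) + Real.pi)
  rw [sub_self, add_sub_cancel_right] at e
  rw [← e, pathClass_arc_add, add_eq_left]
  exact pathClass_arc_self _ _

/-! ### The two cycles over `t = -100` -/

/-- The product of the roots is `-(y³ + 1)`, which is too small for three roots of absolute value
greater than `9`, while their second symmetric function is `300y`. -/
lemma exists_smallX {y : ℂ} (h1 : 1 ≤ ‖y‖) (h2 : ‖y‖ ≤ 20) :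
    ∃ x : ℂ, ‖x‖ ≤ 9 ∧ x ^ 3 + y ^ 3 + 1 = 3 * (-100) * x * y := by
  obtain ⟨a, b, c, ha, hb, hc⟩ := exists_cubic_roots 0 (300 * y) (y ^ 3 + 1)
  have root (x : ℂ) (hx : (x - a) * (x - b) * (x - c) = 0) :
      x ^ 3 + y ^ 3 + 1 = 3 * (-100) * x * y := by
    linear_combination hx + x ^ 2 * ha + x * hb + hc
  by_contra hcon
  push Not at hcon
  have ha9 : 9 < ‖a‖ := lt_of_not_ge fun h => hcon a h (root a (by ring))
  have hb9 : 9 < ‖b‖ := lt_of_not_ge fun h => hcon b h (root b (by ring))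
  have hc9 : 9 < ‖c‖ := lt_of_not_ge fun h => hcon c h (root c (by ring))
  have e1 : 300 * ‖y‖ ≤ ‖a‖ * ‖b‖ + ‖b‖ * ‖c‖ + ‖c‖ * ‖a‖ := by
    have := norm_add₃_le (a := a * b) (b := b * c) (c := c * a)
    rw [← hb] at this
    simpa using this
  have e2 : ‖a‖ * ‖b‖ * ‖c‖ ≤ ‖y‖ ^ 3 + 1 := by
    have := norm_add_le (y ^ 3) 1
    rw [hc] at this
    simpa using this
  have e3 : ‖a‖ * ‖b‖ * 9 ≤ ‖a‖ * ‖b‖ * ‖c‖ := by gcongr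
  have e4 : ‖b‖ * ‖c‖ * 9 ≤ ‖b‖ * ‖c‖ * ‖a‖ := by gcongr
  have e5 : ‖c‖ * ‖a‖ * 9 ≤ ‖c‖ * ‖a‖ * ‖b‖ := by gcongr
  have e6 : ‖y‖ ^ 2 ≤ 400 := by nlinarith
  have e7 : ‖y‖ ^ 3 ≤ 400 * ‖y‖ := by nlinarith
  nlinarith

lemma smallX_unique {x x' y : ℂ} (h1 : 1 ≤ ‖y‖) (hx : ‖x‖ ≤ 9) (hx' : ‖x'‖ ≤ 9)
    (h : x ^ 3 + y ^ 3 + 1 = 3 * (-100) * x * y) (h' : x' ^ 3 + y ^ 3 + 1 = 3 * (-100) * x' * y) :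
    x' = x := by
  have e : (x' - x) * (x' ^ 2 + x' * x + x ^ 2 + 300 * y) = 0 := by linear_combination h' - h
  rcases mul_eq_zero.1 e with e | e
  · exact sub_eq_zero.1 e
  · exfalso
    have e2 : 300 * y = -(x' ^ 2 + x' * x + x ^ 2) := by linear_combination e
    have e3 := norm_add₃_le (a := x' ^ 2) (b := x' * x) (c := x ^ 2)
    rw [← norm_neg, ← e2, norm_mul, RCLike.norm_ofNat, norm_pow, norm_pow, norm_mul] at e3
    nlinarith [norm_nonneg x, norm_nonneg x']

open Classical in
/-- The small root of the equation of `X_{-100}` over a point `y` with `1 ≤ |y| ≤ 20`. -/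
def smallX (y : ℂ) : ℂ :=
  if h : ∃ x : ℂ, ‖x‖ ≤ 9 ∧ x ^ 3 + y ^ 3 + 1 = 3 * (-100) * x * y then h.choose else 0

lemma smallX_spec {y : ℂ} (h1 : 1 ≤ ‖y‖) (h2 : ‖y‖ ≤ 20) :
    ‖smallX y‖ ≤ 9 ∧ smallX y ^ 3 + y ^ 3 + 1 = 3 * (-100) * smallX y * y := by
  have h := exists_smallX h1 h2
  rw [smallX, dif_pos h]
  exact h.choose_spec

lemma smallX_eq {x y : ℂ} (h1 : 1 ≤ ‖y‖) (h2 : ‖y‖ ≤ 20) (hx : ‖x‖ ≤ 9)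
    (h : affine x y ∈ hesse (-100)) : smallX y = x :=
  smallX_unique h1 hx (smallX_spec h1 h2).1 ((affine_mem_hesse _ _ _).1 h) (smallX_spec h1 h2).2

lemma continuous_smallX {Y : Type} [TopologicalSpace Y] {f : Y → ℂ} (hf : Continuous f)
    (h1 : ∀ y, 1 ≤ ‖f y‖) (h2 : ∀ y, ‖f y‖ ≤ 20) : Continuous fun y => smallX (f y) := by
  refine continuous_of_unique (isCompact_closedBall (0 : ℂ) 9)
    (r := {q : Y × ℂ | q.2 ^ 3 + f q.1 ^ 3 + 1 = 3 * (-100) * q.2 * f q.1})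
    (isClosed_eq (by fun_prop) (by fun_prop)) (fun y => ?_) ?_
  · have h := smallX_spec (h1 y) (h2 y)
    exact ⟨mem_closedBall_zero_iff.2 h.1, h.2⟩
  · intro y z hz hz'
    exact smallX_unique (h1 y) (smallX_spec (h1 y) (h2 y)).1 (mem_closedBall_zero_iff.1 hz)
      (smallX_spec (h1 y) (h2 y)).2 hz'

lemma neg_hundred_mem_outerBase : (-100 : ℂ) ∈ outerBase :=
  mem_outerBase_of_one_lt_norm (by norm_num)

lemma sq_sqrt_mul_I : (((Real.sqrt 1200 : ℝ) : ℂ) * Complex.I) ^ 2 = 12 * (-100) := by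
  rw [mul_pow, Complex.I_sq, ← Complex.ofReal_pow, Real.sq_sqrt (by norm_num)]
  push_cast
  norm_num

/-- With this choice of the square root, the outer root is in the upper half plane, where the
logarithm is continuous. -/
lemma outerRoot_neg_hundred {c : ℝ} (hc : |c| ≤ 1) :
    0 < (outerRoot (-100) ((Real.sqrt 1200 : ℝ) * Complex.I) c).im ∧
      ‖outerRoot (-100) ((Real.sqrt 1200 : ℝ) * Complex.I) c‖ ≤ 20 := by
  have h := innerRoot_conj neg_hundred_mem_outerBase hc
  have e : starRingEnd ℂ (-100) = -100 := by simp [Complex.conj_ofNat]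
  rw [e] at h
  obtain ⟨u, hu⟩ := Complex.conj_eq_iff_real.1 h.symm
  obtain ⟨v, w, hI⟩ := innerRoot_spec neg_hundred_mem_outerBase hc
  have hu1 : |u| ≤ 1 := by
    have := hI.inner
    rwa [hu, Complex.norm_real, Real.norm_eq_abs] at this
  have hq : (1 - (u : ℂ) ^ 2 / (4 * (-100))) = ((1 + u ^ 2 / 400 : ℝ) : ℂ) := by
    push_cast; ring
  have hpos : 0 < 1 + u ^ 2 / 400 := by positivity
  set q : ℝ := (1 + u ^ 2 / 400) ^ (2⁻¹ : ℝ) with hqd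
  have hq2 : csqrt (1 - (u : ℂ) ^ 2 / (4 * (-100))) = (q : ℂ) := by
    rw [hq, csqrt, hqd, Complex.ofReal_cpow hpos.le]
  have hq0 : 0 < q := Real.rpow_pos_of_pos hpos _
  have hqq : q ^ 2 = 1 + u ^ 2 / 400 := by
    rw [hqd, ← Real.rpow_natCast, ← Real.rpow_mul hpos.le]; norm_num
  have hu2 : u ^ 2 ≤ 1 := by nlinarith [sq_abs u, abs_nonneg u]
  have e3 : outerRoot (-100) ((Real.sqrt 1200 : ℝ) * Complex.I) c =
      ((-u / 2 : ℝ) : ℂ) + ((Real.sqrt 1200 * q / 2 : ℝ) : ℂ) * Complex.I := by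
    rw [outerRoot, hu, hq2]; push_cast; ring
  have hs : 0 < Real.sqrt 1200 := Real.sqrt_pos.2 (by norm_num)
  rw [e3]
  constructor
  · simp only [Complex.add_im, Complex.ofReal_im, Complex.mul_im, Complex.ofReal_re, Complex.I_im,
      Complex.I_re]
    have := mul_pos hs hq0
    linarith
  · rw [Complex.norm_add_mul_I]
    refine Real.sqrt_le_iff.2 ⟨by norm_num, ?_⟩
    have hs2 := Real.sq_sqrt (show (0 : ℝ) ≤ 1200 by norm_num)
    have : (-u / 2) ^ 2 + (Real.sqrt 1200 * q / 2) ^ 2 = u ^ 2 / 4 + 300 * (1 + u ^ 2 / 400) := by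
      rw [← hqq]; linear_combination q ^ 2 / 4 * hs2
    rw [this]
    nlinarith

/-- Over `t = -100`, the cycles `|x| = 1 ≤ |y|` and `|y| = 1`, `|x| ≤ 2` are homotopic: the
projection to the `y`-plane identifies both with closed curves in a domain on which `x` is a
function of `y`. -/
lemma loopClass_deninger_eq_yCircle (h : (-100 : ℂ) = ((-100 : ℝ) : ℂ)) (hr : (-100 : ℝ) ≤ 0) :
    deningerClass neg_hundred_mem_outerBase sq_sqrt_mul_I =
      loopClass _ (closed_arc_yCircle h hr) := by
  apply loopClass_eq
  set s : ℂ := (Real.sqrt 1200 : ℝ) * Complex.I with hs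
  let Y : ℝ → ℂ := fun η => outerRoot (-100) s (Real.cos (3 * η))
  have hY (η : ℝ) : 0 < (Y η).im ∧ ‖Y η‖ ≤ 20 := outerRoot_neg_hundred (Real.abs_cos_le_one _)
  have hY0 (η : ℝ) : Y η ≠ 0 := fun h0 => by
    have := (hY η).1; rw [h0] at this; simp at this
  have hY1 (η : ℝ) : 1 ≤ ‖Y η‖ := (outerRoot_spec neg_hundred_mem_outerBase sq_sqrt_mul_I
    (Real.abs_cos_le_one _)).outer
  have hYc : Continuous Y := continuous_outerRoot (M := ‖(-100 : ℂ)‖) continuous_const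
    continuous_const (by fun_prop) (fun _ => neg_hundred_mem_outerBase)
    (fun _ => Real.abs_cos_le_one _) fun _ => le_rfl
  have hlog : Continuous fun η => Complex.log (Y η) :=
    hYc.clog fun η => Or.inr (hY η).1.ne'
  let η : I → ℝ := fun r => (1 - (r : ℝ)) * 0 + r * (2 * Real.pi)
  have hη : Continuous η := by fun_prop
  let f : I × I → ℂ := fun q => Complex.exp ((1 - ((q.1 : ℝ) : ℂ)) * Complex.log (Y (η q.2))) *
    Complex.exp (η q.2 * Complex.I)
  have hf : Continuous f := by
    have : Continuous fun q : I × I => Complex.log (Y (η q.2)) :=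
      hlog.comp (hη.comp continuous_snd)
    have h2 : Continuous fun q : I × I => η q.2 := hη.comp continuous_snd
    fun_prop
  have hfn (q : I × I) : ‖f q‖ = ‖Y (η q.2)‖ ^ (1 - (q.1 : ℝ)) := by
    simp only [f]
    rw [norm_mul, Complex.norm_exp_ofReal_mul_I, mul_one, Complex.norm_exp,
      ← Complex.ofReal_one, ← Complex.ofReal_sub, Complex.re_ofReal_mul, Complex.log_re,
      Real.rpow_def_of_pos (norm_pos_iff.2 (hY0 _)), mul_comm]
  have hf1 (q : I × I) : 1 ≤ ‖f q‖ := by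
    rw [hfn]; exact Real.one_le_rpow (hY1 _) (sub_nonneg.2 q.1.2.2)
  have hf2 (q : I × I) : ‖f q‖ ≤ 20 := by
    rw [hfn]
    calc ‖Y (η q.2)‖ ^ (1 - (q.1 : ℝ)) ≤ ‖Y (η q.2)‖ ^ (1 : ℝ) :=
          Real.rpow_le_rpow_of_exponent_le (hY1 _) (by linarith [q.1.2.1])
      _ ≤ 20 := by rw [Real.rpow_one]; exact (hY _).2
  have hx : Continuous fun q => smallX (f q) := continuous_smallX hf hf1 hf2
  let H : C(I × I, hesse (-100)) := ⟨fun q => ⟨affine (smallX (f q)) (f q),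
    (affine_mem_hesse _ _ _).2 (smallX_spec (hf1 q) (hf2 q)).2⟩,
    (continuous_affine.comp (hx.prodMk hf)).subtype_mk _⟩
  have key := pathClass_eq_of_homotopy H fun r => by
    have : f (r, 0) = f (r, 1) := by
      have hp : Y (η 1) = Y (η 0) := by
        simp only [Y, η]
        congr 1
        rw [show 3 * ((1 - ((1 : I) : ℝ)) * 0 + ((1 : I) : ℝ) * (2 * Real.pi)) =
          0 + (3 : ℕ) * (2 * Real.pi) by simp, Real.cos_add_nat_mul_two_pi]
        simp
      simp only [f, hp]
      congr 1
      simp [η, Complex.exp_two_pi_mul_I]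
    apply Subtype.ext
    show affine (smallX (f (r, 0))) (f (r, 0)) = affine (smallX (f (r, 1))) (f (r, 1))
    rw [this]
  have e0 : arc (deninger neg_hundred_mem_outerBase sq_sqrt_mul_I) 0 (2 * Real.pi) =
      H.comp (.prodMk (.const I 0) (.id I)) := by
    refine ContinuousMap.ext fun r => Subtype.ext ?_
    rw [arc_apply, deninger_coe]
    have hfe : f (0, r) = Y (η r) * Complex.exp (η r * Complex.I) := by
      simp only [f, Set.Icc.coe_zero, Complex.ofReal_zero, sub_zero, one_mul,
        Complex.exp_log (hY0 _)]
    have hm : torusPt (η r) (Y (η r)) ∈ hesse (-100) :=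
      (deninger neg_hundred_mem_outerBase sq_sqrt_mul_I (η r)).2
    have hsm := smallX_eq (x := Complex.exp (η r * Complex.I) ^ 2) (hf1 (0, r)) (hf2 (0, r))
      (by rw [norm_pow, Complex.norm_exp_ofReal_mul_I]; norm_num) (by rw [hfe]; exact hm)
    show torusPt (η r) (Y (η r)) = affine (smallX (f (0, r))) (f (0, r))
    rw [hsm, hfe, torusPt]
  have e1 : arc (yCircle h hr) 0 Real.pi = H.comp (.prodMk (.const I 1) (.id I)) := by
    refine ContinuousMap.ext fun r => Subtype.ext ?_
    rw [arc_apply]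
    have hfe : f (1, r) = Complex.exp (((1 - (r : ℝ)) * 0 + r * Real.pi : ℝ) * Complex.I) ^ 2 := by
      simp only [f, Set.Icc.coe_one, Complex.ofReal_one, sub_self, zero_mul, Complex.exp_zero,
        one_mul, η]
      rw [← Complex.exp_nat_mul]
      congr 1
      push_cast
      ring
    have hm := (yCircle h hr ((1 - (r : ℝ)) * 0 + r * Real.pi)).2
    rw [yCircle_coe, torusPt'] at hm
    have hsm := smallX_eq (x := (realRoot (-100) (Real.cos (3 * ((1 - (r : ℝ)) * 0 + r * Real.pi)))
      : ℝ) * Complex.exp (((1 - (r : ℝ)) * 0 + r * Real.pi : ℝ) * Complex.I))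
      (hf1 (1, r)) (hf2 (1, r)) (by
      rw [norm_mul, Complex.norm_exp_ofReal_mul_I, mul_one, Complex.norm_real, Real.norm_eq_abs]
      exact (realRoot_spec hr (Real.abs_cos_le_one
        (3 * ((1 - (r : ℝ)) * 0 + r * Real.pi)))).1.trans (by norm_num)) (by rw [hfe]; exact hm)
    rw [yCircle_coe]
    show torusPt' _ _ = affine (smallX (f (1, r))) (f (1, r))
    rw [hsm, hfe, torusPt']
  rw [e0, e1]
  exact key

/-! ### A sheet of the curve over the unit disc -/

/-- The principal cube root. -/
def ccbrt (z : ℂ) : ℂ := z ^ ((3⁻¹ : ℝ) : ℂ)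

lemma ccbrt_pow (z : ℂ) : ccbrt z ^ 3 = z := by
  rw [ccbrt]; push_cast; exact Complex.cpow_ofNat_inv_pow z 3

lemma ccbrt_ne_zero {z : ℂ} (hz : z ≠ 0) : ccbrt z ≠ 0 := fun h => by
  have := ccbrt_pow z
  rw [h] at this
  exact hz (by rw [← this]; norm_num)

lemma ccbrt_zero : ccbrt 0 = 0 := by
  have := ccbrt_pow 0
  exact pow_eq_zero_iff (by norm_num) |>.1 this

lemma mem_slitPlane_or_zero {z : ℂ} (hz : 0 ≤ z.re) : z ∈ Complex.slitPlane ∨ z = 0 := by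
  by_cases h : z = 0
  · exact Or.inr h
  · refine Or.inl ?_
    rcases hz.lt_or_eq with h1 | h1
    · exact Or.inl h1
    · exact Or.inr fun h2 => h (Complex.ext h1.symm h2)

lemma csqrt_re_nonneg (z : ℂ) : 0 ≤ (csqrt z).re := by
  by_cases hz : z = 0
  · have := csqrt_sq z
    rw [hz] at this ⊢
    rw [pow_eq_zero_iff (by norm_num)] at this
    simp [this]
  · rw [csqrt, Complex.cpow_def_of_ne_zero hz, Complex.exp_re]
    refine mul_nonneg (Real.exp_pos _).le (Real.cos_nonneg_of_mem_Icc ⟨?_, ?_⟩)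
    · rw [Complex.im_mul_ofReal, Complex.log_im]
      linarith [Complex.neg_pi_lt_arg z]
    · rw [Complex.im_mul_ofReal, Complex.log_im]
      linarith [Complex.arg_le_pi z]

/-- A square root of a number with nonnegative real part has argument between `-π/4` and `π/4`. -/
lemma abs_im_csqrt_le {z : ℂ} (hz : 0 ≤ z.re) : |(csqrt z).im| ≤ (csqrt z).re := by
  have h := congrArg Complex.re (csqrt_sq z)
  rw [pow_two, Complex.mul_re] at h
  exact abs_le_of_sq_le_sq (by nlinarith) (csqrt_re_nonneg z)

lemma re_csqrt_mul_csqrt_nonneg {z w : ℂ} (hz : 0 ≤ z.re) (hw : 0 ≤ w.re) :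
    0 ≤ (csqrt z * csqrt w).re := by
  rw [Complex.mul_re]
  have h1 := abs_im_csqrt_le hz
  have h2 := abs_im_csqrt_le hw
  have h3 := mul_le_mul h1 h2 (abs_nonneg _) (csqrt_re_nonneg z)
  rw [← abs_mul] at h3
  linarith [le_abs_self ((csqrt z).im * (csqrt w).im)]

/-- The number of absolute value one for which `(1 + Z)² - 4r³Z = (1 + kZ)(1 + k̄Z)`. -/
def unitParam (r : ℝ) : ℂ := ⟨1 - 2 * r ^ 3, 2 * Real.sqrt (r ^ 3 - r ^ 6)⟩

lemma continuous_unitParam : Continuous unitParam := by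
  have : unitParam = fun r => ((1 - 2 * r ^ 3 : ℝ) : ℂ) +
      ((2 * Real.sqrt (r ^ 3 - r ^ 6) : ℝ) : ℂ) * Complex.I := by
    ext r
    apply Complex.ext <;> simp [unitParam, -Complex.ofReal_pow]
  rw [this]
  fun_prop

section Sheet

variable {r : ℝ} {z : ℂ}

lemma unitParam_mul_conj (h0 : 0 ≤ r) (h1 : r ≤ 1) :
    unitParam r * starRingEnd ℂ (unitParam r) = 1 := by
  have h : 0 ≤ r ^ 3 - r ^ 6 := by
    have : r ^ 3 ≤ 1 := pow_le_one₀ h0 h1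
    have : 0 ≤ r ^ 3 := by positivity
    nlinarith
  have hs := Real.sq_sqrt h
  rw [Complex.mul_conj, Complex.normSq_apply]
  simp only [unitParam]
  rw [show (1 - 2 * r ^ 3) * (1 - 2 * r ^ 3) + 2 * Real.sqrt (r ^ 3 - r ^ 6) *
    (2 * Real.sqrt (r ^ 3 - r ^ 6)) = 1 by linear_combination 4 * hs]
  simp

lemma unitParam_add_conj (r : ℝ) :
    unitParam r + starRingEnd ℂ (unitParam r) = 2 - 4 * (r : ℂ) ^ 3 := by
  rw [Complex.add_conj]
  simp only [unitParam]
  push_cast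
  ring

lemma norm_unitParam (h0 : 0 ≤ r) (h1 : r ≤ 1) : ‖unitParam r‖ = 1 := by
  have h := unitParam_mul_conj h0 h1
  rw [Complex.mul_conj'] at h
  have : ‖unitParam r‖ ^ 2 = 1 := by exact_mod_cast h
  exact (pow_eq_one_iff_of_nonneg (norm_nonneg _) (by norm_num)).1 this

lemma re_one_add_nonneg {w : ℂ} (hw : ‖w‖ ≤ 1) : 0 ≤ (1 + w).re := by
  have := (abs_le.1 (Complex.abs_re_le_norm w)).1
  simp only [Complex.add_re, Complex.one_re]
  linarith

lemma norm_mul_pow_le {k : ℂ} (hk : ‖k‖ = 1) (hz : ‖z‖ ≤ 1) : ‖k * z ^ 3‖ ≤ 1 := by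
  rw [norm_mul, hk, one_mul, norm_pow]
  exact pow_le_one₀ (norm_nonneg _) hz

/-- A root of `B² - (1 + z³)B + r³z³`, with nonnegative real part for `|z| ≤ 1`. -/
def resolventRoot (r : ℝ) (z : ℂ) : ℂ :=
  (1 + z ^ 3 + csqrt (1 + unitParam r * z ^ 3) *
    csqrt (1 + starRingEnd ℂ (unitParam r) * z ^ 3)) / 2

lemma resolventRoot_eq (h0 : 0 ≤ r) (h1 : r ≤ 1) :
    resolventRoot r z * (1 + z ^ 3 - resolventRoot r z) = (r * z) ^ 3 := by
  have e1 := csqrt_sq (1 + unitParam r * z ^ 3)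
  have e2 := csqrt_sq (1 + starRingEnd ℂ (unitParam r) * z ^ 3)
  have e3 : (csqrt (1 + unitParam r * z ^ 3) *
      csqrt (1 + starRingEnd ℂ (unitParam r) * z ^ 3)) ^ 2 = (1 + z ^ 3) ^ 2 - 4 * (r * z) ^ 3 := by
    rw [mul_pow, e1, e2]
    linear_combination z ^ 6 * unitParam_mul_conj h0 h1 + z ^ 3 * unitParam_add_conj r
  rw [resolventRoot]
  linear_combination -e3 / 4

lemma re_resolventRoot_nonneg (h0 : 0 ≤ r) (h1 : r ≤ 1) (hz : ‖z‖ ≤ 1) :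
    0 ≤ (resolventRoot r z).re := by
  have hn := norm_unitParam h0 h1
  have e1 := re_csqrt_mul_csqrt_nonneg (re_one_add_nonneg (norm_mul_pow_le hn hz))
    (re_one_add_nonneg (norm_mul_pow_le ((RCLike.norm_conj _).trans hn) hz))
  have e2 := re_one_add_nonneg (w := z ^ 3) (by simpa using norm_mul_pow_le norm_one hz)
  rw [resolventRoot, show ∀ w : ℂ, (w / 2).re = w.re / 2 by intro w; simp]
  rw [Complex.add_re _ (csqrt _ * csqrt _)]
  linarith

lemma resolventRoot_zero_left (z : ℂ) : resolventRoot 0 z = 1 + z ^ 3 := by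
  have e : unitParam 0 = 1 := by apply Complex.ext <;> simp [unitParam]
  have := csqrt_sq (1 + z ^ 3)
  rw [resolventRoot, e, map_one, one_mul]
  linear_combination this / 2

lemma eq_zero_of_resolventRoot_eq_zero (h0 : 0 ≤ r) (h1 : r ≤ 1) (h : resolventRoot r z = 0) :
    r = 0 ∧ 1 + z ^ 3 = 0 := by
  have e := resolventRoot_eq (z := z) h0 h1
  rw [h, zero_mul] at e
  rcases mul_eq_zero.1 (pow_eq_zero_iff (by norm_num) |>.1 e.symm) with hr | hz
  · have hr : r = 0 := by exact_mod_cast hr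
    refine ⟨hr, ?_⟩
    rw [hr, resolventRoot_zero_left] at h
    exact h
  · have : csqrt 1 = 1 := by rw [csqrt, Complex.one_cpow]
    rw [resolventRoot, hz] at h
    norm_num [this] at h

/-- The solution `ξ` of `ξ³ + z³ + 1 = 3rzξ` given by Cardano's formula. It is a continuous
function of `0 ≤ r ≤ 1` and `|z| ≤ 1`. If the cube root vanishes then `r = 0`, and
the quotient, which is `0` by convention, has the right value. -/
def sheet (r : ℝ) (z : ℂ) : ℂ :=
  -(ccbrt (resolventRoot r z) + r * z / ccbrt (resolventRoot r z))

lemma sheet_eq (h0 : 0 ≤ r) (h1 : r ≤ 1) :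
    sheet r z ^ 3 + z ^ 3 + 1 = 3 * r * sheet r z * z := by
  have e := resolventRoot_eq (z := z) h0 h1
  by_cases h : resolventRoot r z = 0
  · obtain ⟨hr, hz⟩ := eq_zero_of_resolventRoot_eq_zero h0 h1 h
    rw [sheet, h, ccbrt_zero, hr]
    simp
    linear_combination hz
  · have hc := ccbrt_ne_zero h
    have h3 := ccbrt_pow (resolventRoot r z)
    rw [sheet]
    set c := ccbrt (resolventRoot r z)
    rw [← h3] at e
    field_simp
    linear_combination e

lemma continuous_sheet {Y : Type} [TopologicalSpace Y] {r : Y → ℝ} {z : Y → ℂ}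
    (hr : Continuous r) (hz : Continuous z) (h0 : ∀ y, 0 ≤ r y) (h1 : ∀ y, r y ≤ 1)
    (hz1 : ∀ y, ‖z y‖ ≤ 1) : Continuous fun y => sheet (r y) (z y) := by
  have hk : Continuous fun y => unitParam (r y) := continuous_unitParam.comp hr
  have hk' : Continuous fun y => starRingEnd ℂ (unitParam (r y)) := Complex.continuous_conj.comp hk
  have c1 : Continuous fun y => csqrt (1 + unitParam (r y) * z y ^ 3) :=
    continuous_csqrt (by fun_prop) fun y => mem_slitPlane_or_zero
      (re_one_add_nonneg (norm_mul_pow_le (norm_unitParam (h0 y) (h1 y)) (hz1 y)))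
  have c2 : Continuous fun y => csqrt (1 + starRingEnd ℂ (unitParam (r y)) * z y ^ 3) :=
    continuous_csqrt (by fun_prop) fun y => mem_slitPlane_or_zero
      (re_one_add_nonneg (norm_mul_pow_le ((RCLike.norm_conj _).trans
        (norm_unitParam (h0 y) (h1 y))) (hz1 y)))
  have hB : Continuous fun y => resolventRoot (r y) (z y) := by
    unfold resolventRoot
    exact ((by fun_prop : Continuous fun y => 1 + z y ^ 3).add (c1.mul c2)).div_const 2
  have hc : Continuous fun y => ccbrt (resolventRoot (r y) (z y)) :=
    continuous_iff_continuousAt.2 fun y => (continuousAt_cpow_ofReal (by norm_num)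
      (mem_slitPlane_or_zero (re_resolventRoot_nonneg (h0 y) (h1 y) (hz1 y)))).comp
        (f := fun y => resolventRoot (r y) (z y)) hB.continuousAt
  refine (hc.add (continuous_iff_continuousAt.2 fun y => ?_)).neg
  by_cases h : resolventRoot (r y) (z y) = 0
  · -- the cube of the quotient is bounded by the second root of the resolvent, which vanishes here
    have hle (y : Y) : ‖r y * z y / ccbrt (resolventRoot (r y) (z y))‖ ≤
        ‖1 + z y ^ 3 - resolventRoot (r y) (z y)‖ ^ (3⁻¹ : ℝ) := by
      by_cases h : resolventRoot (r y) (z y) = 0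
      · rw [h, ccbrt_zero, div_zero, norm_zero]
        positivity
      · have e : (r y * z y / ccbrt (resolventRoot (r y) (z y))) ^ 3 =
            1 + z y ^ 3 - resolventRoot (r y) (z y) := by
          rw [div_pow, ccbrt_pow, ← resolventRoot_eq (h0 y) (h1 y)]
          field_simp
        rw [← e, norm_pow, ← Real.rpow_natCast, ← Real.rpow_mul (norm_nonneg _)]
        norm_num
    obtain ⟨hr0, hz0⟩ := eq_zero_of_resolventRoot_eq_zero (h0 y) (h1 y) h
    have hlim : Filter.Tendsto (fun y => ‖1 + z y ^ 3 - resolventRoot (r y) (z y)‖ ^ (3⁻¹ : ℝ))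
        (nhds y) (nhds 0) := by
      have : Continuous fun y => ‖1 + z y ^ 3 - resolventRoot (r y) (z y)‖ ^ (3⁻¹ : ℝ) :=
        Continuous.rpow_const (by fun_prop) fun _ => Or.inr (by norm_num)
      have h2 := this.tendsto y
      rw [h, hz0, sub_zero, norm_zero, Real.zero_rpow (by norm_num)] at h2
      exact h2
    rw [ContinuousAt, h, ccbrt_zero, div_zero]
    exact squeeze_zero_norm hle hlim
  · exact ContinuousAt.div (by fun_prop) hc.continuousAt (ccbrt_ne_zero h)

/-- The sheet contains the point `[0 : 1 : -1]`. -/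
lemma sheet_neg_one (h0 : 0 ≤ r) (h1 : r ≤ 1) : sheet r (-1) = 0 := by
  have hre : 0 ≤ (1 + -unitParam r).re :=
    re_one_add_nonneg (by rw [norm_neg, norm_unitParam h0 h1])
  have hmul (w : ℂ) (hw : 0 ≤ w.re) :
      csqrt w * csqrt (starRingEnd ℂ w) = ((‖csqrt w‖ ^ 2 : ℝ) : ℂ) := by
    have hconj : csqrt (starRingEnd ℂ w) = starRingEnd ℂ (csqrt w) := by
      rcases mem_slitPlane_or_zero hw with h | h
      · exact csqrt_conj h
      · have := csqrt_sq 0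
        rw [pow_eq_zero_iff (by norm_num)] at this
        rw [h, map_zero, this, map_zero]
    rw [hconj, Complex.mul_conj']
    push_cast
    rfl
  obtain ⟨b, hb0, hb⟩ : ∃ b : ℝ, 0 ≤ b ∧ resolventRoot r (-1) = b := by
    refine ⟨‖csqrt (1 + -unitParam r)‖ ^ 2 / 2, by positivity, ?_⟩
    have := hmul _ hre
    simp only [map_add, map_one, map_neg] at this
    rw [resolventRoot]
    norm_num
    simpa using this
  have hc : ccbrt (resolventRoot r (-1)) = ((b ^ (3⁻¹ : ℝ) : ℝ) : ℂ) := by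
    rw [hb, ccbrt, Complex.ofReal_cpow hb0]
  have e := resolventRoot_eq (z := -1) h0 h1
  rw [hb] at e
  have e' : b ^ 2 = r ^ 3 := by
    have : ((b ^ 2 : ℝ) : ℂ) = ((r ^ 3 : ℝ) : ℂ) := by push_cast; linear_combination -e
    exact_mod_cast this
  set c : ℝ := b ^ (3⁻¹ : ℝ) with hcd
  have hc3 : c ^ 3 = b := by
    rw [hcd, ← Real.rpow_natCast, ← Real.rpow_mul hb0]; norm_num
  have hc0 : 0 ≤ c := Real.rpow_nonneg hb0 _
  have hcr : c ^ 2 = r := by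
    refine (pow_left_inj₀ (by positivity) h0 (n := 3) (by norm_num)).1 ?_
    rw [← e', ← hc3]; ring
  rw [sheet, hc, ← hcr]
  by_cases h : c = 0
  · simp [h]
  · have : (c : ℂ) ≠ 0 := by exact_mod_cast h
    push_cast
    field_simp
    ring

end Sheet

/-! ### The polygonal path -/

lemma zeta_re_im : zeta = ⟨-(1 / 2), Real.sqrt 3 / 2⟩ := by
  rw [zeta_eq]
  have h : 2 * Real.pi / 3 = Real.pi - Real.pi / 3 := by ring
  apply Complex.ext
  · rw [Complex.exp_ofReal_mul_I_re, h, Real.cos_pi_sub, Real.cos_pi_div_three]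
  · rw [Complex.exp_ofReal_mul_I_im, h, Real.sin_pi_sub, Real.sin_pi_div_three]

lemma zeta_sq : zeta ^ 2 = ⟨-(1 / 2), -(Real.sqrt 3 / 2)⟩ := by
  have h3 := Real.sq_sqrt (show (0 : ℝ) ≤ 3 by norm_num)
  rw [zeta_re_im, pow_two]
  apply Complex.ext
  · rw [Complex.mul_re]; dsimp only; linear_combination -h3 / 4
  · rw [Complex.mul_im]; dsimp only; ring

lemma norm_zeta : ‖zeta‖ = 1 := by rw [zeta_eq, Complex.norm_exp_ofReal_mul_I]

lemma polygonY_of_le {s : ℝ} (hs : s ≤ 1 / 2) : polygonY s = ⟨-1 - s, Real.sqrt 3 * s⟩ := by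
  rw [polygonY, if_pos hs, zeta_re_im]
  apply Complex.ext
  · simp; ring
  · simp; ring

lemma polygonY_of_ge {s : ℝ} (hs : 1 / 2 ≤ s) :
    polygonY s = ⟨4 * s - 7 / 2, Real.sqrt 3 / 2⟩ := by
  rcases hs.eq_or_lt with rfl | hs
  · rw [polygonY_of_le le_rfl]
    apply Complex.ext
    · norm_num
    · simp only; ring
  · rw [polygonY, if_neg hs.not_ge, zeta_re_im, ← zeta_re_im, zeta_sq, zeta_re_im]
    apply Complex.ext
    · simp; ring
    · simp; ring

lemma continuous_polygonY : Continuous polygonY := by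
  unfold polygonY
  refine Continuous.if_le (by fun_prop) (by fun_prop) continuous_id continuous_const ?_
  rintro s rfl
  push_cast
  ring

lemma normSq_polygonY_of_le {s : ℝ} (hs : s ≤ 1 / 2) :
    ‖polygonY s‖ ^ 2 = (1 + s) ^ 2 + 3 * s ^ 2 := by
  have h3 := Real.sq_sqrt (show (0 : ℝ) ≤ 3 by norm_num)
  rw [← Complex.normSq_eq_norm_sq, polygonY_of_le hs, Complex.normSq_mk]
  linear_combination s ^ 2 * h3

lemma normSq_polygonY_of_ge {s : ℝ} (hs : 1 / 2 ≤ s) :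
    ‖polygonY s‖ ^ 2 = (4 * s - 7 / 2) ^ 2 + 3 / 4 := by
  have h3 := Real.sq_sqrt (show (0 : ℝ) ≤ 3 by norm_num)
  rw [← Complex.normSq_eq_norm_sq, polygonY_of_ge hs, Complex.normSq_mk]
  linear_combination h3 / 4

lemma one_le_norm_polygonY {s : ℝ} (h0 : 0 ≤ s) (hs : s ≤ 3 / 4) : 1 ≤ ‖polygonY s‖ := by
  rw [← one_le_sq_iff₀ (norm_nonneg _)]
  rcases le_total s (1 / 2) with h | h
  · rw [normSq_polygonY_of_le h]; nlinarith
  · rw [normSq_polygonY_of_ge h]; nlinarith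

lemma norm_polygonY_le_one {s : ℝ} (h0 : 3 / 4 ≤ s) (hs : s ≤ 1) : ‖polygonY s‖ ≤ 1 := by
  rw [← sq_le_one_iff₀ (norm_nonneg _), normSq_polygonY_of_ge (by linarith)]
  nlinarith

lemma polygonY_zero : polygonY 0 = -1 := by
  rw [polygonY_of_le (by norm_num)]; apply Complex.ext <;> simp

lemma polygonY_three_quarters : polygonY (3 / 4) = zeta := by
  rw [polygonY_of_ge (by norm_num), zeta_re_im]
  apply Complex.ext <;> norm_num

lemma polygonY_one : polygonY 1 = -zeta ^ 2 := by
  rw [polygonY_of_ge (by norm_num), zeta_sq]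
  apply Complex.ext <;> norm_num

lemma polygonY_pow_six {s : ℝ} (h0 : 0 ≤ s) : polygonY s ^ 6 ≠ -1 := by
  intro h
  have hn : ‖polygonY s‖ ^ 2 = 1 := by
    have := congrArg norm h
    rw [norm_pow, norm_neg, norm_one] at this
    rw [(pow_eq_one_iff_of_nonneg (norm_nonneg _) (by norm_num)).1 this, one_pow]
  have hz6 : zeta ^ 6 = 1 := by
    rw [show zeta ^ 6 = (zeta ^ 3) ^ 2 by ring, zeta_pow_three, one_pow]
  rcases le_total s (1 / 2) with hs | hs
  · rw [normSq_polygonY_of_le hs] at hn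
    have : s = 0 := by nlinarith
    rw [this, polygonY_zero] at h
    norm_num at h
  · rw [normSq_polygonY_of_ge hs] at hn
    have e : (s - 3 / 4) * (s - 1) = 0 := by linear_combination hn / 16
    rcases mul_eq_zero.1 e with e | e
    · rw [sub_eq_zero.1 e, polygonY_three_quarters, hz6] at h
      norm_num at h
    · rw [sub_eq_zero.1 e, polygonY_one, show (-zeta ^ 2) ^ 6 = (zeta ^ 6) ^ 2 by ring, hz6] at h
      norm_num at h

/-- The `x`-coordinate along the path `λ` on `X_r`, for `0 ≤ r ≤ 1`: over the first three quarters
of the polygon, where `|y| ≥ 1`, the sheet is taken in the coordinate `1/y`, then the translate by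
`ζ` of the sheet in the coordinate `y`. -/
def lambdaX (r : ℝ) (s : ℝ) : ℂ :=
  if s ≤ 3 / 4 then sheet r (polygonY s)⁻¹ * polygonY s else zeta * sheet r (zeta * polygonY s)

lemma affine_sheet_inv_mem {t : ℂ} {r : ℝ} (h : t = r) (h0 : 0 ≤ r) (h1 : r ≤ 1) {y : ℂ}
    (hy : y ≠ 0) : affine (sheet r y⁻¹ * y) y ∈ hesse t := by
  have e := sheet_eq (z := y⁻¹) h0 h1
  have hz := mul_inv_cancel₀ hy
  rw [affine_mem_hesse, h]
  linear_combination y ^ 3 * e + (3 * r * sheet r y⁻¹ * y ^ 2 - (y * y⁻¹) ^ 2 - y * y⁻¹ - 1) * hz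

lemma affine_zeta_sheet_mem {t : ℂ} {r : ℝ} (h : t = r) (h0 : 0 ≤ r) (h1 : r ≤ 1) (y : ℂ) :
    affine (zeta * sheet r (zeta * y)) y ∈ hesse t := by
  have e := sheet_eq (z := zeta * y) h0 h1
  rw [affine_mem_hesse, h]
  linear_combination e + (sheet r (zeta * y) ^ 3 - y ^ 3) * zeta_pow_three

lemma lambdaX_mem {t : ℂ} {r : ℝ} (h : t = r) (h0 : 0 ≤ r) (h1 : r ≤ 1) {s : ℝ} (hs : 0 ≤ s) :
    affine (lambdaX r s) (polygonY s) ∈ hesse t := by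
  rw [lambdaX]
  split_ifs with h34
  · have := one_le_norm_polygonY hs h34
    exact affine_sheet_inv_mem h h0 h1 (norm_pos_iff.1 (by linarith))
  · exact affine_zeta_sheet_mem h h0 h1 _

lemma continuous_lambdaX {Y : Type} [TopologicalSpace Y] {r s : Y → ℝ} (hr : Continuous r)
    (hs : Continuous s) (h0 : ∀ y, 0 ≤ r y) (h1 : ∀ y, r y ≤ 1) (hs0 : ∀ y, 0 ≤ s y)
    (hs1 : ∀ y, s y ≤ 1) : Continuous fun y => lambdaX (r y) (s y) := by
  have hY {f : Y → ℝ} (hf : Continuous f) : Continuous fun y => polygonY (f y) :=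
    continuous_polygonY.comp hf
  -- both branches are extended continuously by means of `min` and `max`
  have e (y : Y) : lambdaX (r y) (s y) = if s y ≤ 3 / 4 then
      sheet (r y) (polygonY (min (s y) (3 / 4)))⁻¹ * polygonY (min (s y) (3 / 4)) else
      zeta * sheet (r y) (zeta * polygonY (max (s y) (3 / 4))) := by
    rw [lambdaX]
    split_ifs with h
    · rw [min_eq_left h]
    · rw [max_eq_left (by linarith)]
  simp only [e]
  have hmin (y : Y) : 1 ≤ ‖polygonY (min (s y) (3 / 4))‖ :=
    one_le_norm_polygonY (le_min (hs0 y) (by norm_num)) (min_le_right _ _)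
  have hmax (y : Y) : ‖polygonY (max (s y) (3 / 4))‖ ≤ 1 :=
    norm_polygonY_le_one (le_max_right _ _) (max_le (hs1 y) (by norm_num))
  have c1 := hY (hs.min (continuous_const (y := (3 / 4 : ℝ))))
  have c2 := hY (hs.max (continuous_const (y := (3 / 4 : ℝ))))
  refine Continuous.if_le ?_ ?_ hs continuous_const ?_
  · refine (continuous_sheet hr (c1.inv₀ fun y => norm_pos_iff.1 (by linarith [hmin y])) h0 h1
      fun y => ?_).mul c1
    exact (norm_inv _).trans_le (inv_le_one_of_one_le₀ (hmin y))
  · refine continuous_const.mul (continuous_sheet hr (continuous_const.mul c2) h0 h1 fun y => ?_)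
    rw [norm_mul, norm_zeta, one_mul]
    exact hmax y
  · intro y hy
    rw [hy, min_self, max_self, polygonY_three_quarters]
    have : zeta⁻¹ = zeta * zeta := by
      have := zeta_ne_zero
      field_simp
      linear_combination -zeta_pow_three
    rw [this, mul_comm]

/-- The path `λ` on `X_r`, for `0 ≤ r ≤ 1`. -/
def lambda {t : ℂ} {r : ℝ} (h : t = r) (h0 : 0 ≤ r) (h1 : r ≤ 1) : C(I, hesse t) :=
  ⟨fun s => ⟨affine (lambdaX r s) (polygonY s), lambdaX_mem h h0 h1 s.2.1⟩,
    (continuous_affine.comp ((continuous_lambdaX continuous_const continuous_subtype_val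
      (fun _ => h0) (fun _ => h1) (fun s => s.2.1) fun s => s.2.2).prodMk
      (continuous_polygonY.comp continuous_subtype_val))).subtype_mk _⟩

lemma lambda_coe {t : ℂ} {r : ℝ} (h : t = r) (h0 : 0 ≤ r) (h1 : r ≤ 1) (s : I) :
    (lambda h h0 h1 s : P2) = affine (lambdaX r s) (polygonY s) := rfl

lemma lambda_zero {t : ℂ} {r : ℝ} (h : t = r) (h0 : 0 ≤ r) (h1 : r ≤ 1) :
    lambda h h0 h1 0 = pointP t := by
  apply Subtype.ext
  rw [lambda_coe, Set.Icc.coe_zero, polygonY_zero, lambdaX, if_pos (by norm_num), polygonY_zero,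
    show ((-1 : ℂ))⁻¹ = -1 by norm_num, sheet_neg_one h0 h1, zero_mul]
  rfl

lemma lambda_one {t : ℂ} {r : ℝ} (h : t = r) (h0 : 0 ≤ r) (h1 : r ≤ 1) :
    lambda h h0 h1 1 = zetaMap t (pointP t) := by
  apply Subtype.ext
  rw [lambda_coe, Set.Icc.coe_one, polygonY_one, lambdaX, if_neg (by norm_num), polygonY_one,
    zetaMap_affine (pointP t) (x := 0) (y := -1) rfl,
    show zeta * -zeta ^ 2 = -1 by linear_combination -zeta_pow_three, sheet_neg_one h0 h1]
  simp

/-- The path of `IsLambdaPath` over the base point. -/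
def lambdaPath : Path (pointP basePt) (zetaMap basePt (pointP basePt)) where
  toContinuousMap := lambda basePt_eq baseReal_pos.le baseReal_lt_one.le
  source' := lambda_zero _ _ _
  target' := lambda_one _ _ _

lemma isLambdaPath_lambdaPath : IsLambdaPath lambdaPath := fun _ => ⟨_, rfl⟩

/-- The lift of the polygon is unique: the discriminant of the equation of the curve over the base
point, as a polynomial in `x`, is `-27(y⁶ + 1)`, which does not vanish on the polygon. -/
lemma IsLambdaPath.eq {l : Path (pointP basePt) (zetaMap basePt (pointP basePt))}
    (hl : IsLambdaPath l) : l = lambdaPath := by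
  choose x hx using hl
  have hcx : Continuous x := (continuous_affine_coord (f := fun s => (l s : P2)) (by fun_prop) hx).1
  have hcX : Continuous fun s : I => lambdaX baseReal s :=
    continuous_lambdaX continuous_const continuous_subtype_val (fun _ => baseReal_pos.le)
      (fun _ => baseReal_lt_one.le) (fun s => s.2.1) fun s => s.2.2
  have hcy : Continuous fun s : I => polygonY s := continuous_polygonY.comp continuous_subtype_val
  have e1 (s : I) : x s ^ 3 + polygonY s ^ 3 + 1 = 3 * basePt * x s * polygonY s :=
    (affine_mem_hesse _ _ _).1 (hx s ▸ (l s).2)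
  have e2 (s : I) : lambdaX baseReal s ^ 3 + polygonY s ^ 3 + 1 =
      3 * basePt * lambdaX baseReal s * polygonY s :=
    (affine_mem_hesse _ _ _).1 (lambdaPath s).2
  have hE : IsClosed {s : I | x s = lambdaX baseReal s} := isClosed_eq hcx hcX
  have hF : IsClosed {s : I | x s ^ 2 + x s * lambdaX baseReal s + lambdaX baseReal s ^ 2 =
      3 * basePt * polygonY s} := isClosed_eq (by fun_prop) (by fun_prop)
  have hcover (s : I) : x s = lambdaX baseReal s ∨ x s ^ 2 + x s * lambdaX baseReal s +
      lambdaX baseReal s ^ 2 = 3 * basePt * polygonY s := by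
    have : (x s - lambdaX baseReal s) * (x s ^ 2 + x s * lambdaX baseReal s +
        lambdaX baseReal s ^ 2 - 3 * basePt * polygonY s) = 0 := by
      linear_combination e1 s - e2 s
    rcases mul_eq_zero.1 this with h | h
    · exact Or.inl (sub_eq_zero.1 h)
    · exact Or.inr (sub_eq_zero.1 h)
  have hdisj (s : I) (h1 : x s = lambdaX baseReal s) (h2 : x s ^ 2 + x s * lambdaX baseReal s +
      lambdaX baseReal s ^ 2 = 3 * basePt * polygonY s) : False := by
    rw [← h1] at h2
    have h3 : x s ^ 2 = basePt * polygonY s := by linear_combination h2 / 3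
    have h4 : 2 * x s ^ 3 = polygonY s ^ 3 + 1 := by
      linear_combination -e1 s + 3 * x s * h3
    have h5 : x s ^ 6 = polygonY s ^ 3 / 2 := by
      rw [show x s ^ 6 = (x s ^ 2) ^ 3 by ring, h3, mul_pow, basePt_pow]; ring
    apply polygonY_pow_six s.2.1
    linear_combination 4 * h5 - (2 * x s ^ 3 + polygonY s ^ 3 + 1) * h4
  have hall (s : I) : x s = lambdaX baseReal s := by
    by_contra hcon
    have h0 : x 0 = lambdaX baseReal (0 : I) := by
      have h := hx 0
      rw [l.source, ← lambdaPath.source] at h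
      exact (affine_inj h).1.symm
    obtain ⟨q, -, h1, h2⟩ := isPreconnected_closed_iff.1 isPreconnected_univ _ _ hE hF
      (fun s _ => hcover s) ⟨0, trivial, h0⟩ ⟨s, trivial, (hcover s).resolve_left hcon⟩
    exact hdisj q h1 h2
  ext s
  rw [hx, hall]
  rfl

/-! ### The Fermat cubic -/

lemma ccbrt_one_add_exp {ψ : ℝ} (h1 : -(Real.pi / 2) ≤ ψ) (h2 : ψ ≤ Real.pi / 2) :
    ccbrt (1 + Complex.exp (ψ * Complex.I) ^ 2) =
      ((2 * Real.cos ψ) ^ (3⁻¹ : ℝ) : ℝ) * Complex.exp ((ψ / 3 : ℝ) * Complex.I) := by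
  have hcos := Real.cos_nonneg_of_mem_Icc ⟨h1, h2⟩
  have e : 1 + Complex.exp (ψ * Complex.I) ^ 2 =
      ((2 * Real.cos ψ : ℝ) : ℂ) * Complex.exp (ψ * Complex.I) := by
    have h : ((2 * Real.cos ψ : ℝ) : ℂ) = Complex.exp (ψ * Complex.I) +
        (Complex.exp (ψ * Complex.I))⁻¹ := by
      rw [← Complex.exp_neg, ← neg_mul, ← Complex.two_cos]; push_cast; rfl
    have e0 := Complex.exp_ne_zero (ψ * Complex.I)
    rw [h]
    field_simp
    ring
  rw [e]
  rcases hcos.eq_or_lt with h | h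
  · rw [← h, mul_zero, Complex.ofReal_zero, zero_mul, ccbrt_zero, Real.zero_rpow (by norm_num)]
    simp
  · have hpos : 0 < 2 * Real.cos ψ := by linarith
    have hne : ((2 * Real.cos ψ : ℝ) : ℂ) * Complex.exp (ψ * Complex.I) ≠ 0 :=
      mul_ne_zero (by exact_mod_cast hpos.ne') (Complex.exp_ne_zero _)
    have hlog : Complex.log (Complex.exp (ψ * Complex.I)) = ψ * Complex.I := by
      apply Complex.log_exp
      · simp only [Complex.mul_im, Complex.ofReal_re, Complex.I_im, Complex.ofReal_im,
          Complex.I_re]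
        linarith [Real.pi_pos]
      · simp only [Complex.mul_im, Complex.ofReal_re, Complex.I_im, Complex.ofReal_im,
          Complex.I_re]
        linarith [Real.pi_pos]
    rw [ccbrt, Complex.cpow_def_of_ne_zero hne, Complex.log_ofReal_mul hpos (Complex.exp_ne_zero _),
      hlog, add_mul, Complex.exp_add, Real.rpow_def_of_pos hpos]
    push_cast
    congr 2
    ring

lemma sheet_zero (z : ℂ) : sheet 0 z = -ccbrt (1 + z ^ 3) := by
  rw [sheet, resolventRoot_zero_left]; simp

lemma sheet_zero_conj {z : ℂ} (hz : ‖z‖ ≤ 1) :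
    sheet 0 (starRingEnd ℂ z) = starRingEnd ℂ (sheet 0 z) := by
  have h : 0 ≤ (1 + z ^ 3).re := re_one_add_nonneg (by simpa using norm_mul_pow_le norm_one hz)
  rw [sheet_zero, sheet_zero, map_neg, ← map_pow]
  rcases mem_slitPlane_or_zero h with h | h
  · have := Complex.conj_cpow _ ((3⁻¹ : ℝ) : ℂ) (Complex.slitPlane_arg_ne_pi h)
    rw [map_add, map_one, Complex.conj_ofReal] at this
    rw [ccbrt, this, ccbrt]
  · have h' : 1 + starRingEnd ℂ (z ^ 3) = 0 := by
      simpa using congrArg (starRingEnd ℂ) h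
    rw [h, h', ccbrt_zero, map_zero]

/-- The sheet of the Fermat cubic over the closed unit disc, `z ↦ [ξ : 1 : z]`. -/
def fermatSheet : C(Metric.closedBall (0 : ℂ) 1, hesse 0) where
  toFun z := ⟨toP2 ![sheet 0 z, 1, z], (toP2_mem_hesse fun h => by simpa using congrFun h 1).2 (by
    have := sheet_eq (r := 0) (z := z) le_rfl zero_le_one
    simp [hessePoly] at this ⊢
    linear_combination this)⟩
  continuous_toFun := by
    refine (continuous_toP2 (continuous_pi fun i => ?_)
      fun y h => by simpa using congrFun h 1).subtype_mk _
    have h : Continuous fun z : Metric.closedBall (0 : ℂ) 1 => sheet 0 z :=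
      continuous_sheet continuous_const continuous_subtype_val (fun _ => le_rfl)
        (fun _ => zero_le_one) fun z => mem_closedBall_zero_iff.1 z.2
    fin_cases i
    · exact h
    · exact continuous_const
    · exact continuous_subtype_val

lemma fermatSheet_coe (z : Metric.closedBall (0 : ℂ) 1) (hz : (z : ℂ) ≠ 0) :
    (fermatSheet z : P2) = affine (sheet 0 z * (z : ℂ)⁻¹) (z : ℂ)⁻¹ := by
  change toP2 ![sheet 0 z, 1, z] = _
  rw [affine_eq_toP2, ← toP2_smul (inv_ne_zero hz) ![sheet 0 z, 1, (z : ℂ)]]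
  congr 1
  ext i
  fin_cases i
  · simp [mul_comm]
  · simp
  · simp [hz]

lemma exp_neg_mem (θ : ℝ) : Complex.exp (-(θ * Complex.I)) ∈ Metric.closedBall (0 : ℂ) 1 := by
  rw [mem_closedBall_zero_iff, ← neg_mul, ← Complex.ofReal_neg, Complex.norm_exp_ofReal_mul_I]

/-- The point of the unit circle with argument `-θ`. -/
def discPt (θ : ℝ) : Metric.closedBall (0 : ℂ) 1 := ⟨Complex.exp (-(θ * Complex.I)), exp_neg_mem θ⟩

/-- The boundary of the sheet of the Fermat cubic, parametrized by the argument of `y`. -/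
def fermatArc : C(ℝ, hesse 0) :=
  fermatSheet.comp ⟨discPt, Continuous.subtype_mk (by fun_prop) _⟩

lemma fermatArc_coe (θ : ℝ) : (fermatArc θ : P2) =
    affine (sheet 0 (Complex.exp (-(θ * Complex.I))) * Complex.exp (θ * Complex.I))
      (Complex.exp (θ * Complex.I)) := by
  have := fermatSheet_coe (discPt θ) (Complex.exp_ne_zero _)
  have e : ((discPt θ : ℂ))⁻¹ = Complex.exp (θ * Complex.I) := by
    change (Complex.exp (-(θ * Complex.I)))⁻¹ = _
    rw [Complex.exp_neg, inv_inv]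
  rw [e] at this
  exact this

lemma discPt_add_two_pi (θ : ℝ) : discPt (θ + 2 * Real.pi) = discPt θ := by
  apply Subtype.ext
  change Complex.exp (-((θ + 2 * Real.pi : ℝ) * Complex.I)) = Complex.exp (-(θ * Complex.I))
  rw [← Complex.exp_periodic.sub_eq (-(θ * Complex.I))]
  congr 1
  push_cast
  ring

lemma fermatArc_periodic : Function.Periodic fermatArc (2 * Real.pi) := fun θ =>
  congrArg fermatSheet (discPt_add_two_pi θ)

/-- On the sheet, paths with the same end points are homologous. -/
lemma pathClass_fermatSheet {α β : C(I, Metric.closedBall (0 : ℂ) 1)} (h0 : α 0 = β 0)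
    (h1 : α 1 = β 1) : pathClass (fermatSheet.comp α) = pathClass (fermatSheet.comp β) := by
  have hC : Convex ℝ (Metric.closedBall (0 : ℂ) 1) := convex_closedBall 0 1
  rw [pathClass_comp_eq_segment hC, pathClass_comp_eq_segment hC fermatSheet β, h0, h1]

lemma pathClass_fermatArc_two_pi (a : ℝ) :
    pathClass (arc fermatArc a (a + 2 * Real.pi)) = 0 := by
  rw [← pathClass_const (fermatSheet (discPt a))]
  refine pathClass_fermatSheet (α := ⟨fun s : I =>
    discPt ((1 - (s : ℝ)) * a + s * (a + 2 * Real.pi)),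
    Continuous.subtype_mk (by fun_prop) _⟩) (β := .const I (discPt a)) ?_ ?_
  · change discPt ((1 - ((0 : I) : ℝ)) * a + ((0 : I) : ℝ) * (a + 2 * Real.pi)) = discPt a
    simp
  · change discPt ((1 - ((1 : I) : ℝ)) * a + ((1 : I) : ℝ) * (a + 2 * Real.pi)) = discPt a
    rw [← discPt_add_two_pi a]
    simp

lemma exp_neg_mul_I_pow_three (θ : ℝ) : Complex.exp (-(θ * Complex.I)) ^ 3 =
    Complex.exp ((-(3 * θ / 2) : ℝ) * Complex.I) ^ 2 := by
  rw [← Complex.exp_nat_mul, ← Complex.exp_nat_mul]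
  congr 1
  push_cast
  ring

/-- For `|θ| ≤ π/3`, the boundary of the sheet is part of the circle `yCircle`. -/
lemma fermatArc_eq_yCircle (h : (0 : ℂ) = ((0 : ℝ) : ℂ)) {η : ℝ} (h1 : -(Real.pi / 6) ≤ η)
    (h2 : η ≤ Real.pi / 6) : fermatArc (2 * η) = yCircle h le_rfl η := by
  have hcos : 0 ≤ Real.cos (3 * η) := Real.cos_nonneg_of_mem_Icc ⟨by linarith, by linarith⟩
  have hpow : ((2 * Real.cos (3 * η)) ^ (3⁻¹ : ℝ)) ^ 3 = 2 * Real.cos (3 * η) := by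
    rw [← Real.rpow_natCast, ← Real.rpow_mul (by positivity)]; norm_num
  have hroot : realRoot 0 (Real.cos (3 * η)) = -(2 * Real.cos (3 * η)) ^ (3⁻¹ : ℝ) :=
    realRoot_eq le_rfl (Real.abs_cos_le_one _) (by linear_combination -hpow)
  apply Subtype.ext
  rw [fermatArc_coe, yCircle_coe, hroot, torusPt', sheet_zero, exp_neg_mul_I_pow_three,
    show -(3 * (2 * η) / 2) = -(3 * η) by ring, ccbrt_one_add_exp (by linarith) (by linarith),
    Real.cos_neg, ← Complex.exp_nat_mul]
  congr 1
  · rw [Complex.ofReal_neg, neg_mul, neg_mul, mul_assoc, ← Complex.exp_add]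
    congr 3
    push_cast
    ring
  · congr 1
    push_cast
    ring

/-- On the arc `π/3 ≤ arg y ≤ 2π/3`, the sheet in the coordinate `1/y` meets the translate of the
sheet in the coordinate `y`. -/
lemma zeta_mul_sheet {θ : ℝ} (h1 : Real.pi / 3 ≤ θ) (h2 : θ ≤ 2 * Real.pi / 3) :
    zeta * sheet 0 (zeta * Complex.exp (θ * Complex.I)) =
      sheet 0 (Complex.exp (-(θ * Complex.I))) * Complex.exp (θ * Complex.I) := by
  have e1 : (zeta * Complex.exp (θ * Complex.I)) ^ 3 =
      Complex.exp ((3 * θ / 2 - Real.pi : ℝ) * Complex.I) ^ 2 := by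
    rw [mul_pow, zeta_pow_three, one_mul, ← Complex.exp_nat_mul, ← Complex.exp_nat_mul,
      ← Complex.exp_periodic.sub_eq]
    congr 1
    push_cast
    ring
  have e2 : Complex.exp (-(θ * Complex.I)) ^ 3 =
      Complex.exp ((-(3 * θ / 2 - Real.pi) : ℝ) * Complex.I) ^ 2 := by
    rw [← Complex.exp_nat_mul, ← Complex.exp_nat_mul, ← Complex.exp_periodic]
    congr 1
    push_cast
    ring
  rw [sheet_zero, sheet_zero, e1, e2, ccbrt_one_add_exp (by linarith) (by linarith),
    ccbrt_one_add_exp (by linarith) (by linarith), Real.cos_neg, zeta_eq, mul_neg, neg_mul,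
    mul_left_comm, mul_assoc, ← Complex.exp_add, ← Complex.exp_add]
  congr 3
  push_cast
  ring

/-- Over the first three quarters of the polygon, the path `λ` is on the sheet, and homologous to
the arc of its boundary from `arg y = π` to `arg y = 2π/3`. -/
lemma pathClass_lambda_left {g : C(I, hesse 0)}
    (hg : ∀ s : I, (g s : P2) = affine (lambdaX 0 (s * (3 / 4))) (polygonY (s * (3 / 4)))) :
    pathClass g = pathClass (arc fermatArc Real.pi (2 * Real.pi / 3)) := by
  have hs0 (s : I) : 0 ≤ (s : ℝ) * (3 / 4) := mul_nonneg s.2.1 (by norm_num)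
  have hs1 (s : I) : (s : ℝ) * (3 / 4) ≤ 3 / 4 := by linarith [s.2.2]
  have hn (s : I) : 1 ≤ ‖polygonY (s * (3 / 4))‖ := one_le_norm_polygonY (hs0 s) (hs1 s)
  have hy (s : I) : polygonY (s * (3 / 4)) ≠ 0 := norm_pos_iff.1 (by linarith [hn s])
  have hc : Continuous fun s : I => (polygonY (s * (3 / 4)))⁻¹ :=
    (continuous_polygonY.comp (by fun_prop)).inv₀ hy
  obtain ⟨α, hα⟩ : ∃ α : C(I, Metric.closedBall (0 : ℂ) 1), ∀ s,
      (α s : ℂ) = (polygonY (s * (3 / 4)))⁻¹ :=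
    ⟨⟨fun s => ⟨(polygonY (s * (3 / 4)))⁻¹, mem_closedBall_zero_iff.2
      ((norm_inv _).trans_le (inv_le_one_of_one_le₀ (hn s)))⟩, hc.subtype_mk _⟩, fun _ => rfl⟩
  obtain ⟨β, hβ⟩ : ∃ β : C(I, Metric.closedBall (0 : ℂ) 1), ∀ s : I,
      β s = discPt ((1 - (s : ℝ)) * Real.pi + s * (2 * Real.pi / 3)) :=
    ⟨⟨_, Continuous.subtype_mk (by fun_prop) _⟩, fun _ => rfl⟩
  have hdisc (θ : ℝ) : (discPt θ : ℂ) = Complex.exp (-(θ * Complex.I)) := rfl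
  have e0 : α 0 = β 0 := by
    apply Subtype.ext
    rw [hα, hβ, hdisc]
    simp only [Set.Icc.coe_zero, zero_mul, polygonY_zero, sub_zero, one_mul, add_zero]
    rw [Complex.exp_neg, Complex.exp_pi_mul_I]
  have e1 : α 1 = β 1 := by
    apply Subtype.ext
    rw [hα, hβ, hdisc]
    simp only [Set.Icc.coe_one, one_mul, polygonY_three_quarters, sub_self, zero_mul, zero_add]
    rw [Complex.exp_neg, ← zeta_eq]
  have h1 : g = fermatSheet.comp α := by
    refine ContinuousMap.ext fun s => Subtype.ext ?_
    rw [ContinuousMap.comp_apply, fermatSheet_coe _ (by rw [hα]; exact inv_ne_zero (hy s)), hα,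
      inv_inv, hg, lambdaX, if_pos (hs1 s)]
  have h2 : arc fermatArc Real.pi (2 * Real.pi / 3) = fermatSheet.comp β := by
    refine ContinuousMap.ext fun s => ?_
    rw [ContinuousMap.comp_apply, hβ]
    rfl
  rw [h1, h2, pathClass_fermatSheet e0 e1]

/-- Over the last quarter of the polygon, the path `λ` is on the translate of the sheet by `ζ`; the
arc of the boundary of this translate with the same end points is also on the first sheet. -/
lemma pathClass_lambda_right (h : (0 : ℂ) = ((0 : ℝ) : ℂ)) {g : C(I, hesse 0)}
    (hg : ∀ s : I, (g s : P2) = affine (lambdaX 0 ((1 - (s : ℝ)) * (3 / 4) + s * 1))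
      (polygonY ((1 - (s : ℝ)) * (3 / 4) + s * 1))) :
    pathClass g = pathClass (arc fermatArc (2 * Real.pi / 3) (Real.pi / 3)) := by
  have hπ := Real.pi_pos
  have hw (w : Metric.closedBall (0 : ℂ) 1) : affine (zeta * sheet 0 w) (zeta ^ 2 * w) ∈
      hesse 0 := by
    have := affine_zeta_sheet_mem h le_rfl zero_le_one (zeta ^ 2 * w)
    rwa [← mul_assoc, ← pow_succ', zeta_pow_three, one_mul] at this
  obtain ⟨G, hG⟩ : ∃ G : C(Metric.closedBall (0 : ℂ) 1, hesse 0), ∀ w,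
      (G w : P2) = affine (zeta * sheet 0 w) (zeta ^ 2 * w) :=
    ⟨⟨fun w => ⟨_, hw w⟩, (continuous_affine.comp ((continuous_const.mul
      (continuous_sheet continuous_const continuous_subtype_val (fun _ => le_rfl)
      (fun _ => zero_le_one) fun z => mem_closedBall_zero_iff.1 z.2)).prodMk
      (continuous_const.mul continuous_subtype_val))).subtype_mk _⟩, fun _ => rfl⟩
  have hs0 (s : I) : 3 / 4 ≤ (1 - (s : ℝ)) * (3 / 4) + s * 1 := by linarith [s.2.1]
  have hs1 (s : I) : (1 - (s : ℝ)) * (3 / 4) + s * 1 ≤ 1 := by linarith [s.2.2]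
  obtain ⟨α, hα⟩ : ∃ α : C(I, Metric.closedBall (0 : ℂ) 1), ∀ s : I,
      (α s : ℂ) = zeta * polygonY ((1 - (s : ℝ)) * (3 / 4) + s * 1) :=
    ⟨⟨fun s => ⟨zeta * polygonY ((1 - (s : ℝ)) * (3 / 4) + s * 1), mem_closedBall_zero_iff.2 (by
      rw [norm_mul, norm_zeta, one_mul]; exact norm_polygonY_le_one (hs0 s) (hs1 s))⟩,
      (continuous_const.mul (continuous_polygonY.comp (by fun_prop))).subtype_mk _⟩,
      fun _ => rfl⟩
  let θ : I → ℝ := fun s => (1 - (s : ℝ)) * (2 * Real.pi / 3) + s * (Real.pi / 3)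
  obtain ⟨β, hβ⟩ : ∃ β : C(I, Metric.closedBall (0 : ℂ) 1), ∀ s : I,
      (β s : ℂ) = zeta * Complex.exp (θ s * Complex.I) :=
    ⟨⟨fun s => ⟨zeta * Complex.exp (θ s * Complex.I), mem_closedBall_zero_iff.2 (by
      rw [norm_mul, norm_zeta, one_mul, Complex.norm_exp_ofReal_mul_I])⟩,
      Continuous.subtype_mk (by fun_prop) _⟩, fun _ => rfl⟩
  have e0 : α 0 = β 0 := by
    apply Subtype.ext
    rw [hα, hβ]
    simp only [θ, Set.Icc.coe_zero, zero_mul, sub_zero, one_mul, add_zero, polygonY_three_quarters,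
      ← zeta_eq]
  have e1 : α 1 = β 1 := by
    apply Subtype.ext
    rw [hα, hβ]
    simp only [θ, Set.Icc.coe_one, sub_self, zero_mul, one_mul, zero_add, polygonY_one]
    rw [zeta_eq, ← Complex.exp_nat_mul, ← neg_one_mul (Complex.exp _), ← Complex.exp_pi_mul_I,
      ← Complex.exp_add, ← Complex.exp_periodic.sub_eq (Real.pi * Complex.I + _)]
    congr 2
    push_cast
    ring
  have hC : Convex ℝ (Metric.closedBall (0 : ℂ) 1) := convex_closedBall 0 1
  have key : pathClass (G.comp α) = pathClass (G.comp β) := by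
    rw [pathClass_comp_eq_segment hC, pathClass_comp_eq_segment hC G β, e0, e1]
  have hζ (y : ℂ) : zeta ^ 2 * (zeta * y) = y := by
    linear_combination y * zeta_pow_three
  have h1 : g = G.comp α := by
    refine ContinuousMap.ext fun s => Subtype.ext ?_
    rw [ContinuousMap.comp_apply, hG, hα, hg, hζ]
    rcases (hs0 s).eq_or_lt with h34 | h34
    · rw [← h34, polygonY_three_quarters, lambdaX, if_pos le_rfl, polygonY_three_quarters]
      have : zeta⁻¹ = zeta * zeta := by
        have := zeta_ne_zero
        field_simp
        linear_combination -zeta_pow_three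
      rw [this, mul_comm]
    · rw [lambdaX, if_neg h34.not_ge]
  have h2 : arc fermatArc (2 * Real.pi / 3) (Real.pi / 3) = G.comp β := by
    refine ContinuousMap.ext fun s => Subtype.ext ?_
    rw [ContinuousMap.comp_apply, hG, hβ, hζ, arc_apply, fermatArc_coe,
      zeta_mul_sheet (by simp only [θ]; nlinarith [s.2.1, s.2.2])
      (by simp only [θ]; nlinarith [s.2.1, s.2.2])]
  rw [h1, h2, key]

/-- The path `λ` on the Fermat cubic is homologous to the boundary of the sheet from `arg y = π` to
`arg y = π/3`. -/
lemma pathClass_lambda (h : (0 : ℂ) = ((0 : ℝ) : ℂ)) :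
    pathClass (lambda h le_rfl zero_le_one) =
      pathClass (arc fermatArc Real.pi (Real.pi / 3)) := by
  let r : I := ⟨3 / 4, by norm_num, by norm_num⟩
  have hr : (r : ℝ) = 3 / 4 := rfl
  rw [pathClass_split _ r, ← pathClass_arc_add fermatArc _ (2 * Real.pi / 3)]
  congr 1
  · apply pathClass_lambda_left
    intro s
    have ep : (Set.projIcc (0 : ℝ) 1 zero_le_one ((1 - (s : ℝ)) * 0 + s * r) : ℝ) =
        s * (3 / 4) := by
      rw [mul_zero, zero_add, hr]
      exact congrArg Subtype.val (Set.projIcc_of_mem _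
        ⟨mul_nonneg s.2.1 (by norm_num), by linarith [s.2.2]⟩)
    rw [arc_apply, ContinuousMap.comp_apply, lambda_coe, ContinuousMap.coe_mk, ep]
  · apply pathClass_lambda_right h
    intro s
    have ep : (Set.projIcc (0 : ℝ) 1 zero_le_one ((1 - (s : ℝ)) * r + s * 1) : ℝ) =
        (1 - (s : ℝ)) * (3 / 4) + s * 1 := by
      rw [hr]
      exact congrArg Subtype.val (Set.projIcc_of_mem _
        ⟨by linarith [s.2.1, s.2.2], by linarith [s.2.1, s.2.2]⟩)
    rw [arc_apply, ContinuousMap.comp_apply, lambda_coe, ContinuousMap.coe_mk, ep]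

lemma conjMap_fermatArc (h : (0 : ℂ) = starRingEnd ℂ 0) (θ : ℝ) :
    conjMap h (fermatArc θ) = fermatArc (-θ) := by
  apply Subtype.ext
  have hn : ‖Complex.exp (-(θ * Complex.I))‖ ≤ 1 := mem_closedBall_zero_iff.1 (exp_neg_mem θ)
  have e : starRingEnd ℂ (Complex.exp (-(θ * Complex.I))) =
      Complex.exp (-((-θ : ℝ) * Complex.I)) := by
    rw [← Complex.exp_conj]; simp
  rw [conjMap_affine h _ (fermatArc_coe θ), fermatArc_coe, map_mul, ← sheet_zero_conj hn, e,
    conj_exp_mul_I]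

/-- On the Fermat cubic, `λ - F_∞(λ)` is homologous to a third of the circle `yCircle`: together
with the complementary arc of the boundary of the sheet, it bounds the sheet. -/
lemma pathClass_lambda_sub (h : (0 : ℂ) = ((0 : ℝ) : ℂ)) (h' : (0 : ℂ) = starRingEnd ℂ 0) :
    pathClass (lambda h le_rfl zero_le_one) -
      ChainClass.map (conjMap h') (pathClass (lambda h le_rfl zero_le_one)) =
    pathClass (arc (yCircle h le_rfl) (-(Real.pi / 6)) (Real.pi / 6)) := by
  have e1 : (conjMap h').comp (arc fermatArc Real.pi (Real.pi / 3)) =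
      arc fermatArc Real.pi (5 * Real.pi / 3) := by
    refine ContinuousMap.ext fun s => ?_
    rw [ContinuousMap.comp_apply, arc_apply, conjMap_fermatArc, arc_apply, ← fermatArc_periodic]
    congr 1
    ring
  have e2 : arc (yCircle h le_rfl) (-(Real.pi / 6)) (Real.pi / 6) =
      arc fermatArc (-(Real.pi / 3)) (Real.pi / 3) := by
    refine ContinuousMap.ext fun s => ?_
    rw [arc_apply, arc_apply, ← fermatArc_eq_yCircle h
      (by nlinarith [s.2.1, s.2.2, Real.pi_pos]) (by nlinarith [s.2.1, s.2.2, Real.pi_pos])]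
    congr 1
    ring
  have e3 := pathClass_fermatArc_two_pi (-(Real.pi / 3))
  rw [show -(Real.pi / 3) + 2 * Real.pi = 5 * Real.pi / 3 by ring,
    ← pathClass_arc_add _ _ (Real.pi / 3)] at e3
  have e4 := pathClass_arc_add fermatArc (Real.pi / 3) Real.pi (5 * Real.pi / 3)
  have e5 := pathClass_arc_add fermatArc (Real.pi / 3) Real.pi (Real.pi / 3)
  rw [pathClass_arc_self] at e5
  rw [pathClass_lambda, ChainClass.map_pathClass, e1, e2, eq_neg_of_add_eq_zero_left e3, ← e4,
    eq_neg_of_add_eq_zero_right e5]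
  abel

/-! ### Continuation of the cycle `A` to the Fermat cubic -/

section Symmetrization

variable {t : ℂ}

/-- The chain `(1 + ζ + ζ²)(l)`. -/
def symChain (l : C(I, hesse t)) : ModuleCat.of ℚ ℚ ⟶ (Chains (hesse t)).X 1 :=
  pathChain l + pathChain ((zetaMap t).comp l) + pathChain ((zetaMap t).comp ((zetaMap t).comp l))

lemma symChain_d {l : C(I, hesse t)} (h : l 1 = zetaMap t (l 0)) :
    symChain l ≫ (Chains (hesse t)).d 1 0 = 0 := by
  simp only [symChain, Preadditive.add_comp, pathChain_d]
  simp [h, zetaMap_three]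

/-- The endomorphism `1 + m + m²`. -/
def symmetrize {G : Type} [AddCommGroup G] (m : G →+ G) : G →+ G :=
  AddMonoidHom.id G + m + m.comp m

lemma symmetrize_apply {G : Type} [AddCommGroup G] (m : G →+ G) (x : G) :
    symmetrize m x = x + m x + m (m x) := rfl

lemma mk_symChain (l : C(I, hesse t)) : (QuotientAddGroup.mk (symChain l) : ChainClass (hesse t)) =
    symmetrize (ChainClass.map (zetaMap t)) (pathClass l) := by
  rw [symmetrize_apply, ChainClass.map_pathClass, ChainClass.map_pathClass]
  rfl

end Symmetrization

lemma lambda_closed {t : ℂ} {r : ℝ} (h : t = r) (h0 : 0 ≤ r) (h1 : r ≤ 1) :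
    lambda h h0 h1 1 = zetaMap t (lambda h h0 h1 0) := by
  rw [lambda_one, lambda_zero]

/-- The class of the cycle `A` on `X_r`, for `0 ≤ r ≤ 1`. -/
def lambdaClass {t : ℂ} {r : ℝ} (h : t = r) (h0 : 0 ≤ r) (h1 : r ≤ 1) : H1 (hesse t) :=
  cycleClass _ (symChain_d (lambda_closed h h0 h1))

lemma isClassA_iff (a : H1 (hesse basePt)) :
    IsClassA a ↔ a = lambdaClass basePt_eq baseReal_pos.le baseReal_lt_one.le := by
  constructor
  · rintro ⟨l, hl, rfl⟩
    obtain rfl := hl.eq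
    rfl
  · rintro rfl
    exact ⟨lambdaPath, isLambdaPath_lambdaPath, rfl⟩

/-- The action of `ζ` on a family of curves. -/
def zetaFamily {t₀ t₁ : ℂ} (c : Path t₀ t₁) : C(pathFamily c, pathFamily c) where
  toFun x := ⟨(x.1.1, Projectivization.map zetaLin zetaLin_injective x.1.2),
    zeta_mem (show x.1.2 ∈ hesse (c x.1.1) from x.2)⟩
  continuous_toFun := (continuous_subtype_val.fst.prodMk ((continuous_projectivization_map _
    zetaLin_injective continuous_zetaLin).comp continuous_subtype_val.snd)).subtype_mk _

lemma zetaFamily_three {t₀ t₁ : ℂ} (c : Path t₀ t₁) (x : pathFamily c) :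
    zetaFamily c (zetaFamily c (zetaFamily c x)) = x := by
  obtain ⟨⟨s, p⟩, hp⟩ := x
  have := congrArg Subtype.val (zetaMap_three (c s) ⟨p, hp⟩)
  exact Subtype.ext (Prod.ext rfl this)

lemma mk_symChain_fibreIncl {t₀ t₁ : ℂ} (c : Path t₀ t₁) (s : I) {t : ℂ} (h : c s = t)
    (l : C(I, hesse t)) :
    (QuotientAddGroup.mk (symChain l ≫ (chainsMap (fibreIncl c s h)).f 1) :
      ChainClass (pathFamily c)) =
      symmetrize (ChainClass.map (zetaFamily c)) (pathClass ((fibreIncl c s h).comp l)) := by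
  rw [← ChainClass.map_mk, mk_symChain, symmetrize_apply, symmetrize_apply, map_add, map_add]
  simp only [ChainClass.map_pathClass]
  rfl

/-- Over a real path, the cycles `(1 + ζ + ζ²)(λ)` are continued into each other: the tracks of the
two end points of `λ` are exchanged by `ζ`, and cancel. -/
lemma isContinuation_lambdaClass {t₀ t₁ : ℂ} (c : Path t₀ t₁) (ρ : C(I, ℝ)) (hc : ∀ s, c s = ρ s)
    (hρ0 : ∀ s, 0 ≤ ρ s) (hρ1 : ∀ s, ρ s ≤ 1) {r₀ r₁ : ℝ} (h₀ : t₀ = r₀) (h₀0 : 0 ≤ r₀)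
    (h₀1 : r₀ ≤ 1) (h₁ : t₁ = r₁) (h₁0 : 0 ≤ r₁) (h₁1 : r₁ ≤ 1) :
    IsContinuation c (lambdaClass h₀ h₀0 h₀1) (lambdaClass h₁ h₁0 h₁1) := by
  have e₀ : ρ 0 = r₀ := by
    have := hc 0; rw [c.source, h₀] at this; exact_mod_cast this.symm
  have e₁ : ρ 1 = r₁ := by
    have := hc 1; rw [c.target, h₁] at this; exact_mod_cast this.symm
  have hX : Continuous fun q : I × I => lambdaX (ρ q.1) q.2 :=
    continuous_lambdaX (ρ.continuous.comp continuous_fst)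
      (continuous_subtype_val.comp continuous_snd) (fun q => hρ0 _) (fun q => hρ1 _)
      (fun q => q.2.2.1) fun q => q.2.2.2
  have hY : Continuous fun q : I × I => polygonY q.2 :=
    continuous_polygonY.comp (continuous_subtype_val.comp continuous_snd)
  let h : C(I × I, pathFamily c) := ⟨fun q => ⟨(q.1, affine (lambdaX (ρ q.1) q.2) (polygonY q.2)),
    lambdaX_mem (hc q.1) (hρ0 q.1) (hρ1 q.1) q.2.2.1⟩,
    (continuous_fst.prodMk (continuous_affine.comp (hX.prodMk hY))).subtype_mk _⟩
  have key := pathClass_square h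
  let m := ChainClass.map (zetaFamily c)
  let τ : C(I, pathFamily c) := h.comp (.prodMk (.id I) (.const I 0))
  have hτ : pathClass (h.comp (.prodMk (.id I) (.const I 1))) = m (pathClass τ) := by
    rw [ChainClass.map_pathClass]
    congr 1
    refine ContinuousMap.ext fun s => Subtype.ext (Prod.ext rfl ?_)
    have h1 := congrArg Subtype.val (lambda_closed (hc s) (hρ0 s) (hρ1 s))
    exact h1
  have hm3 : m (m (m (pathClass τ))) = pathClass τ := by
    simp only [m, ChainClass.map_pathClass]
    congr 1
    exact ContinuousMap.ext fun s => zetaFamily_three c (τ s)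
  have l₀ : h.comp (.prodMk (.const I 0) (.id I)) =
      (fibreIncl c 0 c.source).comp (lambda h₀ h₀0 h₀1) := by
    refine ContinuousMap.ext fun s => Subtype.ext (Prod.ext rfl ?_)
    change affine (lambdaX (ρ 0) s) (polygonY s) = affine (lambdaX r₀ s) (polygonY s)
    rw [e₀]
  have l₁ : h.comp (.prodMk (.const I 1) (.id I)) =
      (fibreIncl c 1 c.target).comp (lambda h₁ h₁0 h₁1) := by
    refine ContinuousMap.ext fun s => Subtype.ext (Prod.ext rfl ?_)
    change affine (lambdaX (ρ 1) s) (polygonY s) = affine (lambdaX r₁ s) (polygonY s)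
    rw [e₁]
  rw [hτ, l₀, l₁] at key
  -- `1 + ζ + ζ²` takes the same value on the tracks `τ` and `ζ τ` of the two end points
  have key2 := congrArg (symmetrize m) key
  rw [map_add, map_add] at key2
  have hs : symmetrize m (m (pathClass τ)) = symmetrize m (pathClass τ) := by
    rw [symmetrize_apply, symmetrize_apply, hm3]; abel
  rw [hs, add_comm (symmetrize m (pathClass _)) (symmetrize m _)] at key2
  rw [IsContinuation, lambdaClass, lambdaClass, H1map_cycleClass, H1map_cycleClass]
  apply cycleClass_eq
  rw [mk_symChain_fibreIncl, mk_symChain_fibreIncl]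
  exact add_left_cancel key2

/-- Over a real path, continuation is compatible with complex conjugation. -/
lemma IsContinuation.conj {t₀ t₁ : ℂ} {c : Path t₀ t₁} (hc : ∀ s, c s = starRingEnd ℂ (c s))
    (h₀ : t₀ = starRingEnd ℂ t₀) (h₁ : t₁ = starRingEnd ℂ t₁) {a : H1 (hesse t₀)}
    {b : H1 (hesse t₁)} (h : IsContinuation c a b) :
    IsContinuation c (H1map (conjMap h₀) a) (H1map (conjMap h₁) b) := by
  let F : C(pathFamily c, pathFamily c) :=
    ⟨fun x => ⟨(x.1.1, Projectivization.map conjLin conjLin_injective x.1.2),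
      conj_mem (hc x.1.1) (show x.1.2 ∈ hesse (c x.1.1) from x.2)⟩,
      (continuous_subtype_val.fst.prodMk ((continuous_projectivization_map _
      conjLin_injective continuous_conjLin).comp continuous_subtype_val.snd)).subtype_mk _⟩
  have f₀ : F.comp (fibreIncl c 0 c.source) = (fibreIncl c 0 c.source).comp (conjMap h₀) := rfl
  have f₁ : F.comp (fibreIncl c 1 c.target) = (fibreIncl c 1 c.target).comp (conjMap h₁) := rfl
  rw [IsContinuation, ← H1map_comp, ← H1map_comp, ← f₀, ← f₁, H1map_comp, H1map_comp, h]

lemma IsContinuation.sub {t₀ t₁ : ℂ} {c : Path t₀ t₁} {a a' : H1 (hesse t₀)} {b b' : H1 (hesse t₁)}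
    (h : IsContinuation c a b) (h' : IsContinuation c a' b') :
    IsContinuation c (a - a') (b - b') := by
  rw [IsContinuation, map_sub, map_sub, h, h']

/-- Complex conjugation conjugates the action of `ζ` to the action of `ζ² = ζ⁻¹`, so it preserves
the image of `1 + ζ + ζ²`. -/
lemma conjMap_comp_zetaMap (h : (0 : ℂ) = starRingEnd ℂ 0) :
    (conjMap h).comp (zetaMap 0) = (zetaMap 0).comp ((zetaMap 0).comp (conjMap h)) := by
  have hz : starRingEnd ℂ zeta = zeta ^ 2 := by
    rw [zeta_sq, zeta_re_im]; apply Complex.ext <;> simp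
  refine ContinuousMap.ext fun p => Subtype.ext ?_
  obtain ⟨p, hp⟩ := p
  change Projectivization.map conjLin conjLin_injective
    (Projectivization.map zetaLin zetaLin_injective p) =
    Projectivization.map zetaLin zetaLin_injective (Projectivization.map zetaLin zetaLin_injective
    (Projectivization.map conjLin conjLin_injective p))
  induction p using Projectivization.ind with
  | h v hv =>
    simp only [Projectivization.map_mk]
    congr 1
    ext i
    fin_cases i
    · simp [conjLin, zetaLin, hz]
      ring
    · simp [conjLin, zetaLin, hz]
      ring
    · simp [conjLin, zetaLin]

lemma map_conjMap_symmetrize (h : (0 : ℂ) = starRingEnd ℂ 0) (l : C(I, hesse 0)) :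
    ChainClass.map (conjMap h) (symmetrize (ChainClass.map (zetaMap 0)) (pathClass l)) =
      symmetrize (ChainClass.map (zetaMap 0)) (ChainClass.map (conjMap h) (pathClass l)) := by
  have e1 (l : C(I, hesse 0)) : (conjMap h).comp ((zetaMap 0).comp l) =
      (zetaMap 0).comp ((zetaMap 0).comp ((conjMap h).comp l)) :=
    congrArg (fun f => ContinuousMap.comp f l) (conjMap_comp_zetaMap h)
  have e2 (l : C(I, hesse 0)) : (zetaMap 0).comp ((zetaMap 0).comp ((zetaMap 0).comp l)) = l :=
    ContinuousMap.ext fun s => zetaMap_three 0 (l s)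
  simp only [symmetrize_apply, map_add, ChainClass.map_pathClass]
  rw [e1, e1, e1, e2]
  abel

/-- On the Fermat cubic, the class `A - F_∞(A)` is the class of the circle `yCircle`. -/
lemma lambdaClass_sub (h : (0 : ℂ) = ((0 : ℝ) : ℂ)) (h' : (0 : ℂ) = starRingEnd ℂ 0) :
    lambdaClass h le_rfl zero_le_one - H1map (conjMap h') (lambdaClass h le_rfl zero_le_one) =
      loopClass _ (closed_arc_yCircle h le_rfl) := by
  rw [lambdaClass, H1map_cycleClass, ← cycleClass_sub]
  apply cycleClass_eq
  rw [QuotientAddGroup.mk_sub, ← ChainClass.map_mk, mk_symChain, map_conjMap_symmetrize, ← map_sub,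
    pathClass_lambda_sub, symmetrize_apply, ChainClass.map_pathClass, ChainClass.map_pathClass]
  exact pathClass_arc_yCircle h le_rfl

/-! ### Continuation along admissible paths -/

/-- The slit plane is star-shaped, so continuation along its paths only depends on the end
points. -/
lemma IsContinuation.of_slitBase {t₀ t₁ : ℂ} {c c' : Path t₀ t₁} (hc : ∀ s, c s ∈ slitBase)
    (hc' : ∀ s, c' s ∈ slitBase) {a : H1 (hesse t₀)} {b : H1 (hesse t₁)}
    (h : IsContinuation c a b) : IsContinuation c' a b := by
  have := starConvex_slitBase.contractibleSpace ⟨t₀, c.source ▸ hc 0⟩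
  let lift (c : Path t₀ t₁) (hc : ∀ s, c s ∈ slitBase) :
      Path (X := slitBase) ⟨t₀, c.source ▸ hc 0⟩ ⟨t₁, c.target ▸ hc 1⟩ :=
    { toFun := fun s => ⟨c s, hc s⟩
      continuous_toFun := c.continuous.subtype_mk _
      source' := Subtype.ext c.source
      target' := Subtype.ext c.target }
  obtain ⟨H⟩ := SimplyConnectedSpace.paths_homotopic (lift c hc) (lift c' hc')
  let H' := H.map (⟨Subtype.val, continuous_subtype_val⟩ : C(slitBase, ℂ))
  exact IsContinuation.of_homotopy (c := c) (c' := c') H' (fun x => slitBase_subset (H x).2) h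

/-- The class `A - F_∞(A)` is continued to the cycle of Deninger over the sector, along the real
axis via the Fermat cubic to `t = -100`, and then outside of the triangle. -/
lemma exists_continuation_sector {t : ℂ} (ht : t ∈ outerBase) (hs : t ∈ sector)
    {b : H1 (hesse t)} (hb : IsDeningerClass b) :
    ∃ c : Path basePt t, (∀ s, c s ∈ slitBase) ∧ IsContinuation c
      (antiInvariantPart (lambdaClass basePt_eq baseReal_pos.le baseReal_lt_one.le)) b := by
  have h0 : (0 : ℂ) = ((0 : ℝ) : ℂ) := by simp
  have h0' : (0 : ℂ) = starRingEnd ℂ 0 := by simp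
  have h100 : (-100 : ℂ) = ((-100 : ℝ) : ℂ) := by push_cast; rfl
  have h100' : (-100 : ℝ) ≤ 0 := by norm_num
  let ρ₀ : C(I, ℝ) := ⟨fun s => (1 - (s : ℝ)) * baseReal, by fun_prop⟩
  let c₀ : Path basePt 0 :=
    { toFun := fun s => (ρ₀ s : ℂ)
      continuous_toFun := by fun_prop
      source' := by simp [ρ₀, basePt_eq]
      target' := by simp [ρ₀] }
  have hρ₀ (s : I) : 0 ≤ ρ₀ s := mul_nonneg (by linarith [s.2.2]) baseReal_pos.le
  have hρ₁ (s : I) : ρ₀ s < 1 := by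
    have : ρ₀ s = (1 - (s : ℝ)) * baseReal := rfl
    nlinarith [s.2.1, baseReal_pos, baseReal_lt_one]
  let ρ₁ : C(I, ℝ) := ⟨fun s => (s : ℝ) * (-100), by fun_prop⟩
  let c₁ : Path (0 : ℂ) (-100) :=
    { toFun := fun s => (ρ₁ s : ℂ)
      continuous_toFun := by fun_prop
      source' := by simp [ρ₁]
      target' := by simp [ρ₁] }
  have hρ₂ (s : I) : ρ₁ s ≤ 0 := mul_nonpos_of_nonneg_of_nonpos s.2.1 (by norm_num)
  obtain ⟨c₂, hc₂⟩ := joinedIn_sector ht hs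
  have k₀ := isContinuation_lambdaClass c₀ ρ₀ (fun _ => rfl) hρ₀ (fun s => (hρ₁ s).le)
    basePt_eq baseReal_pos.le baseReal_lt_one.le h0 le_rfl zero_le_one
  have k₁ := k₀.sub (k₀.conj (fun s => (Complex.conj_ofReal _).symm) basePt_eq_conj h0')
  rw [lambdaClass_sub] at k₁
  have k₂ := k₁.trans (isContinuation_yCircle c₁ ρ₁ (fun _ => rfl) hρ₂ h0 le_rfl h100 h100')
  rw [← loopClass_deninger_eq_yCircle] at k₂
  have k₃ := k₂.trans (isContinuation_of_isDeningerClass c₂ (fun s => (hc₂ s).1)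
    ((isDeningerClass_iff neg_hundred_mem_outerBase sq_sqrt_mul_I _).2 rfl) hb)
  refine ⟨_, fun s => ?_, k₃⟩
  rw [Path.trans_apply]
  split_ifs
  · rw [Path.trans_apply]
    split_ifs
    · exact ofReal_mem_slitBase (hρ₁ _)
    · exact ofReal_mem_slitBase ((hρ₂ _).trans_lt one_pos)
  · exact sector_subset (hc₂ _).2

lemma exists_isDeningerClass {t : ℂ} (ht : t ∈ outerBase) :
    ∃! b : H1 (hesse t), IsDeningerClass b := by
  obtain ⟨s, hs⟩ : ∃ s : ℂ, s ^ 2 = 12 * t := IsAlgClosed.exists_pow_nat_eq _ two_pos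
  exact ⟨deningerClass ht hs, (isDeningerClass_iff ht hs _).2 rfl,
    fun b hb => (isDeningerClass_iff ht hs b).1 hb⟩

/-- The restriction of an admissible path up to the boundary of the triangle is homotopic in the
slit plane to a path along which the continuation is known; on the rest of the path, the cycle of
Deninger is locally constant. -/
lemma IsAdmissible.isContinuation {t : ℂ} {c : Path basePt t} (hc : IsAdmissible c)
    {b : H1 (hesse t)} (hb : IsDeningerClass b) : IsContinuation c
      (antiInvariantPart (lambdaClass basePt_eq baseReal_pos.le baseReal_lt_one.le)) b := by
  obtain ⟨hS, s₀, hK, hsec, hout⟩ := hc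
  have hmem (s : I) (h : s₀ ≤ s) : c s ∈ outerBase := ⟨triangleFn_nonneg (hout s h), hS s⟩
  obtain ⟨b', hb', -⟩ := exists_isDeningerClass (hmem s₀ le_rfl)
  obtain ⟨c', hc', hcont⟩ := exists_continuation_sector (hmem s₀ le_rfl) hsec hb'
  generalize antiInvariantPart (lambdaClass basePt_eq baseReal_pos.le baseReal_lt_one.le) = a
    at hcont ⊢
  obtain ⟨α, hα⟩ : ∃ α : C(I, I), ∀ s, α s = s * s₀ :=
    ⟨⟨fun s => s * s₀, by fun_prop⟩, fun _ => rfl⟩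
  obtain ⟨β, hβ⟩ : ∃ β : C(I, I), ∀ s, β s = max s s₀ :=
    ⟨⟨fun s => max s s₀, by fun_prop⟩, fun _ => rfl⟩
  have hα0 : α 0 = 0 := by rw [hα, zero_mul]
  have hα1 : α 1 = s₀ := by rw [hα, one_mul]
  have hβ0 : β 0 = s₀ := (hβ 0).trans (max_eq_right s₀.2.1)
  have hβ1 : β 1 = 1 := (hβ 1).trans (max_eq_left s₀.2.2)
  obtain ⟨d₀, hd₀⟩ : ∃ d : Path basePt (c s₀), ∀ s, d s = c (α s) :=
    ⟨⟨c.toContinuousMap.comp α, by simp [hα0], by simp [hα1]⟩, fun _ => rfl⟩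
  obtain ⟨d₁, hd₁⟩ : ∃ d : Path (c s₀) t, ∀ s, d s = c (β s) :=
    ⟨⟨c.toContinuousMap.comp β, by simp [hβ0], by simp [hβ1]⟩, fun _ => rfl⟩
  have k₀ : IsContinuation d₀ a b' := hcont.of_slitBase hc' fun s => by
    rw [hd₀, hα]
    exact mem_slitBase (hK _ (mul_le_of_le_one_left s₀.2.1 s.2.2)) (hS _)
  have k₁ : IsContinuation d₁ b' b := isContinuation_of_isDeningerClass d₁
    (fun s => by rw [hd₁, hβ]; exact hmem _ (le_max_right _ _)) hb' hb
  exact IsContinuation.concat (c := c) (c₀ := d₀) (c₁ := d₁) α β hd₀ hd₁ hα0 (hα1.trans hβ0.symm)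
    hβ1 k₀ k₁

end HesseCubic

end

theorem proposition4p6 (t : ℂ) (ht : t ∈ HesseCubic.smoothBase)
    (htK : t ∉ interior HesseCubic.curvedTriangle) :
    -- the cycles `A` and `γ'` are well defined, and the paths of continuation exist
    (∃! A, HesseCubic.IsClassA A) ∧
    (∃! γ' : HesseCubic.H1 (HesseCubic.hesse t), HesseCubic.IsDeningerClass γ') ∧
    (∃ c : Path HesseCubic.basePt t, HesseCubic.IsAdmissible c) ∧
    -- `γ'` lies in the minus part for `F_∞`, which sends `X_t` to the curve of the conjugate of `t`
    (∀ (t' : ℂ) (h : t' = starRingEnd ℂ t) (γ' : HesseCubic.H1 (HesseCubic.hesse t))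
      (γ'' : HesseCubic.H1 (HesseCubic.hesse t')),
      HesseCubic.IsDeningerClass γ' → HesseCubic.IsDeningerClass γ'' →
        HesseCubic.H1map (HesseCubic.conjMap h) γ' = -γ'') ∧
    -- the continuation of `A - F_∞(A)` to `t` is `γ'`
    ∀ (A : HesseCubic.H1 (HesseCubic.hesse HesseCubic.basePt))
      (γ' : HesseCubic.H1 (HesseCubic.hesse t)) (c : Path HesseCubic.basePt t),
      HesseCubic.IsClassA A → HesseCubic.IsDeningerClass γ' → HesseCubic.IsAdmissible c →
        ∀ γ : HesseCubic.H1 (HesseCubic.hesse t),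
          HesseCubic.IsContinuation c (HesseCubic.antiInvariantPart A) γ ↔ γ = γ' := by
  have hto : t ∈ HesseCubic.outerBase := ⟨HesseCubic.triangleFn_nonneg htK, ht⟩
  refine ⟨⟨_, (HesseCubic.isClassA_iff _).2 rfl, fun a ha => (HesseCubic.isClassA_iff a).1 ha⟩,
    HesseCubic.exists_isDeningerClass hto, HesseCubic.exists_isAdmissible hto,
    fun t' h γ' γ'' h' h'' => HesseCubic.H1map_conjMap_of_isDeningerClass h hto h' h'', ?_⟩
  intro A γ' c hA hγ' hc γ
  obtain rfl := (HesseCubic.isClassA_iff A).1 hA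
  have k := hc.isContinuation hγ'
  -- the inclusion of the last fibre is injective on homology, so the continuation is unique
  exact ⟨fun h => HesseCubic.injective_H1map_fibreIncl c hc.1 (h.symm.trans k), fun h => h ▸ k⟩
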